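/- Let $k$ be a finite product of fields, $k\cong k_1\times\cdots\times k_n$ with $n\ge 1$. Let $\mathrm{Ch}$ be the category of non-negatively graded (homological) chain complexes of $k$-modules with its usual tensor product, in which a (connective) dg-coalgebra over $k$ is a coassociative counital coalgebra. Let $C$ be a simply connected dg-coalgebra over $k$, that is, $C_0=k$ and $C_1=0$, and let $X$ be any right $C$-comodule in $\mathrm{Ch}$, with coaction $\rho$. A weak equivalence of right $C$-comodules is a morphism of comodules that induces an isomorphism in homology. The two-sided cosimplicial cobar construction $\Omega^\bullet(X,C,C)$ is the cosimplicial right $C$-comodule with $\Omega^m(X,C,C)=X\otimes C^{\otimes m+1}$ for $m\ge 0$ (a cofree comodule on the last factor), with cofaces $d^0=\rho\otimes\mathrm{id}$ and, for $1\le i\le m+1$, $d^i$ the comultiplication applied to the $i$-th factor $C$, and with codegeneracies $s^j$, $0\le j\le m$, the counit applied to the $(j+1)$-st factor $C$; it is coaugmented by $\rho\colon X\to X\otimes C$. For a simplicial set $S$ and a right $C$-comodule $A$ let $S\otimes A=N_*(S;k)\otimes A$ (normalized chains), and let $A\mapsto A^S$ be the right adjoint of $A\mapsto S\otimes A$ on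 right $C$-comodules. Let $\Omega(X,C,C)$ be the homotopy limit of $\Omega^\bullet(X,C,C)$ in the category of right $C$-comodules, computed as the end $$\Omega(X,C,C)=\int_{[m]\in\Delta}\Omega^m(X,C,C)^{N(\Delta\downarrow[m])}$$ taken in right $C$-comodules, where $N(\Delta\downarrow[m])$ is the nerve of the category of objects of $\Delta$ over $[m]$. Then this end exists, and the morphism of right $C$-comodules $$X\longrightarrow\Omega(X,C,C)$$ induced by the coaugmentation (and the maps $N(\Delta\downarrow[m])\to *$) is a weak equivalence. -/

import Mathlib

open CategoryTheory MonoidalCategory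

universe v u

namespace DGComod

noncomputable section

/-! ### Right comodules over a comonoid in a monoidal category -/

section Comodules

variable {V : Type u} [Category.{v} V] [MonoidalCategory V]

/-- A right comodule over the comonoid (coassociative counital coalgebra) `C` in `V`. -/
structure RightComodule (C : V) [ComonObj C] where
  /-- the underlying object -/
  X : V
  /-- the right coaction -/
  ρ : X ⟶ X ⊗ C
  coassoc : ρ ≫ X ◁ ComonObj.comul (X := C) = ρ ≫ ρ ▷ C ≫ (α_ X C C).hom
  counit : ρ ≫ X ◁ ComonObj.counit (X := C) = (ρ_ X).inv

namespace RightComodule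

variable {C : V} [ComonObj C]

/-- Morphisms of right comodules: morphisms in `V` which commute with the coactions. -/
@[ext]
structure Hom (A B : RightComodule C) where
  /-- the underlying morphism -/
  hom : A.X ⟶ B.X
  comm : A.ρ ≫ hom ▷ C = hom ≫ B.ρ

/-- The category of right `C`-comodules in `V`. -/
instance : Category (RightComodule C) where
  Hom A B := Hom A B
  id A := ⟨𝟙 A.X, by simp⟩
  comp f g := ⟨f.hom ≫ g.hom, by
    rw [comp_whiskerRight, ← Category.assoc, f.comm, Category.assoc, g.comm, Category.assoc]⟩

@[ext]
theorem hom_ext {A B : RightComodule C} {f g : A ⟶ B} (h : f.hom = g.hom) : f = g :=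
  Hom.ext h

@[simp]
theorem id_hom (A : RightComodule C) : Hom.hom (𝟙 A) = 𝟙 A.X := rfl

@[simp]
theorem comp_hom {A B D : RightComodule C} (f : A ⟶ B) (g : B ⟶ D) :
    (f ≫ g).hom = f.hom ≫ g.hom := rfl

variable (C) in
/-- The cofree right comodule `M ⊗ C`, with coaction induced by the comultiplication. -/
@[simps, reducible]
def cofree (M : V) : RightComodule C where
  X := M ⊗ C
  ρ := M ◁ ComonObj.comul ≫ (α_ M C C).inv
  coassoc := by
    have h := congrArg (fun t => M ◁ t) (ComonObj.comul_assoc (X := C))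
    simp only [whiskerLeft_comp] at h
    simp only [Category.assoc, comp_whiskerRight, ← associator_inv_naturality_right]
    rw [reassoc_of% h]
    simp
  counit := by
    have h := congrArg (fun t => M ◁ t) (ComonObj.comul_counit (X := C))
    simp only [whiskerLeft_comp] at h
    rw [Category.assoc, ← associator_inv_naturality_right, reassoc_of% h]
    simp

variable (C) in
/-- Functoriality of the cofree comodule: `f ⊗ id_C`. -/
@[simps]
def cofreeMap {M N : V} (f : M ⟶ N) : cofree C M ⟶ cofree C N where
  hom := f ▷ C
  comm := by
    rw [Category.assoc, ← associator_inv_naturality_left, whisker_exchange_assoc]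

/-- The coaction, as a morphism of comodules `A ⟶ A ⊗ C` into the cofree comodule. -/
@[simps]
def coaction (A : RightComodule C) : A ⟶ cofree C A.X where
  hom := A.ρ
  comm := by
    rw [cofree_ρ, ← Category.assoc, A.coassoc]
    simp

variable (C) in
/-- The map `id_M ⊗ ε : M ⊗ C ⟶ M` of `V`; it is not a morphism of comodules. -/
def counitMap (M : V) : M ⊗ C ⟶ M :=
  M ◁ ComonObj.counit ≫ (ρ_ M).hom

/-- The tensor product `W ⊗ A` of an object `W` of `V` and a right comodule `A`, with coaction
`id_W ⊗ ρ`. -/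
@[simps, reducible]
def tensorLeft (W : V) (A : RightComodule C) : RightComodule C where
  X := W ⊗ A.X
  ρ := W ◁ A.ρ ≫ (α_ W A.X C).inv
  coassoc := by
    have h := congrArg (fun t => W ◁ t) A.coassoc
    simp only [whiskerLeft_comp] at h
    simp only [Category.assoc, comp_whiskerRight, ← associator_inv_naturality_right]
    rw [reassoc_of% h]
    simp
  counit := by
    have h := congrArg (fun t => W ◁ t) A.counit
    simp only [whiskerLeft_comp] at h
    rw [Category.assoc, ← associator_inv_naturality_right, reassoc_of% h]
    simp

/-- `f ⊗ g : W ⊗ A ⟶ W' ⊗ B` as a morphism of comodules. -/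
@[simps]
def tensorMap {W W' : V} (f : W ⟶ W') {A B : RightComodule C} (g : A ⟶ B) :
    tensorLeft W A ⟶ tensorLeft W' B where
  hom := f ⊗ₘ g.hom
  comm := by
    have h := congrArg (fun t => W ◁ t) g.comm
    simp only [whiskerLeft_comp] at h
    simp only [tensorHom_def', Category.assoc, comp_whiskerRight]
    rw [← associator_inv_naturality_middle_assoc, reassoc_of% h,
      ← associator_inv_naturality_left, whisker_exchange_assoc]

theorem tensorMap_comp_tensorMap {W W' W'' : V} (f : W ⟶ W') (f' : W' ⟶ W'')
    (A : RightComodule C) :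
    tensorMap f (𝟙 A) ≫ tensorMap f' (𝟙 A) = tensorMap (f ≫ f') (𝟙 A) := by
  ext; simp

/-- The unit isomorphism `𝟙_ ⊗ A ⟶ A` as a morphism of comodules. -/
@[simps]
def tensorUnitHom (A : RightComodule C) : tensorLeft (𝟙_ V) A ⟶ A where
  hom := (λ_ A.X).hom
  comm := by simp

end RightComodule

end Comodules

/-! ### Cosimplicial objects and their homotopy limits -/

/-- A cosimplicial object of a category, presented by its cofaces `d^i`, its codegeneracies `s^j`
and the cosimplicial identities. -/
structure Cosimplicial (D : Type u) [Category.{v} D] where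
  /-- the object in cosimplicial degree `n` -/
  obj : ℕ → D
  /-- the cofaces -/
  d : ∀ n : ℕ, Fin (n + 2) → (obj n ⟶ obj (n + 1))
  /-- the codegeneracies -/
  s : ∀ n : ℕ, Fin (n + 1) → (obj (n + 1) ⟶ obj n)
  d_comp_d : ∀ (n : ℕ) (i j : Fin (n + 2)), i ≤ j →
    d n i ≫ d (n + 1) j.succ = d n j ≫ d (n + 1) i.castSucc
  d_comp_s_of_le : ∀ (n : ℕ) (i : Fin (n + 2)) (j : Fin (n + 1)), i ≤ j.castSucc →
    d (n + 1) i.castSucc ≫ s (n + 1) j.succ = s n j ≫ d n i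
  d_comp_s_self : ∀ (n : ℕ) (i : Fin (n + 1)), d n i.castSucc ≫ s n i = 𝟙 (obj n)
  d_comp_s_succ : ∀ (n : ℕ) (i : Fin (n + 1)), d n i.succ ≫ s n i = 𝟙 (obj n)
  d_comp_s_of_gt : ∀ (n : ℕ) (i : Fin (n + 2)) (j : Fin (n + 1)), j.castSucc < i →
    d (n + 1) i.succ ≫ s (n + 1) j.castSucc = s n j ≫ d n i
  s_comp_s : ∀ (n : ℕ) (i j : Fin (n + 1)), i ≤ j →
    s (n + 1) i.castSucc ≫ s n j = s (n + 1) j.succ ≫ s n i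

section WeightedLimits

variable {V : Type u} [Category.{v} V] [MonoidalCategory V] {C : V} [ComonObj C]

/-- A cone over the cosimplicial comodule `F` with weight `W`: a comodule `pt` together with
morphisms of comodules `W [n] ⊗ pt ⟶ F n` which are compatible with the cofaces and
codegeneracies, hence with all morphisms `[m] ⟶ [n]`.
Equivalently, a morphism from `pt` to the end over `[n]` of the cotensors `(F n) ^ (W [n])`. -/
structure WeightedCone (W : SimplexCategory ⥤ V) (F : Cosimplicial (RightComodule C)) where
  /-- the vertex of the cone -/
  pt : RightComodule C
  /-- the legs of the cone -/
  π : ∀ n : ℕ, RightComodule.tensorLeft (W.obj (SimplexCategory.mk n)) pt ⟶ F.obj n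
  π_d : ∀ (n : ℕ) (i : Fin (n + 2)),
    π n ≫ F.d n i = RightComodule.tensorMap (W.map (SimplexCategory.δ i)) (𝟙 pt) ≫ π (n + 1)
  π_s : ∀ (n : ℕ) (j : Fin (n + 1)),
    π (n + 1) ≫ F.s n j = RightComodule.tensorMap (W.map (SimplexCategory.σ j)) (𝟙 pt) ≫ π n

namespace WeightedCone

variable {W : SimplexCategory ⥤ V} {F : Cosimplicial (RightComodule C)}

/-- The morphism `f` of comodules is a factorization of the cone `S` through the cone `T`. -/
def IsFactorization (S T : WeightedCone W F) (f : S.pt ⟶ T.pt) : Prop :=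
  ∀ n : ℕ, RightComodule.tensorMap (𝟙 (W.obj (SimplexCategory.mk n))) f ≫ T.π n = S.π n

/-- The cone `T` is universal: its vertex is the limit of `F` weighted by `W` in the category of
comodules, that is, the end over `[n]` of the cotensors `(F n) ^ (W [n])`. -/
def IsLimit (T : WeightedCone W F) : Prop :=
  ∀ S : WeightedCone W F, ∃! f : S.pt ⟶ T.pt, IsFactorization S T f

/-- The morphism into the weighted limit which is induced by a cone. -/
def IsLimit.lift {T : WeightedCone W F} (hT : T.IsLimit) (S : WeightedCone W F) : S.pt ⟶ T.pt :=
  (hT S).choose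

theorem IsLimit.lift_spec {T : WeightedCone W F} (hT : T.IsLimit) (S : WeightedCone W F) :
    IsFactorization S T (hT.lift S) :=
  (hT S).choose_spec.1

end WeightedCone

end WeightedLimits

/-! ### The two-sided cosimplicial cobar construction -/

section Cobar

variable {V : Type u} [Category.{v} V] [MonoidalCategory V] {C : V} [ComonObj C]

open RightComodule

/-- `cobarObj X n` is the comodule `X ⊗ C ⊗ ⋯ ⊗ C` with `n` factors `C` (bracketed to the left). -/
@[reducible]
def cobarObj (X : RightComodule C) : ℕ → RightComodule C
  | 0 => X
  | n + 1 => cofree C (cobarObj X n).X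

/-- The cofaces `X ⊗ C ^ n ⟶ X ⊗ C ^ (n + 1)` for `0 ≤ i ≤ n`: the last one is the coaction of
`X ⊗ C ^ n` (that is, `ρ` if `n = 0`, and the comultiplication of the last factor `C` otherwise);
the other ones are `d ⊗ id_C` with `d` a coface on `X ⊗ C ^ (n - 1)`. Thus the coface `0` is
`ρ ⊗ id`, and the coface `i ≥ 1` is the comultiplication of the `i`-th factor `C`. -/
def cobarCoface (X : RightComodule C) :
    ∀ n : ℕ, Fin (n + 1) → (cobarObj X n ⟶ cobarObj X (n + 1))
  | 0 => fun _ => coaction X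
  | n + 1 => Fin.lastCases (motive := fun _ => cobarObj X (n + 1) ⟶ cobarObj X (n + 2))
      (coaction (cobarObj X (n + 1)))
      (fun i => cofreeMap C (cobarCoface X n i).hom)

/-- The codegeneracies `X ⊗ C ^ (n + 2) ⟶ X ⊗ C ^ (n + 1)` for `0 ≤ j ≤ n`: the counit is applied
to the factor `C` number `j + 1`. -/
def cobarCodegeneracy (X : RightComodule C) :
    ∀ n : ℕ, Fin (n + 1) → (cobarObj X (n + 2) ⟶ cobarObj X (n + 1))
  | 0 => fun _ => cofreeMap C (counitMap C X.X)
  | n + 1 => Fin.lastCases (motive := fun _ => cobarObj X (n + 3) ⟶ cobarObj X (n + 2))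
      (cofreeMap C (counitMap C (cobarObj X (n + 1)).X))
      (fun j => cofreeMap C (cobarCodegeneracy X n j).hom)

theorem cobarCoface_last (X : RightComodule C) (n : ℕ) :
    cobarCoface X n (Fin.last n) = coaction (cobarObj X n) := by
  cases n with
  | zero => rfl
  | succ n => simp [cobarCoface]

theorem cobarCoface_castSucc (X : RightComodule C) (n : ℕ) (i : Fin (n + 1)) :
    cobarCoface X (n + 1) i.castSucc = cofreeMap C (cobarCoface X n i).hom := by
  simp [cobarCoface]

theorem cobarCodegeneracy_last (X : RightComodule C) (n : ℕ) :
    cobarCodegeneracy X n (Fin.last n) = cofreeMap C (counitMap C (cobarObj X n).X) := by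
  cases n with
  | zero => rfl
  | succ n => simp [cobarCodegeneracy]

theorem cobarCodegeneracy_castSucc (X : RightComodule C) (n : ℕ) (j : Fin (n + 1)) :
    cobarCodegeneracy X (n + 1) j.castSucc = cofreeMap C (cobarCodegeneracy X n j).hom := by
  simp [cobarCodegeneracy]

theorem cofreeMap_comp {L M N : V} (f : L ⟶ M) (g : M ⟶ N) :
    cofreeMap C f ≫ cofreeMap C g = cofreeMap C (f ≫ g) := by
  ext; simp

theorem cofreeMap_id (M : V) : cofreeMap C (𝟙 M) = 𝟙 (cofree C M) := by
  ext; simp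

theorem coaction_naturality {A B : RightComodule C} (f : A ⟶ B) :
    f ≫ coaction B = coaction A ≫ cofreeMap C f.hom := by
  ext; exact f.comm.symm

theorem counitMap_naturality {M N : V} (f : M ⟶ N) :
    f ▷ C ≫ counitMap C N = counitMap C M ≫ f := by
  simp only [counitMap, Category.assoc]
  rw [← whisker_exchange_assoc]
  simp

theorem coaction_counitMap (A : RightComodule C) : A.ρ ≫ counitMap C A.X = 𝟙 A.X := by
  rw [counitMap, ← Category.assoc, A.counit]
  simp

theorem coaction_cofree_counitMap (M : V) :
    coaction (cofree C M) ≫ cofreeMap C (counitMap C M) = 𝟙 (cofree C M) := by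
  ext
  have h := congrArg (fun t => M ◁ t) (ComonObj.counit_comul (X := C))
  simp only [whiskerLeft_comp] at h
  simp only [comp_hom, coaction_hom, cofreeMap_hom, id_hom, cofree_X, counitMap,
    comp_whiskerRight, Category.assoc]
  rw [← associator_inv_naturality_middle_assoc, reassoc_of% h]
  simp

theorem cobar_d_comp_d (X : RightComodule C) (n : ℕ) (i j : Fin (n + 1)) (hij : i ≤ j) :
    cobarCoface X n i ≫ cobarCoface X (n + 1) j.succ =
      cobarCoface X n j ≫ cobarCoface X (n + 1) i.castSucc := by
  induction n with
  | zero =>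
    obtain rfl : i = Fin.last 0 := Subsingleton.elim (α := Fin 1) _ _
    obtain rfl : j = Fin.last 0 := Subsingleton.elim (α := Fin 1) _ _
    rw [Fin.succ_last, cobarCoface_last X (0 + 1), cobarCoface_castSucc, coaction_naturality,
      cobarCoface_last]
  | succ n ih =>
    induction j using Fin.lastCases with
    | last =>
      rw [Fin.succ_last, cobarCoface_last X (n + 1 + 1), cobarCoface_castSucc,
        coaction_naturality, cobarCoface_last]
    | cast j =>
      induction i using Fin.lastCases with
      | last => exact absurd (lt_of_le_of_lt hij (Fin.castSucc_lt_last j)) (lt_irrefl _)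
      | cast i =>
        have h := congrArg Hom.hom (ih i j hij)
        rw [Fin.succ_castSucc, cobarCoface_castSucc, cobarCoface_castSucc, cobarCoface_castSucc,
          cobarCoface_castSucc]
        erw [cofreeMap_comp, cofreeMap_comp]
        exact congrArg (cofreeMap C) h

theorem cobar_d_comp_s_of_le (X : RightComodule C) (n : ℕ) (i : Fin (n + 2)) (j : Fin (n + 1))
    (hij : i ≤ j.castSucc) :
    cobarCoface X (n + 2) i.castSucc ≫ cobarCodegeneracy X (n + 1) j.succ =
      cobarCodegeneracy X n j ≫ cobarCoface X (n + 1) i := by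
  induction i using Fin.lastCases with
  | last => exact absurd (lt_of_le_of_lt hij (Fin.castSucc_lt_last j)) (lt_irrefl _)
  | cast i =>
    rw [cobarCoface_castSucc, cobarCoface_castSucc]
    induction j using Fin.lastCases with
    | last =>
      rw [Fin.succ_last, cobarCodegeneracy_last, cobarCodegeneracy_last]
      erw [cofreeMap_comp, cofreeMap_comp]
      congr 1
      exact counitMap_naturality _
    | cast j =>
      cases n with
      | zero => exact j.elim0
      | succ n =>
        rw [Fin.succ_castSucc, cobarCodegeneracy_castSucc, cobarCodegeneracy_castSucc]
        erw [cofreeMap_comp, cofreeMap_comp]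
        rw [← cobarCoface_castSucc]
        exact congrArg (fun t => cofreeMap C (Hom.hom t)) (cobar_d_comp_s_of_le X n i j hij)

theorem cobar_d_comp_s_self (X : RightComodule C) (n : ℕ) (i : Fin (n + 1)) :
    cobarCoface X (n + 1) i.castSucc ≫ cobarCodegeneracy X n i = 𝟙 (cobarObj X (n + 1)) := by
  rw [cobarCoface_castSucc]
  induction i using Fin.lastCases with
  | last =>
    rw [cobarCodegeneracy_last, cobarCoface_last]
    erw [cofreeMap_comp]
    rw [coaction_hom, coaction_counitMap]
    exact cofreeMap_id _
  | cast i =>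
    cases n with
    | zero => exact i.elim0
    | succ n =>
      rw [cobarCodegeneracy_castSucc]
      erw [cofreeMap_comp]
      rw [← comp_hom, cobar_d_comp_s_self X n i]
      exact cofreeMap_id _

theorem cobar_d_comp_s_succ (X : RightComodule C) (n : ℕ) (i : Fin (n + 1)) :
    cobarCoface X (n + 1) i.succ ≫ cobarCodegeneracy X n i = 𝟙 (cobarObj X (n + 1)) := by
  induction i using Fin.lastCases with
  | last =>
    rw [Fin.succ_last, cobarCodegeneracy_last, cobarCoface_last]
    exact coaction_cofree_counitMap _
  | cast i =>
    cases n with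
    | zero => exact i.elim0
    | succ n =>
      rw [Fin.succ_castSucc, cobarCoface_castSucc, cobarCodegeneracy_castSucc]
      erw [cofreeMap_comp]
      rw [← comp_hom, cobar_d_comp_s_succ X n i]
      exact cofreeMap_id _

theorem cobar_d_comp_s_of_gt (X : RightComodule C) (n : ℕ) (i : Fin (n + 2)) (j : Fin (n + 1))
    (hij : j.castSucc < i) :
    cobarCoface X (n + 2) i.succ ≫ cobarCodegeneracy X (n + 1) j.castSucc =
      cobarCodegeneracy X n j ≫ cobarCoface X (n + 1) i := by
  induction i using Fin.lastCases with
  | last =>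
    rw [Fin.succ_last, cobarCoface_last, cobarCoface_last, cobarCodegeneracy_castSucc]
    exact (coaction_naturality _).symm
  | cast i =>
    rw [Fin.succ_castSucc, cobarCoface_castSucc, cobarCoface_castSucc, cobarCodegeneracy_castSucc]
    induction j using Fin.lastCases with
    | last =>
      exact absurd (lt_of_lt_of_le hij (Fin.castSucc_le_castSucc_iff.2 (Fin.le_last i)))
        (lt_irrefl _)
    | cast j =>
      cases n with
      | zero => exact j.elim0
      | succ n =>
        rw [cobarCodegeneracy_castSucc]
        erw [cofreeMap_comp, cofreeMap_comp]
        rw [← cobarCodegeneracy_castSucc]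
        exact congrArg (fun t => cofreeMap C (Hom.hom t)) (cobar_d_comp_s_of_gt X n i j hij)

theorem cobar_s_comp_s (X : RightComodule C) (n : ℕ) (i j : Fin (n + 1)) (hij : i ≤ j) :
    cobarCodegeneracy X (n + 1) i.castSucc ≫ cobarCodegeneracy X n j =
      cobarCodegeneracy X (n + 1) j.succ ≫ cobarCodegeneracy X n i := by
  rw [cobarCodegeneracy_castSucc]
  induction j using Fin.lastCases with
  | last =>
    rw [Fin.succ_last, cobarCodegeneracy_last, cobarCodegeneracy_last]
    induction i using Fin.lastCases with
    | last =>
      rw [cobarCodegeneracy_last]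
      erw [cofreeMap_comp, cofreeMap_comp]
      congr 1
      exact counitMap_naturality _
    | cast i =>
      cases n with
      | zero => exact i.elim0
      | succ n =>
        rw [cobarCodegeneracy_castSucc]
        erw [cofreeMap_comp, cofreeMap_comp]
        congr 1
        exact counitMap_naturality _
  | cast j =>
    induction i using Fin.lastCases with
    | last => exact absurd (lt_of_le_of_lt hij (Fin.castSucc_lt_last j)) (lt_irrefl _)
    | cast i =>
      cases n with
      | zero => exact j.elim0
      | succ n =>
        rw [Fin.succ_castSucc, cobarCodegeneracy_castSucc, cobarCodegeneracy_castSucc,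
          cobarCodegeneracy_castSucc]
        erw [cofreeMap_comp, cofreeMap_comp]
        rw [← cobarCodegeneracy_castSucc]
        exact congrArg (fun t => cofreeMap C (Hom.hom t)) (cobar_s_comp_s X n i j hij)

/-- The two-sided cosimplicial cobar construction of `X`: the cosimplicial comodule
`[n] ↦ X ⊗ C ^ (n + 1)`. -/
@[reducible]
def cobar (X : RightComodule C) : Cosimplicial (RightComodule C) where
  obj n := cobarObj X (n + 1)
  d n := cobarCoface X (n + 1)
  s n := cobarCodegeneracy X n
  d_comp_d n := cobar_d_comp_d X (n + 1)
  d_comp_s_of_le n := cobar_d_comp_s_of_le X n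
  d_comp_s_self n := cobar_d_comp_s_self X n
  d_comp_s_succ n := cobar_d_comp_s_succ X n
  d_comp_s_of_gt n := cobar_d_comp_s_of_gt X n
  s_comp_s n := cobar_s_comp_s X n

/-- The coaugmentation `X ⟶ X ⊗ C ^ n`, the iterated coaction (any composite of cofaces). -/
def coaug (X : RightComodule C) : ∀ n : ℕ, X ⟶ cobarObj X n
  | 0 => 𝟙 X
  | n + 1 => coaug X n ≫ coaction (cobarObj X n)

theorem coaug_coface (X : RightComodule C) (n : ℕ) (i : Fin (n + 1)) :
    coaug X n ≫ cobarCoface X n i = coaug X (n + 1) := by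
  induction n with
  | zero =>
    obtain rfl : i = Fin.last 0 := Subsingleton.elim (α := Fin 1) _ _
    rw [cobarCoface_last]; rfl
  | succ n ih =>
    induction i using Fin.lastCases with
    | last => rw [cobarCoface_last]; rfl
    | cast i =>
      calc coaug X (n + 1) ≫ cobarCoface X (n + 1) i.castSucc
          = coaug X n ≫ cobarCoface X n (Fin.last n) ≫ cobarCoface X (n + 1) i.castSucc := by
            rw [← ih (Fin.last n), Category.assoc]
        _ = coaug X n ≫ cobarCoface X n i ≫ cobarCoface X (n + 1) (Fin.last n).succ := by
            rw [cobar_d_comp_d X n i (Fin.last n) (Fin.le_last i)]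
        _ = coaug X (n + 1) ≫ cobarCoface X (n + 1) (Fin.last (n + 1)) := by
            rw [← Category.assoc, ih, Fin.succ_last]
        _ = coaug X (n + 1 + 1) := by
            rw [cobarCoface_last]; rfl

theorem coaug_codegeneracy (X : RightComodule C) (n : ℕ) (j : Fin (n + 1)) :
    coaug X (n + 2) ≫ cobarCodegeneracy X n j = coaug X (n + 1) := by
  rw [← coaug_coface X (n + 1) j.castSucc, Category.assoc]
  erw [cobar_d_comp_s_self, Category.comp_id]

/-- The cone over the cobar construction given by the coaugmentation: its legs are the composites
`W [n] ⊗ X ⟶ 𝟙_ ⊗ X = X ⟶ X ⊗ C ^ (n + 1)`, for an augmentation `ε` of the weight `W`. -/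
def coaugCone (W : SimplexCategory ⥤ V) (ε : ∀ n, W.obj n ⟶ 𝟙_ V)
    (hε : ∀ {m n} (f : m ⟶ n), W.map f ≫ ε n = ε m) (X : RightComodule C) :
    WeightedCone W (cobar X) where
  pt := X
  π n := tensorMap (ε (SimplexCategory.mk n)) (𝟙 X) ≫ tensorUnitHom X ≫ coaug X (n + 1)
  π_d n i := by
    have h := coaug_coface X (n + 1) i
    rw [← Category.assoc (tensorMap (W.map (SimplexCategory.δ i)) (𝟙 X)), tensorMap_comp_tensorMap, Category.assoc,
      Category.assoc, h, hε]
  π_s n j := by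
    have h := coaug_codegeneracy X n j
    rw [← Category.assoc (tensorMap (W.map (SimplexCategory.σ j)) (𝟙 X)), tensorMap_comp_tensorMap, Category.assoc,
      Category.assoc, h, hε]

end Cobar

/-! ### Connective chain complexes, dg-coalgebras and dg-comodules -/

section DG

variable (k : Type u) [CommRing k]

/-- Non-negatively graded chain complexes of `k`-modules. The monoidal structure is the usual one,
with differential `d (x ⊗ y) = dx ⊗ y + (-1) ^ |x| x ⊗ dy`. A dg-coalgebra is a comonoid in this
monoidal category. -/
abbrev Ch : Type (u + 1) := ChainComplex (ModuleCat.{u} k) ℕ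

/-- The simplicial `k`-module freely generated by a simplicial set. -/
def freeSimplicial : SSet.{0} ⥤ SimplicialObject (ModuleCat.{u} k) :=
  (SimplicialObject.whiskering (Type 0) (ModuleCat.{u} k)).obj
    (uliftFunctor.{u, 0} ⋙ ModuleCat.free k)

/-- The normalized chains of a simplicial set, with coefficients in `k`. -/
def normalizedChains : SSet.{0} ⥤ Ch k :=
  freeSimplicial k ⋙ AlgebraicTopology.normalizedMooreComplex (ModuleCat.{u} k)

/-- The cosimplicial simplicial set `[n] ↦ N (Δ ↓ [n])`, the nerve of the category of objects
of `Δ` over `[n]`. -/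
def overNerve : SimplexCategory ⥤ SSet.{0} :=
  Over.mapFunctor SimplexCategory ⋙ nerveFunctor

/-- The weight for homotopy limits of cosimplicial diagrams: the normalized chains of
`N (Δ ↓ [n])`. -/
def holimWeight : SimplexCategory ⥤ Ch k :=
  overNerve ⋙ normalizedChains k

theorem freeMap_comp_freeDesc_one {S T : Type u} (f : S ⟶ T) :
    (ModuleCat.free k).map f ≫ ModuleCat.freeDesc (M := 𝟙_ (ModuleCat.{u} k))
        (TypeCat.ofHom (fun _ => (1 : k))) =
      ModuleCat.freeDesc (TypeCat.ofHom (fun _ => (1 : k))) := by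
  apply ModuleCat.free_hom_ext
  intro x
  rw [ModuleCat.comp_apply]
  simp [ModuleCat.freeDesc_apply]

/-- The augmentation of the simplicial module generated by `K`, mapping each simplex to `1`. -/
def freeSimplicialAug (K : SSet.{0}) :
    (freeSimplicial k).obj K ⟶ (SimplicialObject.const _).obj (𝟙_ (ModuleCat.{u} k)) where
  app _ := ModuleCat.freeDesc (TypeCat.ofHom (fun _ => (1 : k)))
  naturality _ _ _ :=
    (freeMap_comp_freeDesc_one k _).trans (Category.comp_id _).symm

/-- The augmentation of the normalized chains of `K`. -/
def normalizedChainsAug (K : SSet.{0}) : (normalizedChains k).obj K ⟶ 𝟙_ (Ch k) :=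
  AlgebraicTopology.inclusionOfMooreComplexMap ((freeSimplicial k).obj K) ≫
    AlgebraicTopology.AlternatingFaceMapComplex.ε.app
      { left := (freeSimplicial k).obj K
        right := 𝟙_ (ModuleCat.{u} k)
        hom := freeSimplicialAug k K }

theorem normalizedChainsAug_naturality {K L : SSet.{0}} (f : K ⟶ L) :
    (normalizedChains k).map f ≫ normalizedChainsAug k L = normalizedChainsAug k K := by
  let A : SSet.{0} → SimplicialObject.Augmented (ModuleCat.{u} k) := fun K =>
    { left := (freeSimplicial k).obj K
      right := 𝟙_ (ModuleCat.{u} k)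
      hom := freeSimplicialAug k K }
  let g : A K ⟶ A L :=
    { left := (freeSimplicial k).map f
      right := 𝟙 _
      w := by
        apply NatTrans.ext
        funext m
        exact (freeMap_comp_freeDesc_one k _).trans (Category.comp_id _).symm }
  have h := AlgebraicTopology.AlternatingFaceMapComplex.ε.naturality g
  have h' := (AlgebraicTopology.inclusionOfMooreComplex (ModuleCat.{u} k)).naturality
    ((freeSimplicial k).map f)
  change (AlgebraicTopology.normalizedMooreComplex (ModuleCat.{u} k)).map
      ((freeSimplicial k).map f) ≫ AlgebraicTopology.inclusionOfMooreComplexMap _ ≫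
      AlgebraicTopology.AlternatingFaceMapComplex.ε.app (A L) =
    AlgebraicTopology.inclusionOfMooreComplexMap _ ≫
      AlgebraicTopology.AlternatingFaceMapComplex.ε.app (A K)
  have h1 := h' =≫ AlgebraicTopology.AlternatingFaceMapComplex.ε.app (A L)
  rw [Category.assoc, Category.assoc] at h1
  refine h1.trans ?_
  refine congrArg (fun t => AlgebraicTopology.inclusionOfMooreComplexMap _ ≫ t) ?_
  refine h.trans ?_
  exact (congrArg (fun t => AlgebraicTopology.AlternatingFaceMapComplex.ε.app (A K) ≫ t)
    ((ChainComplex.single₀ (ModuleCat.{u} k)).map_id _)).trans (Category.comp_id _)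

variable {k}

/-- A dg-coalgebra `C` is simply connected if `C_0 = k` and `C_1 = 0`. -/
structure IsSimplyConnected (C : Ch k) : Prop where
  degree_zero : Nonempty (C.X 0 ≅ ModuleCat.of k k)
  degree_one : Limits.IsZero (C.X 1)

/-- The weak equivalences of right dg-comodules: the quasi-isomorphisms. -/
def IsWeakEquivalence {C : Ch k} [ComonObj C] {A B : RightComodule C} (f : A ⟶ B) : Prop :=
  QuasiIso f.hom

/-- `T` exhibits its vertex as the homotopy limit of the (objectwise fibrant) cosimplicial
dg-comodule `F` in the category of dg-comodules: the vertex is the end over `[n]` of the cotensors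
`(F n) ^ (N (Δ ↓ [n]))`, where the cotensor with a simplicial set `K` is right adjoint to
`A ↦ N_*(K; k) ⊗ A`, that is, the equalizer of
`∏ₙ (F n) ^ (N (Δ ↓ [n])) ⇉ ∏ (F n) ^ (N (Δ ↓ [m]))`, the last product over all
`[m] ⟶ [n]` in `Δ`. -/
abbrev IsHomotopyLimit {C : Ch k} [ComonObj C] {F : Cosimplicial (RightComodule C)}
    (T : WeightedCone (holimWeight k) F) : Prop :=
  T.IsLimit

/-- The cone over the two-sided cosimplicial cobar construction given by its coaugmentation. -/
def cobarCone {C : Ch k} [ComonObj C] (X : RightComodule C) :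
    WeightedCone (holimWeight k) (cobar X) :=
  coaugCone (holimWeight k) (fun n => normalizedChainsAug k (overNerve.obj n))
    (fun f => normalizedChainsAug_naturality k (overNerve.map f)) X

/-- The morphism of dg-comodules from `X` to the homotopy limit `T` of its cobar construction
which is induced by the coaugmentation. -/
def toCobarResolution {C : Ch k} [ComonObj C] (X : RightComodule C)
    {T : WeightedCone (holimWeight k) (cobar X)} (hT : IsHomotopyLimit T) : X ⟶ T.pt :=
  WeightedCone.IsLimit.lift hT (cobarCone X)

end DG

end

end DGComod

/-! The homotopy limit is the limit of the cobar construction weighted by `holimWeight k`, the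
normalized chains of `N(Δ ↓ [n])`. Its existence uses only that `k` is semisimple; its homology is
found by comparison with a smaller weight.

Existence. A comodule map from `W ⊗ A` to a cofree comodule `M ⊗ C` is the same as a chain map `W ⊗
A ⟶ M`. Hence a family of legs into the cofree comodules `X ⊗ C ^ (n + 1)` is one comodule map into
the cofree comodule on a product of internal Homs (`homFam`, `cofree_representable`). Compatibility
with cofaces and with codegeneracies is then imposed by two successive equalizers. Equalizers of
comodules exist because all kernels over `k` split, so they survive `- ⊗ C` and inherit a coaction
(`exists_comodule_equalizer`).

The small model. The chains of `Δ[n]`, used modulo degenerate chains, lead to the conormalized total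
complex `tot`: an element of degree `q` has normalized components in cosimplicial degree `m` and
chain degree `m + q`. Since `C_0 = k` and `C_1 = 0`, the normalized part of `X ⊗ C ^ (m + 1)`
vanishes in chain degrees below `2 * m` (`isSteep_cobar`). So only `m ≤ q` contributes, the product
over `m` is finite in each degree, `tot` commutes with `- ⊗ C`, and it is a comodule with a cone of
its own (`totComodule`, `totCone`). Applying the counit to the last factor `C` is an extra
codegeneracy, and it gives a deformation retraction of `tot` onto `X` as chain complexes
(`quasiIso_toTot`).

The comparison. Both weights are, degreewise, free on coproducts of corepresentable functors before
normalization, and both resolve the constant functor `k`, since `Δ[n]` and `N(Δ ↓ [n])` contract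
onto a last vertex. Acyclic models make `holimWeight k` a natural homotopy retract of the chains of
`Δ[n]` (`exists_weight_retraction`). A homotopy of weights is a map out of the tensor product with
an interval, so it induces a homotopy on the weighted limit (`liftHomotopy`). This gives `g : T.pt ⟶
tot` and `r : tot ⟶ T.pt` with `g ≫ r` homotopic to the identity. The composite `X ⟶ T.pt ⟶ tot` is
the quasi-isomorphism above, so `g` is both mono and epi on homology; thus `g`, and then `X ⟶ T.pt`,
are quasi-isomorphisms. No homotopy for `r ≫ g` is needed. -/

namespace DGComod
noncomputable section

/-! ### Element calculus in tensor products of chain complexes -/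

section TensorElements

variable {k : Type u} [CommRing k]

/-- The element `a ⊗ b` of degree `n` of a tensor product of chain complexes; it is zero unless
`i + j = n`. -/
def tm (A B : Ch k) (i j n : ℕ) : A.X i →ₗ[k] B.X j →ₗ[k] ((A ⊗ B : Ch k).X n) :=
  if h : i + j = n then
    TensorProduct.curry (HomologicalComplex.ιTensorObj A B i j n h).hom
  else 0

theorem tm_of_ne {A B : Ch k} {i j n : ℕ} (h : i + j ≠ n) : tm A B i j n = 0 := dif_neg h

theorem tm_eq {A B : Ch k} {i j n : ℕ} (h : i + j = n) (a : A.X i) (b : B.X j) :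
    tm A B i j n a b = (HomologicalComplex.ιTensorObj A B i j n h).hom (a ⊗ₜ[k] b) := by
  rw [tm, dif_pos h]; rfl

theorem tm_ext {A B : Ch k} {n : ℕ} {Z : Type*} [AddCommGroup Z] [Module k Z]
    {f g : (A ⊗ B : Ch k).X n →ₗ[k] Z}
    (h : ∀ i j, i + j = n → ∀ a b, f (tm A B i j n a b) = g (tm A B i j n a b)) : f = g := by
  let S : Submodule k ((A ⊗ B : Ch k).X n) := LinearMap.ker (f - g)
  have hS : ∀ i j (hij : i + j = n) (x), (HomologicalComplex.ιTensorObj A B i j n hij).hom x ∈ S := by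
    intro i j hij x
    induction x using TensorProduct.induction_on with
    | zero => rw [map_zero]; exact S.zero_mem
    | tmul a b =>
      have := h i j hij a b
      rw [tm_eq hij] at this
      rw [LinearMap.mem_ker, LinearMap.sub_apply, sub_eq_zero]
      exact this
    | add x y hx hy => rw [map_add]; exact S.add_mem hx hy
  -- `Z` may live in any universe, so the universal property of the tensor product is applied to the
  -- quotient by `ker (f - g)`, which stays in universe `u`.
  have h2 : ModuleCat.ofHom S.mkQ = (0 : (A ⊗ B : Ch k).X n ⟶ _) := by
    apply HomologicalComplex.mapBifunctor.hom_ext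
    intro i j hij
    ext x
    rw [Limits.comp_zero]
    exact (Submodule.Quotient.mk_eq_zero S).2 (hS i j hij x)
  ext z
  have h3 : S.mkQ z = 0 := congrArg (fun t => t.hom z) h2
  have h4 : z ∈ S := (Submodule.Quotient.mk_eq_zero S).1 h3
  rw [LinearMap.mem_ker, LinearMap.sub_apply, sub_eq_zero] at h4
  exact h4

/-- The linear map out of a graded piece of a tensor product given by a family of bilinear maps. -/
def tdesc {A B : Ch k} {n : ℕ} {Z : Type u} [AddCommGroup Z] [Module k Z]
    (φ : ∀ i j, A.X i →ₗ[k] B.X j →ₗ[k] Z) : (A ⊗ B : Ch k).X n →ₗ[k] Z :=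
  (HomologicalComplex.mapBifunctorDesc (K₁ := A) (K₂ := B)
    (F := curriedTensor (ModuleCat.{u} k)) (c := ComplexShape.down ℕ) (A := ModuleCat.of k Z) (j := n)
    (fun i j _ => ModuleCat.ofHom (TensorProduct.lift (φ i j)))).hom

theorem tdesc_tm {A B : Ch k} {n : ℕ} {Z : Type u} [AddCommGroup Z] [Module k Z]
    (φ : ∀ i j, A.X i →ₗ[k] B.X j →ₗ[k] Z) {i j : ℕ} (h : i + j = n) (a : A.X i) (b : B.X j) :
    tdesc φ (tm A B i j n a b) = φ i j a b := by
  rw [tm_eq h]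
  have := HomologicalComplex.ι_mapBifunctorDesc (K₁ := A) (K₂ := B)
    (F := curriedTensor (ModuleCat.{u} k)) (c := ComplexShape.down ℕ) (A := ModuleCat.of k Z) (j := n)
    (fun i j _ => ModuleCat.ofHom (TensorProduct.lift (φ i j))) i j h
  exact (congrArg (fun t => t.hom (a ⊗ₜ[k] b)) this).trans (TensorProduct.lift.tmul a b)

theorem tensorHom_tm {A B A' B' : Ch k} (f : A ⟶ A') (g : B ⟶ B') {i j n : ℕ} (a : A.X i)
    (b : B.X j) : ((f ⊗ₘ g).f n).hom (tm A B i j n a b) =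
      tm A' B' i j n ((f.f i).hom a) ((g.f j).hom b) := by
  by_cases h : i + j = n
  · rw [tm_eq h, tm_eq h]
    have := HomologicalComplex.ι_mapBifunctorMap f g (curriedTensor (ModuleCat.{u} k))
      (ComplexShape.down ℕ) i j n h
    exact congrArg (fun t => t.hom (a ⊗ₜ[k] b)) this
  · rw [tm_of_ne h, tm_of_ne h]; simp

theorem whiskerRight_tm {A A' : Ch k} (f : A ⟶ A') (B : Ch k) {i j n : ℕ} (a : A.X i)
    (b : B.X j) : ((f ▷ B).f n).hom (tm A B i j n a b) =
      tm A' B i j n ((f.f i).hom a) b := by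
  rw [← tensorHom_id]; exact tensorHom_tm f (𝟙 B) a b

theorem whiskerLeft_tm {B B' : Ch k} (A : Ch k) (f : B ⟶ B') {i j n : ℕ} (a : A.X i)
    (b : B.X j) : ((A ◁ f).f n).hom (tm A B i j n a b) =
      tm A B' i j n a ((f.f j).hom b) := by
  rw [← id_tensorHom]; exact tensorHom_tm (𝟙 A) f a b

/-- The truncated subtractions are harmless: for `i = 0` the map `A.d 0 (0 - 1)` is zero, and
likewise for `j = 0`, so no case distinction has to appear in the formula. -/
theorem d_tm {A B : Ch k} {i j n : ℕ} (h : i + j = n + 1) (a : A.X i) (b : B.X j) :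
    ((A ⊗ B : Ch k).d (n + 1) n).hom (tm A B i j (n + 1) a b) =
      tm A B (i - 1) j n ((A.d i (i - 1)).hom a) b +
        (-1 : k) ^ i • tm A B i (j - 1) n a ((B.d j (j - 1)).hom b) := by
  have e1 : ((HomologicalComplex.mapBifunctor.d₁ A B (curriedTensor (ModuleCat.{u} k))
      (ComplexShape.down ℕ) i j n).hom (a ⊗ₜ[k] b)) =
      tm A B (i - 1) j n ((A.d i (i - 1)).hom a) b := by
    cases i with
    | zero =>
      rw [HomologicalComplex.mapBifunctor.d₁_eq_zero _ _ _ _ _ _ _ (by simp),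
        A.shape 0 (0 - 1) (by simp)]
      simp
    | succ i =>
      have hh : i + j = n := by omega
      rw [HomologicalComplex.mapBifunctor.d₁_eq A B (curriedTensor (ModuleCat.{u} k))
        (ComplexShape.down ℕ) (i₁ := i + 1) (i₁' := i) rfl j n hh]
      have hs : ComplexShape.ε₁ (ComplexShape.down ℕ) (ComplexShape.down ℕ) (ComplexShape.down ℕ)
        (i + 1, j) = 1 := rfl
      rw [hs, one_smul, tm_eq (by simpa using hh)]
      rfl
  have e2 : ((HomologicalComplex.mapBifunctor.d₂ A B (curriedTensor (ModuleCat.{u} k))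
      (ComplexShape.down ℕ) i j n).hom (a ⊗ₜ[k] b)) =
      (-1 : k) ^ i • tm A B i (j - 1) n a ((B.d j (j - 1)).hom b) := by
    cases j with
    | zero =>
      rw [HomologicalComplex.mapBifunctor.d₂_eq_zero _ _ _ _ _ _ _ (by simp),
        B.shape 0 (0 - 1) (by simp)]
      simp
    | succ j =>
      have hh : i + j = n := by omega
      rw [HomologicalComplex.mapBifunctor.d₂_eq A B (curriedTensor (ModuleCat.{u} k))
        (ComplexShape.down ℕ) i (i₂ := j + 1) (i₂' := j) rfl n hh]
      have hs : ComplexShape.ε₂ (ComplexShape.down ℕ) (ComplexShape.down ℕ) (ComplexShape.down ℕ)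
        (i, j + 1) = (-1) ^ i := ComplexShape.ε_down_ℕ i
      rw [hs, tm_eq (by simpa using hh)]
      rcases Nat.even_or_odd i with hi | hi
      · rw [hi.neg_one_pow, hi.neg_one_pow, one_smul, one_smul]; rfl
      · rw [hi.neg_one_pow, hi.neg_one_pow, Units.neg_smul, one_smul, neg_one_smul]; rfl
  rw [← e1, ← e2, tm_eq h]
  have h1 := HomologicalComplex.mapBifunctor.ι_D₁ A B (curriedTensor (ModuleCat.{u} k))
    (ComplexShape.down ℕ) (n + 1) n i j h
  have h2 := HomologicalComplex.mapBifunctor.ι_D₂ A B (curriedTensor (ModuleCat.{u} k))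
    (ComplexShape.down ℕ) (n + 1) n i j h
  have h3 := HomologicalComplex.mapBifunctor.d_eq A B (curriedTensor (ModuleCat.{u} k))
    (ComplexShape.down ℕ) (n + 1) n
  have h1' := congrArg (fun t => t.hom (a ⊗ₜ[k] b)) h1
  have h2' := congrArg (fun t => t.hom (a ⊗ₜ[k] b)) h2
  rw [← h1', ← h2']
  exact congrArg (fun t => t.hom ((HomologicalComplex.ιTensorObj A B i j (n + 1) h).hom (a ⊗ₜ[k] b))) h3

theorem associator_hom_tm {A B D : Ch k} {i j l m m' n : ℕ} (h : i + j = m) (h' : j + l = m')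
    (a : A.X i) (b : B.X j) (c : D.X l) :
    ((α_ A B D).hom.f n).hom (tm (A ⊗ B) D m l n (tm A B i j m a b) c) =
      tm A (B ⊗ D) i m' n a (tm B D j l m' b c) := by
  by_cases hn : i + j + l = n
  · subst h h'
    have := HomologicalComplex.ι_mapBifunctorAssociatorX_hom (curriedAssociatorNatIso (ModuleCat.{u} k))
      A B D (ComplexShape.down ℕ) (ComplexShape.down ℕ) (ComplexShape.down ℕ) i j l n hn
    rw [HomologicalComplex.mapBifunctor₁₂.ι_eq _ _ _ _ _ _ _ i j l (i + j) n rfl hn,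
      HomologicalComplex.mapBifunctor₂₃.ι_eq _ _ _ _ _ _ _ _ i j l (j + l) n rfl
        (by rw [← hn]; exact (add_assoc _ _ _).symm)] at this
    rw [tm_eq hn, tm_eq rfl, tm_eq (by omega), tm_eq rfl]
    exact congrArg (fun t => t.hom ((a ⊗ₜ[k] b) ⊗ₜ[k] c)) this
  · rw [tm_of_ne (A := A ⊗ B) (i := m) (by omega), tm_of_ne (B := B ⊗ D) (j := m') (by omega)]; simp

theorem associator_inv_tm {A B D : Ch k} {i j l m m' n : ℕ} (h : i + j = m) (h' : j + l = m')
    (a : A.X i) (b : B.X j) (c : D.X l) :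
    ((α_ A B D).inv.f n).hom (tm A (B ⊗ D) i m' n a (tm B D j l m' b c)) =
      tm (A ⊗ B) D m l n (tm A B i j m a b) c := by
  rw [← associator_hom_tm h h' a b c]
  exact congrArg (fun t => (t.f n).hom (tm (A ⊗ B) D m l n (tm A B i j m a b) c))
    (α_ A B D).hom_inv_id

/-- The unit element of the tensor unit. -/
def unitElt (k : Type u) [CommRing k] : (𝟙_ (Ch k)).X 0 :=
  (HomologicalComplex.singleObjXSelf (ComplexShape.down ℕ) 0 (𝟙_ (ModuleCat.{u} k))).inv.hom (1 : k)

theorem unit_ext {Z : Type*} [AddCommGroup Z] [Module k Z] {f g : (𝟙_ (Ch k)).X 0 →ₗ[k] Z}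
    (h : f (unitElt k) = g (unitElt k)) : f = g := by
  let e := HomologicalComplex.singleObjXSelf (ComplexShape.down ℕ) 0 (𝟙_ (ModuleCat.{u} k))
  have h2 : f ∘ₗ e.inv.hom = g ∘ₗ e.inv.hom := LinearMap.ext_ring h
  refine LinearMap.ext fun z => ?_
  have hz : e.inv.hom (e.hom.hom z) = z := congrArg (fun t => t.hom z) e.hom_inv_id
  rw [← hz]
  exact congrArg (fun t => t (e.hom.hom z)) h2

theorem unit_X_eq_zero {i : ℕ} (hi : i ≠ 0) (z : (𝟙_ (Ch k)).X i) : z = 0 := by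
  have := HomologicalComplex.isZero_single_obj_X (ComplexShape.down ℕ) 0 (𝟙_ (ModuleCat.{u} k)) i hi
  have h : 𝟙 ((𝟙_ (Ch k)).X i) = 0 := this.eq_of_src _ _
  exact congrArg (fun t => t.hom z) h

theorem leftUnitor_inv_apply (A : Ch k) {n : ℕ} (a : A.X n) :
    ((λ_ A).inv.f n).hom a = tm (𝟙_ (Ch k)) A 0 n n (unitElt k) a := by
  rw [tm_eq (zero_add n)]
  exact congrArg (fun t => t.hom a) (HomologicalComplex.leftUnitor'_inv A n)

theorem rightUnitor_inv_apply (A : Ch k) {n : ℕ} (a : A.X n) :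
    ((ρ_ A).inv.f n).hom a = tm A (𝟙_ (Ch k)) n 0 n a (unitElt k) := by
  rw [tm_eq (add_zero n)]
  exact congrArg (fun t => t.hom a) (HomologicalComplex.rightUnitor'_inv A n)

theorem leftUnitor_hom_tm (A : Ch k) {n : ℕ} (a : A.X n) :
    ((λ_ A).hom.f n).hom (tm (𝟙_ (Ch k)) A 0 n n (unitElt k) a) = a := by
  rw [← leftUnitor_inv_apply]
  exact congrArg (fun t => (t.f n).hom a) (λ_ A).inv_hom_id

theorem rightUnitor_hom_tm (A : Ch k) {n : ℕ} (a : A.X n) :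
    ((ρ_ A).hom.f n).hom (tm A (𝟙_ (Ch k)) n 0 n a (unitElt k)) = a := by
  rw [← rightUnitor_inv_apply]
  exact congrArg (fun t => (t.f n).hom a) (ρ_ A).inv_hom_id

/-- Morphisms of chain complexes agree if they agree on elements. -/
theorem ch_ext {A B : Ch k} {f g : A ⟶ B} (h : ∀ n (a : A.X n), (f.f n).hom a = (g.f n).hom a) :
    f = g := by
  ext n a; exact h n a

theorem ch_tensor_ext {A B D : Ch k} {f g : A ⊗ B ⟶ D}
    (h : ∀ n i j, i + j = n → ∀ a b, (f.f n).hom (tm A B i j n a b) = (g.f n).hom (tm A B i j n a b)) :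
    f = g := by
  apply HomologicalComplex.hom_ext
  intro n
  apply ModuleCat.hom_ext
  exact tm_ext (h n)

end TensorElements

end
end DGComod

namespace DGComod
noncomputable section

/-! ### Maps out of tensor products, truncated complexes and products of internal Homs -/

section HomFamilies

variable {k : Type u} [CommRing k]

theorem hom_d {A B : Ch k} (f : A ⟶ B) (m n : ℕ) (a : A.X m) :
    (f.f n).hom ((A.d m n).hom a) = (B.d m n).hom ((f.f m).hom a) :=
  congrArg (fun t => t.hom a) (f.comm m n).symm

theorem d_d (A : Ch k) (l m n : ℕ) (a : A.X l) : (A.d m n).hom ((A.d l m).hom a) = 0 :=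
  congrArg (fun t => t.hom a) (A.d_comp_d l m n)

theorem d_zero_zero (A : Ch k) (n : ℕ) (a : A.X 0) : (A.d 0 n).hom a = 0 := by
  rw [A.shape 0 n (by simp)]; rfl

theorem comp_hom_apply {A B D : Ch k} (f : A ⟶ B) (g : B ⟶ D) (n : ℕ) (a : A.X n) :
    ((f ≫ g).f n).hom a = (g.f n).hom ((f.f n).hom a) := rfl

/-- Off the diagonal `i + j = n + 1` every term vanishes: either the shifted degrees also fail to
add up to `n`, or the index was `0` and the differential is zero. -/
theorem d_tm_all {A B : Ch k} (i j n : ℕ) (a : A.X i) (b : B.X j) :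
    ((A ⊗ B : Ch k).d (n + 1) n).hom (tm A B i j (n + 1) a b) =
      tm A B (i - 1) j n ((A.d i (i - 1)).hom a) b +
        (-1 : k) ^ i • tm A B i (j - 1) n a ((B.d j (j - 1)).hom b) := by
  by_cases h : i + j = n + 1
  · exact d_tm h a b
  · rw [tm_of_ne h]
    have h1 : tm A B (i - 1) j n ((A.d i (i - 1)).hom a) b = 0 := by
      rcases i with _ | i
      · rw [d_zero_zero]; simp
      · rw [tm_of_ne (by omega)]; rfl
    have h2 : tm A B i (j - 1) n a ((B.d j (j - 1)).hom b) = 0 := by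
      rcases j with _ | j
      · rw [d_zero_zero]; simp
      · rw [tm_of_ne (by omega)]; rfl
    rw [h1, h2]; simp

theorem tdesc_d {A B D : Ch k} (φ : ∀ i j n, A.X i →ₗ[k] B.X j →ₗ[k] D.X n)
    (hφ : ∀ i j n, i + j = n + 1 → ∀ a b, (D.d (n + 1) n).hom (φ i j (n + 1) a b) =
      φ (i - 1) j n ((A.d i (i - 1)).hom a) b +
        (-1 : k) ^ i • φ i (j - 1) n a ((B.d j (j - 1)).hom b)) (n : ℕ) :
    (D.d (n + 1) n).hom ∘ₗ tdesc (fun i j => φ i j (n + 1)) =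
      tdesc (fun i j => φ i j n) ∘ₗ ((A ⊗ B : Ch k).d (n + 1) n).hom := by
  apply tm_ext
  intro i j h a b
  rw [LinearMap.comp_apply, LinearMap.comp_apply, tdesc_tm _ h, d_tm h, hφ i j n h, map_add,
    map_smul]
  congr 1
  · rcases i with _ | i
    · rw [d_zero_zero]; simp
    · rw [tdesc_tm _ (by omega)]
  · rcases j with _ | j
    · rw [d_zero_zero]; simp
    · rw [tdesc_tm _ (by omega)]

/-- The morphism out of a tensor product of chain complexes given by a family of bilinear maps. -/
def tensorDesc {A B D : Ch k} (φ : ∀ i j n, A.X i →ₗ[k] B.X j →ₗ[k] D.X n)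
    (hφ : ∀ i j n, i + j = n + 1 → ∀ a b, (D.d (n + 1) n).hom (φ i j (n + 1) a b) =
      φ (i - 1) j n ((A.d i (i - 1)).hom a) b +
        (-1 : k) ^ i • φ i (j - 1) n a ((B.d j (j - 1)).hom b)) : A ⊗ B ⟶ D where
  f n := ModuleCat.ofHom (tdesc (fun i j => φ i j n))
  comm' := by
    rintro _ n rfl
    exact ModuleCat.hom_ext (tdesc_d φ hφ n)

theorem tensorDesc_tm {A B D : Ch k} (φ : ∀ i j n, A.X i →ₗ[k] B.X j →ₗ[k] D.X n)
    (hφ : ∀ i j n, i + j = n + 1 → ∀ a b, (D.d (n + 1) n).hom (φ i j (n + 1) a b) =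
      φ (i - 1) j n ((A.d i (i - 1)).hom a) b +
        (-1 : k) ^ i • φ i (j - 1) n a ((B.d j (j - 1)).hom b))
    {i j n : ℕ} (h : i + j = n) (a : A.X i) (b : B.X j) :
    ((tensorDesc φ hφ).f n).hom (tm A B i j n a b) = φ i j n a b := by
  have := tdesc_tm (fun i j => φ i j n) h a b
  exact this

section Trunc

variable {Ω : Type u} [AddCommGroup Ω] [Module k Ω] (D : Ω →ₗ[k] Ω) (S : ℕ → Submodule k Ω)

/-- The elements of degree `q` of `truncComplex`: in degree `0`, only cycles are allowed. -/
def truncSub (q : ℕ) : Submodule k Ω where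
  carrier := {x | x ∈ S q ∧ (q = 0 → D x = 0)}
  add_mem' := fun hx hy => ⟨(S q).add_mem hx.1 hy.1, fun h => by
    rw [map_add, hx.2 h, hy.2 h, add_zero]⟩
  zero_mem' := ⟨(S q).zero_mem, fun _ => map_zero _⟩
  smul_mem' := fun c _ hx => ⟨(S q).smul_mem c hx.1, fun h => by rw [map_smul, hx.2 h, smul_zero]⟩

variable (hD : ∀ x, D (D x) = 0) (hS : ∀ q, ∀ x ∈ S (q + 1), D x ∈ S q)

/-- The differential of `truncComplex`. -/
def truncD (q : ℕ) : truncSub D S (q + 1) →ₗ[k] truncSub D S q :=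
  LinearMap.restrict D (fun x hx => ⟨hS q x hx.1, fun _ => hD x⟩)

/-- The non-negatively graded truncation of a complex which is given by the square-zero
endomorphism `D` of an ambient module and its submodules `S q` of elements of degree `q`. -/
def truncComplex : Ch k :=
  ChainComplex.of (fun q => ModuleCat.of k (truncSub D S q))
    (fun q => ModuleCat.ofHom (truncD D S hD hS q))
    (fun q => by
      apply ModuleCat.hom_ext
      exact LinearMap.ext fun x => Subtype.ext (hD x.1))

/-- The underlying element of the ambient module. -/
def truncVal (q : ℕ) : (truncComplex D S hD hS).X q →ₗ[k] Ω := (truncSub D S q).subtype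

variable {D S hD hS} in
theorem truncVal_injective {q : ℕ} {x y : (truncComplex D S hD hS).X q}
    (h : truncVal D S hD hS q x = truncVal D S hD hS q y) : x = y := Subtype.ext h

theorem truncVal_mem (q : ℕ) (x : (truncComplex D S hD hS).X q) :
    truncVal D S hD hS q x ∈ S q := x.2.1

theorem truncVal_cycle (x : (truncComplex D S hD hS).X 0) :
    D (truncVal D S hD hS 0 x) = 0 := x.2.2 rfl

theorem truncVal_d (q : ℕ) (x : (truncComplex D S hD hS).X q) :
    truncVal D S hD hS (q - 1) (((truncComplex D S hD hS).d q (q - 1)).hom x) =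
      D (truncVal D S hD hS q x) := by
  rcases q with _ | q
  · rw [d_zero_zero, truncVal_cycle, map_zero]
  · simp only [truncComplex]
    erw [ChainComplex.of_d]
    rfl

/-- An element of `truncComplex`. -/
def truncMk (q : ℕ) (x : Ω) (hx : x ∈ S q) (h0 : q = 0 → D x = 0) :
    (truncComplex D S hD hS).X q := (⟨x, hx, h0⟩ : truncSub D S q)

/-- The components of a morphism into `truncComplex`. -/
def truncLiftX {A : Ch k} (φ : ∀ q, A.X q →ₗ[k] Ω) (hφ : ∀ q a, φ q a ∈ S q)
    (hd : ∀ q a, D (φ q a) = φ (q - 1) ((A.d q (q - 1)).hom a)) (q : ℕ) :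
    A.X q →ₗ[k] (truncComplex D S hD hS).X q :=
  LinearMap.codRestrict (truncSub D S q) (φ q) (fun a => ⟨hφ q a, fun h => by
    subst h; rw [hd, d_zero_zero, map_zero]⟩)

/-- A morphism into `truncComplex`. -/
def truncLift {A : Ch k} (φ : ∀ q, A.X q →ₗ[k] Ω) (hφ : ∀ q a, φ q a ∈ S q)
    (hd : ∀ q a, D (φ q a) = φ (q - 1) ((A.d q (q - 1)).hom a)) :
    A ⟶ truncComplex D S hD hS where
  f q := ModuleCat.ofHom (truncLiftX D S hD hS φ hφ hd q)
  comm' := by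
    rintro _ j rfl
    apply ModuleCat.hom_ext
    refine LinearMap.ext fun a => ?_
    apply truncVal_injective
    exact (truncVal_d D S hD hS (j + 1) _).trans (hd (j + 1) a)

end Trunc

variable {ι : Type} (W G : ι → Ch k)

/-- The differential of families of graded linear maps. -/
def homFamD : (∀ i m p, (W i).X m →ₗ[k] (G i).X p) →ₗ[k] (∀ i m p, (W i).X m →ₗ[k] (G i).X p) where
  -- The weight stands on the left, so the Leibniz rule reads `d (f w) = f (d w) + (-1) ^ m (d f)
  -- w`; this is that rule solved for `d f`.
  toFun f i m p := (-1 : k) ^ m • (((G i).d (p + 1) p).hom ∘ₗ f i m (p + 1) -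
    f i (m - 1) p ∘ₗ ((W i).d m (m - 1)).hom)
  map_add' f g := by
    funext i m p; ext w
    simp only [Pi.add_apply, LinearMap.smul_apply, LinearMap.sub_apply, LinearMap.comp_apply,
      LinearMap.add_apply, map_add, ← smul_add]
    congr 1; abel
  map_smul' c f := by
    funext i m p; ext w
    simp only [Pi.smul_apply, LinearMap.smul_apply, LinearMap.sub_apply, LinearMap.comp_apply,
      map_smul, RingHom.id_apply, ← smul_sub]
    rw [smul_comm]

theorem homFamD_apply (f : ∀ i m p, (W i).X m →ₗ[k] (G i).X p) (i : ι) (m p : ℕ) (w : (W i).X m) :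
    homFamD W G f i m p w = (-1 : k) ^ m • (((G i).d (p + 1) p).hom (f i m (p + 1) w) -
      f i (m - 1) p (((W i).d m (m - 1)).hom w)) := rfl

/-- Families of linear maps which raise degrees by `q`. -/
def homFamSub (q : ℕ) : Submodule k (∀ i m p, (W i).X m →ₗ[k] (G i).X p) where
  carrier := {f | ∀ i m p, m + q ≠ p → f i m p = 0}
  add_mem' := fun hf hg i m p h => by
    rw [Pi.add_apply, Pi.add_apply, Pi.add_apply, hf i m p h, hg i m p h, add_zero]
  zero_mem' := fun _ _ _ _ => rfl
  smul_mem' := fun c f hf i m p h => by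
    rw [Pi.smul_apply, Pi.smul_apply, Pi.smul_apply, hf i m p h, smul_zero]

theorem homFamD_homFamD (f : ∀ i m p, (W i).X m →ₗ[k] (G i).X p) :
    homFamD W G (homFamD W G f) = 0 := by
  funext i m p; ext w
  rw [homFamD_apply, homFamD_apply, homFamD_apply, map_smul, map_sub, d_d, d_d, map_zero]
  rcases m with _ | m
  · rw [d_zero_zero]; simp
  · rw [Nat.add_sub_cancel, zero_sub, sub_zero, pow_succ, mul_neg, mul_one]
    simp only [neg_smul, smul_neg, neg_neg, sub_self, smul_zero]
    rfl

theorem homFamD_mem (q : ℕ) : ∀ f ∈ homFamSub W G (q + 1), homFamD W G f ∈ homFamSub W G q := by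
  intro f hf i m p h
  ext w
  rw [homFamD_apply, hf i m (p + 1) (by omega)]
  rcases m with _ | m
  · rw [d_zero_zero]; simp
  · rw [hf i _ p (by omega)]; simp

/-- The product of the internal Homs from `W i` to `G i`. -/
def homFam : Ch k :=
  truncComplex (homFamD W G) (homFamSub W G) (homFamD_homFamD W G) (homFamD_mem W G)

/-- The components of an element of `homFam`. -/
def homFamVal (q : ℕ) : (homFam W G).X q →ₗ[k] (∀ i m p, (W i).X m →ₗ[k] (G i).X p) :=
  truncVal _ _ _ _ q

theorem homFamVal_d (q : ℕ) (f : (homFam W G).X q) :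
    homFamVal W G (q - 1) (((homFam W G).d q (q - 1)).hom f) = homFamD W G (homFamVal W G q f) :=
  truncVal_d _ _ _ _ q f

/-- The evaluation maps of `homFam`. -/
def homFamEval (i : ι) : W i ⊗ homFam W G ⟶ G i :=
  tensorDesc (fun m q p => ((LinearMap.proj p ∘ₗ LinearMap.proj m ∘ₗ LinearMap.proj i) ∘ₗ
      homFamVal W G q : (homFam W G).X q →ₗ[k] (W i).X m →ₗ[k] (G i).X p).flip)
    (by
      intro m q p h w f
      change ((G i).d (p + 1) p).hom (homFamVal W G q f i m (p + 1) w) =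
        homFamVal W G q f i (m - 1) p _ + (-1 : k) ^ m • homFamVal W G (q - 1) _ i m p w
      rw [homFamVal_d, homFamD_apply, smul_smul, ← mul_pow]
      simp)

theorem homFamEval_tm (i : ι) {m q p : ℕ} (h : m + q = p) (w : (W i).X m) (f : (homFam W G).X q) :
    ((homFamEval W G i).f p).hom (tm (W i) (homFam W G) m q p w f) = homFamVal W G q f i m p w :=
  tensorDesc_tm _ _ h w f

/-- Morphisms into `homFam`. -/
def homFamLift {B : Ch k} (φ : ∀ q, B.X q →ₗ[k] (∀ i m p, (W i).X m →ₗ[k] (G i).X p))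
    (h1 : ∀ q b, φ q b ∈ homFamSub W G q)
    (h2 : ∀ q b, homFamD W G (φ q b) = φ (q - 1) ((B.d q (q - 1)).hom b)) : B ⟶ homFam W G :=
  truncLift _ _ _ _ φ h1 h2

theorem homFamVal_homFamLift {B : Ch k}
    (φ : ∀ q, B.X q →ₗ[k] (∀ i m p, (W i).X m →ₗ[k] (G i).X p)) (h1) (h2) (q : ℕ) (b : B.X q) :
    homFamVal W G q (((homFamLift W G φ h1 h2).f q).hom b) = φ q b := rfl

theorem homFamVal_of_ne {q : ℕ} (f : (homFam W G).X q) (i : ι) {m p : ℕ} (h : m + q ≠ p) :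
    homFamVal W G q f i m p = 0 :=
  truncVal_mem (homFamD W G) (homFamSub W G) (homFamD_homFamD W G)
        (homFamD_mem W G) q f i m p h

theorem homFamVal_injective {q : ℕ} {f g : (homFam W G).X q}
    (h : homFamVal W G q f = homFamVal W G q g) : f = g :=
  truncVal_injective h

/-- The universal property of `homFam`. -/
theorem homFam_existsUnique (B : Ch k) (π : ∀ i, W i ⊗ B ⟶ G i) :
    ∃! f : B ⟶ homFam W G, ∀ i, W i ◁ f ≫ homFamEval W G i = π i := by
  let φ : ∀ q, B.X q →ₗ[k] (∀ i m p, (W i).X m →ₗ[k] (G i).X p) := fun q =>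
    LinearMap.pi fun i => LinearMap.pi fun m => LinearMap.pi fun p =>
      ((tm (W i) B m q p).compr₂ ((π i).f p).hom).flip
  have hφ : ∀ q b i m p w, φ q b i m p w = ((π i).f p).hom (tm (W i) B m q p w b) :=
    fun _ _ _ _ _ _ => rfl
  clear_value φ
  have h1 : ∀ q b, φ q b ∈ homFamSub W G q := by
    intro q b i m p h
    ext w
    rw [hφ, tm_of_ne h]; simp
  -- The Leibniz rule for `w ⊗ b`: the term with `d w` cancels, and the two signs `(-1) ^ m`
  -- multiply to `1`.
  have h2 : ∀ q b, homFamD W G (φ q b) = φ (q - 1) ((B.d q (q - 1)).hom b) := by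
    intro q b
    funext i m p; ext w
    rw [homFamD_apply, hφ, hφ, hφ, ← hom_d, d_tm_all, map_add, add_sub_cancel_left, map_smul,
      smul_smul, ← mul_pow]
    simp
  refine ⟨homFamLift W G φ h1 h2, ?_, ?_⟩
  · intro i
    apply ch_tensor_ext
    intro p m q h w b
    rw [comp_hom_apply, whiskerLeft_tm, homFamEval_tm _ _ _ h, homFamVal_homFamLift, hφ]
  · intro g hg
    apply ch_ext
    intro q b
    apply homFamVal_injective
    rw [homFamVal_homFamLift]
    funext i m p; ext w
    rw [hφ]
    by_cases h : m + q = p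
    · rw [← hg i, comp_hom_apply, whiskerLeft_tm, homFamEval_tm _ _ _ h]
    · rw [tm_of_ne h, homFamVal_of_ne W G _ _ h]
      simp

end HomFamilies

end
end DGComod

namespace DGComod
noncomputable section

/-! ### Cofree comodules, equalizers and weighted limits -/

namespace RightComodule

section Abstract

variable {V : Type u} [Category.{v} V] [MonoidalCategory V] {C : V} [ComonObj C]

/-- The morphism of comodules into a cofree comodule given by a morphism of `V`. -/
def cofreeLift (A : RightComodule C) {M : V} (g : A.X ⟶ M) : A ⟶ cofree C M :=
  coaction A ≫ cofreeMap C g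

theorem cofreeLift_counitMap (A : RightComodule C) {M : V} (g : A.X ⟶ M) :
    (cofreeLift A g).hom ≫ counitMap C M = g := by
  change (A.ρ ≫ g ▷ C) ≫ _ = _
  rw [Category.assoc, counitMap_naturality, ← Category.assoc, coaction_counitMap, Category.id_comp]

/-- The cofree comodule is right adjoint to forgetting the coaction. Naturality of the coaction and
the counit law rebuild a comodule map from its composite with `id ⊗ ε`. -/
theorem cofree_hom_ext {A : RightComodule C} {M : V} {f g : A ⟶ cofree C M}
    (h : f.hom ≫ counitMap C M = g.hom ≫ counitMap C M) : f = g := by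
  have key : ∀ f : A ⟶ cofree C M, f = cofreeLift A (f.hom ≫ counitMap C M) := by
    intro f
    have h1 := coaction_naturality f =≫ cofreeMap C (counitMap C M)
    rw [Category.assoc, Category.assoc] at h1
    erw [coaction_cofree_counitMap, Category.comp_id] at h1
    rw [cofreeMap_comp] at h1
    exact h1
  rw [key f, key g, h]

theorem associator_inv_counitMap (W M : V) :
    (α_ W M C).inv ≫ counitMap C (W ⊗ M) = W ◁ counitMap C M := by
  simp [counitMap]

/-- The evaluation `W ⊗ (P ⊗ C) ⟶ M ⊗ C` induced by an evaluation `W ⊗ P ⟶ M`. -/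
def cofreeEval {W P M : V} (ev : W ⊗ P ⟶ M) : tensorLeft W (cofree C P) ⟶ cofree C M where
  hom := (α_ W P C).inv ≫ ev ▷ C
  comm := by
    dsimp
    simp only [Category.assoc, comp_whiskerRight]
    rw [← whisker_exchange_assoc]
    simp

/-- Composing with `id ⊗ ε` turns the problem for comodules into the one for underlying objects,
which `P` solves. This is how cotensors of cofree comodules are obtained without constructing
general cotensors. -/
theorem cofree_representable {ι : Type*} {W M : ι → V} {P : V} (ev : ∀ i, W i ⊗ P ⟶ M i)
    (hP : ∀ (B : V) (π : ∀ i, W i ⊗ B ⟶ M i), ∃! f : B ⟶ P, ∀ i, W i ◁ f ≫ ev i = π i)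
    (A : RightComodule C) (π : ∀ i, tensorLeft (W i) A ⟶ cofree C (M i)) :
    ∃! f : A ⟶ cofree C P, ∀ i, tensorMap (𝟙 (W i)) f ≫ cofreeEval (ev i) = π i := by
  have key : ∀ f : A ⟶ cofree C P, ∀ i, (tensorMap (𝟙 (W i)) f ≫ cofreeEval (ev i)).hom ≫
      counitMap C (M i) = W i ◁ (f.hom ≫ counitMap C P) ≫ ev i := by
    intro f i
    simp only [comp_hom, tensorMap_hom, cofreeEval, id_tensorHom, Category.assoc,
      whiskerLeft_comp]
    rw [counitMap_naturality, ← associator_inv_counitMap (C := C), Category.assoc]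
  obtain ⟨p, hp, hu⟩ := hP A.X (fun i => (π i).hom ≫ counitMap C (M i))
  refine ⟨cofreeLift A p, ?_, ?_⟩
  · intro i
    apply cofree_hom_ext
    rw [key, cofreeLift_counitMap, hp]
  · intro g hg
    apply cofree_hom_ext
    rw [cofreeLift_counitMap]
    apply hu
    intro i
    rw [← key, hg]

/-- When `- ⊗ C` preserves the equalizer `e`, the restricted coaction of `A` factors through `e ▷
C`. The comodule axioms can be checked after the monomorphisms into `A ⊗ C ⊗ C` and `A ⊗ 𝟙_`, where
they hold for `A`. -/
theorem exists_equalizer {A B : RightComodule C} (f g : A ⟶ B) {E : V} (e : E ⟶ A.X)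
    (w : e ≫ f.hom = e ≫ g.hom) [Mono e] [Mono (e ▷ C)] [Mono ((e ▷ C) ▷ C)]
    (lift : ∀ (Z : V) (h : Z ⟶ A.X), h ≫ f.hom = h ≫ g.hom → ∃ l, l ≫ e = h)
    (liftC : ∀ (Z : V) (h : Z ⟶ A.X ⊗ C), h ≫ f.hom ▷ C = h ≫ g.hom ▷ C → ∃ l, l ≫ e ▷ C = h) :
    ∃ (E' : RightComodule C) (i : E' ⟶ A), i ≫ f = i ≫ g ∧
      ∀ (Z : RightComodule C) (h : Z ⟶ A), h ≫ f = h ≫ g → ∃! l, l ≫ i = h := by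
  obtain ⟨ρ, hρ⟩ := liftC E (e ≫ A.ρ) (by
    rw [Category.assoc, Category.assoc, f.comm, g.comm, reassoc_of% w])
  have : Mono (e ▷ (C ⊗ C)) := by
    have : e ▷ (C ⊗ C) = (α_ E C C).inv ≫ (e ▷ C) ▷ C ≫ (α_ A.X C C).hom := by simp
    rw [this]; infer_instance
  let E' : RightComodule C :=
    { X := E
      ρ := ρ
      coassoc := by
        rw [← cancel_mono (e ▷ (C ⊗ C)), Category.assoc, whisker_exchange, reassoc_of% hρ,
          A.coassoc]
        simp only [Category.assoc]
        rw [← associator_naturality_left, ← comp_whiskerRight_assoc, hρ, comp_whiskerRight_assoc,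
          ← reassoc_of% hρ]
      counit := by
        have hm : Mono (e ▷ 𝟙_ V) := by
          have : e ▷ 𝟙_ V = (ρ_ E).hom ≫ e ≫ (ρ_ A.X).inv := by simp
          rw [this]; infer_instance
        rw [← cancel_mono (e ▷ 𝟙_ V), Category.assoc, whisker_exchange, reassoc_of% hρ, A.counit]
        simp }
  refine ⟨E', ⟨e, hρ⟩, ?_, ?_⟩
  · ext; exact w
  · intro Z h hh
    obtain ⟨l, hl⟩ := lift Z.X h.hom (congrArg Hom.hom hh)
    refine ⟨⟨l, ?_⟩, ?_, ?_⟩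
    · rw [← cancel_mono (e ▷ C), Category.assoc, Category.assoc, ← comp_whiskerRight, hl, h.comm]
      change _ = l ≫ ρ ≫ e ▷ C
      rw [hρ, reassoc_of% hl]
    · ext; exact hl
    · intro l' hl'
      ext
      rw [← cancel_mono e]
      exact (congrArg Hom.hom hl').trans hl.symm

theorem tensorMap_id_comp {W : V} {A B D : RightComodule C} (f : A ⟶ B) (g : B ⟶ D) :
    tensorMap (𝟙 W) (f ≫ g) = tensorMap (𝟙 W) f ≫ tensorMap (𝟙 W) g := by
  ext; simp

theorem tensorMap_exchange {W W' : V} {A B : RightComodule C} (f : W ⟶ W') (g : A ⟶ B) :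
    tensorMap f (𝟙 A) ≫ tensorMap (𝟙 W') g = tensorMap (𝟙 W) g ≫ tensorMap f (𝟙 B) := by
  ext; simp [← whisker_exchange]

-- The limit sits inside the cofree comodule on the product of the internal Homs from `W [n]` to `X
-- ⊗ C ^ n`, which carries the universal family of legs. Each compatibility condition says that two
-- maps into another representing cofree comodule agree. The cofaces and the codegeneracies suffice,
-- since cones are only required to respect these.
variable (C) in
theorem exists_isLimit_cobar
    (hHom : ∀ (ι : Type) (W G : ι → V), ∃ (P : V) (ev : ∀ i, W i ⊗ P ⟶ G i),
      ∀ (B : V) (π : ∀ i, W i ⊗ B ⟶ G i), ∃! f : B ⟶ P, ∀ i, W i ◁ f ≫ ev i = π i)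
    (hEq : ∀ {A B : RightComodule C} (f g : A ⟶ B), ∃ (E' : RightComodule C) (i : E' ⟶ A),
      i ≫ f = i ≫ g ∧ ∀ (Z : RightComodule C) (h : Z ⟶ A), h ≫ f = h ≫ g → ∃! l, l ≫ i = h)
    (W : SimplexCategory ⥤ V) (X : RightComodule C) :
    ∃ T : WeightedCone W (cobar X), T.IsLimit := by
  obtain ⟨P, evP, hP⟩ := hHom ℕ (fun n => W.obj (SimplexCategory.mk n)) (fun n => (cobarObj X n).X)
  have HP := cofree_representable (C := C) evP hP
  obtain ⟨Q₁, ev₁, hQ₁⟩ := hHom (Σ n : ℕ, Fin (n + 2)) (fun c => W.obj (SimplexCategory.mk c.1))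
    (fun c => (cobarObj X (c.1 + 1)).X)
  have HQ₁ := cofree_representable (C := C) ev₁ hQ₁
  obtain ⟨Q₂, ev₂, hQ₂⟩ := hHom (Σ n : ℕ, Fin (n + 1))
    (fun c => W.obj (SimplexCategory.mk (c.1 + 1))) (fun c => (cobarObj X c.1).X)
  have HQ₂ := cofree_representable (C := C) ev₂ hQ₂
  let π : ∀ n, tensorLeft (W.obj (SimplexCategory.mk n)) (cofree C P) ⟶ cobarObj X (n + 1) :=
    fun n => cofreeEval (evP n)
  obtain ⟨f₁, hf₁, -⟩ := HQ₁ (cofree C P) (fun c => π c.1 ≫ cobarCoface X (c.1 + 1) c.2)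
  obtain ⟨g₁, hg₁, -⟩ := HQ₁ (cofree C P)
    (fun c => tensorMap (W.map (SimplexCategory.δ c.2)) (𝟙 _) ≫ π (c.1 + 1))
  obtain ⟨f₂, hf₂, -⟩ := HQ₂ (cofree C P) (fun c => π (c.1 + 1) ≫ cobarCodegeneracy X c.1 c.2)
  obtain ⟨g₂, hg₂, -⟩ := HQ₂ (cofree C P)
    (fun c => tensorMap (W.map (SimplexCategory.σ c.2)) (𝟙 _) ≫ π c.1)
  -- Uniqueness in `HQ₁` turns one equation between maps into the family of all coface conditions;
  -- `u₂` does this for the codegeneracies.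
  have u₁ : ∀ {A : RightComodule C} (t : A ⟶ cofree C P), t ≫ f₁ = t ≫ g₁ ↔
      ∀ (n : ℕ) (i : Fin (n + 2)), (tensorMap (𝟙 _) t ≫ π n) ≫ cobarCoface X (n + 1) i =
        tensorMap (W.map (SimplexCategory.δ i)) (𝟙 _) ≫ tensorMap (𝟙 _) t ≫ π (n + 1) := by
    intro A t
    have a1 : ∀ c, tensorMap (𝟙 _) (t ≫ f₁) ≫ cofreeEval (ev₁ c) =
        (tensorMap (𝟙 _) t ≫ π c.1) ≫ cobarCoface X (c.1 + 1) c.2 := fun c => by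
      rw [tensorMap_id_comp, Category.assoc, hf₁, Category.assoc]
    have a2 : ∀ c, tensorMap (𝟙 _) (t ≫ g₁) ≫ cofreeEval (ev₁ c) =
        tensorMap (W.map (SimplexCategory.δ c.2)) (𝟙 _) ≫ tensorMap (𝟙 _) t ≫ π (c.1 + 1) :=
      fun c => by
        rw [tensorMap_id_comp, Category.assoc, hg₁, ← Category.assoc, ← tensorMap_exchange,
          Category.assoc]
    constructor
    · intro h n i
      rw [← a1 ⟨n, i⟩, ← a2 ⟨n, i⟩, h]
    · intro h
      exact (HQ₁ A _).unique a1 (fun c => (a2 c).trans (h c.1 c.2).symm)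
  have u₂ : ∀ {A : RightComodule C} (t : A ⟶ cofree C P), t ≫ f₂ = t ≫ g₂ ↔
      ∀ (n : ℕ) (i : Fin (n + 1)), (tensorMap (𝟙 _) t ≫ π (n + 1)) ≫ cobarCodegeneracy X n i =
        tensorMap (W.map (SimplexCategory.σ i)) (𝟙 _) ≫ tensorMap (𝟙 _) t ≫ π n := by
    intro A t
    have a1 : ∀ c, tensorMap (𝟙 _) (t ≫ f₂) ≫ cofreeEval (ev₂ c) =
        (tensorMap (𝟙 _) t ≫ π (c.1 + 1)) ≫ cobarCodegeneracy X c.1 c.2 := fun c => by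
      rw [tensorMap_id_comp, Category.assoc, hf₂, Category.assoc]
    have a2 : ∀ c, tensorMap (𝟙 _) (t ≫ g₂) ≫ cofreeEval (ev₂ c) =
        tensorMap (W.map (SimplexCategory.σ c.2)) (𝟙 _) ≫ tensorMap (𝟙 _) t ≫ π c.1 :=
      fun c => by
        rw [tensorMap_id_comp, Category.assoc, hg₂, ← Category.assoc, ← tensorMap_exchange,
          Category.assoc]
    constructor
    · intro h n i
      rw [← a1 ⟨n, i⟩, ← a2 ⟨n, i⟩, h]
    · intro h
      exact (HQ₂ A _).unique a1 (fun c => (a2 c).trans (h c.1 c.2).symm)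
  obtain ⟨E₁, i₁, hi₁, hE₁⟩ := hEq f₁ g₁
  -- The second equalizer is taken inside the first, so that products of comodules are not required.
  obtain ⟨E₂, i₂, hi₂, hE₂⟩ := hEq (i₁ ≫ f₂) (i₁ ≫ g₂)
  let T : WeightedCone W (cobar X) :=
    { pt := E₂
      π := fun n => tensorMap (𝟙 _) (i₂ ≫ i₁) ≫ π n
      π_d := (u₁ (i₂ ≫ i₁)).1 (by rw [Category.assoc, hi₁, Category.assoc])
      π_s := (u₂ (i₂ ≫ i₁)).1 (by rw [Category.assoc, hi₂, Category.assoc]) }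
  refine ⟨T, fun S => ?_⟩
  obtain ⟨t, ht, htu⟩ := HP S.pt S.π
  have ht' : ∀ n, tensorMap (𝟙 (W.obj (SimplexCategory.mk n))) t ≫ π n = S.π n := ht
  obtain ⟨l₁, hl₁, hu₁⟩ := hE₁ S.pt t ((u₁ t).2 (fun n i => by rw [ht', ht']; exact S.π_d n i))
  obtain ⟨l₂, hl₂, hu₂⟩ := hE₂ S.pt l₁ (by
    rw [← Category.assoc, ← Category.assoc, hl₁]
    exact (u₂ t).2 (fun n i => by rw [ht', ht']; exact S.π_s n i))
  refine ⟨l₂, ?_, ?_⟩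
  · intro n
    change tensorMap (𝟙 _) l₂ ≫ tensorMap (𝟙 _) (i₂ ≫ i₁) ≫ π n = _
    rw [← Category.assoc, ← tensorMap_id_comp, ← Category.assoc, hl₂, hl₁]
    exact ht' n
  · intro l hl
    apply hu₂
    apply hu₁
    apply htu
    intro n
    change tensorMap (𝟙 _) ((l ≫ i₂) ≫ i₁) ≫ π n = _
    rw [Category.assoc, tensorMap_id_comp, Category.assoc]
    exact hl n

end Abstract

end RightComodule

end
end DGComod

namespace DGComod
noncomputable section

/-! ### Equalizers of comodules over a semisimple ring -/

section Semisimple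

variable {k : Type u} [CommRing k]

/-- The tensor product with `B` of a family of linear maps between the components of two
complexes. -/
def gradedWhisker {A E : Ch k} (B : Ch k) (r : ∀ i, A.X i →ₗ[k] E.X i) (n : ℕ) :
    (A ⊗ B : Ch k).X n →ₗ[k] (E ⊗ B : Ch k).X n :=
  tdesc (fun i j => (tm E B i j n).comp (r i))

theorem gradedWhisker_tm {A E : Ch k} (B : Ch k) (r : ∀ i, A.X i →ₗ[k] E.X i) {i j n : ℕ}
    (h : i + j = n) (a : A.X i) (b : B.X j) :
    gradedWhisker B r n (tm A B i j n a b) = tm E B i j n (r i a) b :=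
  tdesc_tm (fun i j => (tm E B i j n).comp (r i)) h a b

/-- A morphism of chain complexes which has a retraction as a morphism of graded modules. -/
def HasGradedRetraction {A B : Ch k} (f : A ⟶ B) : Prop :=
  ∃ r : ∀ n, B.X n →ₗ[k] A.X n, ∀ n a, r n ((f.f n).hom a) = a

theorem HasGradedRetraction.whiskerRight {A B : Ch k} {f : A ⟶ B} (hf : HasGradedRetraction f)
    (D : Ch k) : HasGradedRetraction (f ▷ D) := by
  obtain ⟨r, hr⟩ := hf
  refine ⟨gradedWhisker D r, fun n => ?_⟩
  have : gradedWhisker D r n ∘ₗ ((f ▷ D).f n).hom = LinearMap.id := by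
    apply tm_ext
    intro i j h a b
    rw [LinearMap.comp_apply, whiskerRight_tm, gradedWhisker_tm _ _ h, hr]; rfl
  exact LinearMap.congr_fun this

theorem HasGradedRetraction.injective {A B : Ch k} {f : A ⟶ B} (hf : HasGradedRetraction f)
    (n : ℕ) {a a' : A.X n} (h : (f.f n).hom a = (f.f n).hom a') : a = a' := by
  obtain ⟨r, hr⟩ := hf
  rw [← hr n a, h, hr]

theorem HasGradedRetraction.mono {A B : Ch k} {f : A ⟶ B} (hf : HasGradedRetraction f) :
    Mono f where
  right_cancellation g h w := by
    apply ch_ext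
    intro n a
    exact hf.injective n (congrArg (fun t => (t.f n).hom a) w)

/-- A morphism into the source of a map with a graded retraction, given by its components. -/
def homOfInjective {A B Z : Ch k} {f : A ⟶ B} (hf : HasGradedRetraction f) (h : Z ⟶ B)
    (l : ∀ n, Z.X n →ₗ[k] A.X n) (hl : ∀ n z, (f.f n).hom (l n z) = (h.f n).hom z) : Z ⟶ A where
  f n := ModuleCat.ofHom (l n)
  comm' i j _ := by
    apply ModuleCat.hom_ext
    refine LinearMap.ext fun z => ?_
    apply hf.injective
    change (f.f j).hom ((A.d i j).hom (l i z)) = (f.f j).hom (l j ((Z.d i j).hom z))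
    rw [hl, hom_d, hl, hom_d]

theorem homOfInjective_comp {A B Z : Ch k} {f : A ⟶ B} (hf : HasGradedRetraction f) (h : Z ⟶ B)
    (l : ∀ n, Z.X n →ₗ[k] A.X n) (hl : ∀ n z, (f.f n).hom (l n z) = (h.f n).hom z) :
    homOfInjective hf h l hl ≫ f = h :=
  ch_ext hl

/-- Over a semisimple ring the range of `f` is projective, so `f` splits over it, and the range has
a complement, so the splitting extends to all of `N`. -/
theorem exists_generalized_inverse [IsSemisimpleRing k] {M N : Type*} [AddCommGroup M] [Module k M]
    [AddCommGroup N] [Module k N] (f : M →ₗ[k] N) : ∃ s : N →ₗ[k] M, f ∘ₗ s ∘ₗ f = f := by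
  have hp : Module.Projective k (LinearMap.range f) :=
    Module.projective_of_isSemisimpleRing k _
  obtain ⟨t, ht⟩ := Module.projective_lifting_property (LinearMap.rangeRestrict f)
    (LinearMap.id : LinearMap.range f →ₗ[k] LinearMap.range f) (LinearMap.surjective_rangeRestrict f)
  obtain ⟨q, hq⟩ := exists_isCompl (LinearMap.range f)
  refine ⟨t ∘ₗ (LinearMap.range f).projectionOnto q hq, ?_⟩
  ext x
  have h1 : (LinearMap.range f).projectionOnto q hq (f x) = f.rangeRestrict x :=
    Submodule.projectionOnto_apply_left hq (f.rangeRestrict x)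
  have h2 := LinearMap.congr_fun ht (f.rangeRestrict x)
  simp only [LinearMap.comp_apply, h1]
  exact congrArg Subtype.val h2

/-- The complex of kernels of the components of a difference of two morphisms. -/
def eqComplex {A B : Ch k} (f g : A ⟶ B) : Ch k where
  X n := ModuleCat.of k (LinearMap.ker ((f.f n).hom - (g.f n).hom))
  d i j := ModuleCat.ofHom (LinearMap.restrict (A.d i j).hom (fun a ha => by
    rw [LinearMap.mem_ker, LinearMap.sub_apply, sub_eq_zero] at ha ⊢
    rw [hom_d, hom_d, ha]))
  shape i j h := by
    apply ModuleCat.hom_ext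
    refine LinearMap.ext fun a => Subtype.ext ?_
    exact congrArg (fun t => t.hom a.1) (A.shape i j h)
  d_comp_d' i j l _ _ := by
    apply ModuleCat.hom_ext
    refine LinearMap.ext fun a => Subtype.ext ?_
    exact d_d A i j l a.1

/-- The inclusion of `eqComplex`. -/
def eqInclusion {A B : Ch k} (f g : A ⟶ B) : eqComplex f g ⟶ A where
  f _ := ModuleCat.ofHom (Submodule.subtype _)
  comm' _ _ _ := rfl

theorem eqInclusion_condition {A B : Ch k} (f g : A ⟶ B) :
    eqInclusion f g ≫ f = eqInclusion f g ≫ g := by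
  apply ch_ext
  exact fun _ a => sub_eq_zero.1 a.2

/-- The equation `e r = 1 - s (f - g)` says that `r` retracts `A` onto the kernel up to a term that
vanishes on the kernel. Being an identity of linear maps, it persists after tensoring, unlike the
bare definition of a kernel. Neither `r` nor `s` has to commute with differentials. -/
theorem exists_eqInclusion_splitting [IsSemisimpleRing k] {A B : Ch k} (f g : A ⟶ B) :
    ∃ (r : ∀ n, A.X n →ₗ[k] (eqComplex f g).X n) (s : ∀ n, B.X n →ₗ[k] A.X n),
      ∀ n a, ((eqInclusion f g).f n).hom (r n a) = a - s n ((f.f n).hom a - (g.f n).hom a) := by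
  choose s hs using fun n => exists_generalized_inverse ((f.f n).hom - (g.f n).hom)
  have hs' : ∀ n a, ((f.f n).hom - (g.f n).hom) (a - s n (((f.f n).hom - (g.f n).hom) a)) = 0 :=
    fun n a => by
      rw [map_sub, sub_eq_zero]; exact (LinearMap.congr_fun (hs n) a).symm
  exact ⟨fun n => LinearMap.codRestrict (LinearMap.ker ((f.f n).hom - (g.f n).hom))
    (LinearMap.id - s n ∘ₗ ((f.f n).hom - (g.f n).hom)) (hs' n), s, fun _ _ => rfl⟩

/-- Any `z` equalized by `f ▷ D` and `g ▷ D` is therefore the image of `gradedWhisker D r n z`; this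
yields the lifts that `exists_equalizer` asks for. -/
theorem gradedWhisker_splitting {E A B : Ch k} (e : E ⟶ A) (f g : A ⟶ B) (D : Ch k)
    (r : ∀ n, A.X n →ₗ[k] E.X n) (s : ∀ n, B.X n →ₗ[k] A.X n)
    (hr : ∀ n a, (e.f n).hom (r n a) = a - s n ((f.f n).hom a - (g.f n).hom a)) (n : ℕ)
    (z : (A ⊗ D : Ch k).X n) : ((e ▷ D).f n).hom (gradedWhisker D r n z) =
      z - gradedWhisker D s n (((f ▷ D).f n).hom z - ((g ▷ D).f n).hom z) := by
  have key : ((e ▷ D).f n).hom ∘ₗ gradedWhisker D r n =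
      LinearMap.id - gradedWhisker D s n ∘ₗ (((f ▷ D).f n).hom - ((g ▷ D).f n).hom) := by
    apply tm_ext
    intro i j hij a b
    rw [LinearMap.comp_apply, gradedWhisker_tm _ _ hij, whiskerRight_tm, hr, LinearMap.sub_apply,
      LinearMap.comp_apply, LinearMap.sub_apply, whiskerRight_tm, whiskerRight_tm,
      map_sub (gradedWhisker D s n), gradedWhisker_tm _ _ hij, gradedWhisker_tm _ _ hij]
    simp only [map_sub, LinearMap.sub_apply]
    rfl
  exact LinearMap.congr_fun key z

theorem exists_comodule_equalizer [IsSemisimpleRing k] {C : Ch k} [ComonObj C]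
    {A B : RightComodule C} (f g : A ⟶ B) :
    ∃ (E : RightComodule C) (i : E ⟶ A), i ≫ f = i ≫ g ∧
      ∀ (Z : RightComodule C) (h : Z ⟶ A), h ≫ f = h ≫ g → ∃! l, l ≫ i = h := by
  obtain ⟨r, s, hr⟩ := exists_eqInclusion_splitting f.hom g.hom
  have hret : HasGradedRetraction (eqInclusion f.hom g.hom) := by
    refine ⟨r, fun n a => Subtype.ext ((hr n _).trans ?_)⟩
    rw [← comp_hom_apply, ← comp_hom_apply, eqInclusion_condition, sub_self, map_zero, sub_zero]
    rfl
  have := hret.mono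
  have := (hret.whiskerRight C).mono
  have := ((hret.whiskerRight C).whiskerRight C).mono
  apply RightComodule.exists_equalizer f g (eqInclusion f.hom g.hom)
    (eqInclusion_condition f.hom g.hom)
  · intro Z h hh
    refine ⟨homOfInjective hret h (fun n => r n ∘ₗ (h.f n).hom) (fun n z => ?_),
      homOfInjective_comp _ _ _ _⟩
    rw [LinearMap.comp_apply, hr, ← comp_hom_apply, ← comp_hom_apply, hh, sub_self, map_zero,
      sub_zero]
  · intro Z h hh
    refine ⟨homOfInjective (hret.whiskerRight C) h
      (fun n => gradedWhisker C r n ∘ₗ (h.f n).hom) (fun n z => ?_), homOfInjective_comp _ _ _ _⟩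
    rw [LinearMap.comp_apply, gradedWhisker_splitting _ f.hom g.hom C r s hr, ← comp_hom_apply,
      ← comp_hom_apply, hh, sub_self, map_zero, sub_zero]

/-- The homotopy limit of the cobar construction exists. -/
theorem exists_isLimit_cobar [IsSemisimpleRing k] {C : Ch k} [ComonObj C]
    (W : SimplexCategory ⥤ Ch k) (X : RightComodule C) :
    ∃ T : WeightedCone W (cobar X), T.IsLimit :=
  RightComodule.exists_isLimit_cobar C
    (fun _ W G => ⟨homFam W G, homFamEval W G, homFam_existsUnique W G⟩)
    (fun f g => exists_comodule_equalizer f g) W X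

end Semisimple

end
end DGComod

namespace DGComod
noncomputable section

/-! ### Generators and relations of the simplex category: faithfulness -/

section GenRel

open SimplexCategoryGenRel

/-- The functor to the simplex category, on morphisms between the standard objects. -/
def toS {m n : ℕ} (f : mk m ⟶ mk n) : SimplexCategory.mk m ⟶ SimplexCategory.mk n :=
  toSimplexCategory.map f

theorem toS_id (n : ℕ) : toS (𝟙 (mk n)) = 𝟙 _ := toSimplexCategory.map_id _

theorem toS_comp {l m n : ℕ} (f : mk l ⟶ mk m) (g : mk m ⟶ mk n) :
    toS (f ≫ g) = toS f ≫ toS g := toSimplexCategory.map_comp f g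

theorem toS_δ {n : ℕ} (i : Fin (n + 2)) : toS (δ i) = SimplexCategory.δ i := rfl

theorem toS_σ {n : ℕ} (i : Fin (n + 1)) : toS (σ i) = SimplexCategory.σ i := rfl

/-- Composites of degeneracies in the simplex category given by generators and relations. -/
inductive IsDeg : ∀ {m n : ℕ}, (mk m ⟶ mk n) → Prop
  | id (n : ℕ) : IsDeg (𝟙 (mk n))
  | comp {m n : ℕ} (i : Fin (m + 1)) (g : mk m ⟶ mk n) : IsDeg g → IsDeg (σ i ≫ g)

/-- Composites of faces in the simplex category given by generators and relations. -/
inductive IsFace : ∀ {m n : ℕ}, (mk m ⟶ mk n) → Prop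
  | id (n : ℕ) : IsFace (𝟙 (mk n))
  | comp {m n : ℕ} (g : mk m ⟶ mk n) (i : Fin (n + 2)) : IsFace g → IsFace (g ≫ δ i)

theorem isDeg_of_P_σ {x y : SimplexCategoryGenRel} {f : x ⟶ y} (hf : P_σ f) :
    @IsDeg x.len y.len f := by
  rw [P_σ, MorphismProperty.multiplicativeClosure_eq_multiplicativeClosure'] at hf
  induction hf with
  | of f hf =>
    obtain ⟨i⟩ := hf
    have := IsDeg.comp i _ (IsDeg.id _)
    rwa [Category.comp_id] at this
  | id x => exact IsDeg.id _
  | of_comp f g hf _ ih =>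
    obtain ⟨i⟩ := hf
    exact IsDeg.comp i _ ih

theorem isFace_of_P_δ {x y : SimplexCategoryGenRel} {f : x ⟶ y} (hf : P_δ f) :
    @IsFace x.len y.len f := by
  induction hf with
  | of f hf =>
    obtain ⟨i⟩ := hf
    have := IsFace.comp _ i (IsFace.id _)
    rwa [Category.id_comp] at this
  | id x => exact IsFace.id _
  | comp_of f g _ hg ih =>
    obtain ⟨i⟩ := hg
    exact IsFace.comp _ i ih

theorem exists_isDeg_isFace {m n : ℕ} (f : mk m ⟶ mk n) :
    ∃ (l : ℕ) (e : mk m ⟶ mk l) (i : mk l ⟶ mk n), IsDeg e ∧ IsFace i ∧ f = e ≫ i := by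
  obtain ⟨z, e, i, he, hi, h⟩ := exists_P_σ_P_δ_factorization f
  exact ⟨z.len, e, i, isDeg_of_P_σ he, isFace_of_P_δ hi, h⟩

theorem IsDeg.le {m n : ℕ} {f : mk m ⟶ mk n} (hf : IsDeg f) : n ≤ m := by
  induction hf with
  | id => exact le_rfl
  | comp => omega

theorem IsFace.le {m n : ℕ} {f : mk m ⟶ mk n} (hf : IsFace f) : m ≤ n := by
  induction hf with
  | id => exact le_rfl
  | comp => omega

theorem IsDeg.epi {m n : ℕ} {f : mk m ⟶ mk n} (hf : IsDeg f) : Epi (toS f) := by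
  induction hf with
  | id => rw [toS_id]; infer_instance
  | comp i g _ ih =>
    rw [toS_comp, toS_σ]
    exact epi_comp' inferInstance ih

theorem IsFace.mono {m n : ℕ} {f : mk m ⟶ mk n} (hf : IsFace f) :
    Mono (toS f) := by
  induction hf with
  | id => rw [toS_id]; infer_instance
  | comp g i _ ih =>
    rw [toS_comp, toS_δ]
    exact mono_comp' ih inferInstance

/-- Induction on the word, moving `σ j` to the front by the simplicial identities. The extra
variable `f'` and the heterogeneous equality leave the source index free for the induction. -/
theorem IsDeg.factor {m n : ℕ} {f : mk m ⟶ mk n} (hf : IsDeg f) :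
    ∀ {m' : ℕ} (f' : mk (m' + 1) ⟶ mk n), m = m' + 1 → HEq f f' → ∀ (j : Fin (m' + 1))
      (h : SimplexCategory.mk m' ⟶ SimplexCategory.mk n),
      toS f' = SimplexCategory.σ j ≫ h → ∃ g, IsDeg g ∧ f' = σ j ≫ g := by
  induction hf with
  | id n =>
    rintro m' f' rfl hf' j h hj
    obtain rfl := eq_of_heq hf'
    rw [toS_id] at hj
    have : Mono (SimplexCategory.σ j) := by
      have : Mono (SimplexCategory.σ j ≫ h) := by rw [← hj]; infer_instance
      exact mono_of_mono (SimplexCategory.σ j) h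
    have := SimplexCategory.len_le_of_mono (SimplexCategory.σ j)
    simp at this
  | @comp m n i g hg ih =>
    rintro m' f' hm hf' j h hj
    obtain rfl : m = m' := by omega
    obtain rfl := eq_of_heq hf'
    rw [toS_comp, toS_σ] at hj
    rcases lt_trichotomy i j with hij | rfl | hij
    · obtain ⟨m, rfl⟩ : ∃ l, m = l + 1 := ⟨m - 1, by have := j.2; have := hij; omega⟩
      obtain ⟨j, rfl⟩ := Fin.exists_succ_eq.2 (Fin.ne_zero_of_lt hij)
      obtain ⟨i, rfl⟩ := Fin.exists_castSucc_eq.2 (Fin.ne_last_of_lt hij)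
      have hij' : i ≤ j := Fin.castSucc_lt_succ_iff.1 hij
      obtain ⟨g', hg', rfl⟩ := ih g rfl HEq.rfl j (SimplexCategory.δ i.castSucc ≫ h) (by
        -- Composing with a section of the first degeneracy removes it from the left side and leaves
        -- `σ j` in front on the right side, as the induction hypothesis needs.
        have h2 := SimplexCategory.δ i.castSucc.castSucc ≫= hj
        rw [SimplexCategory.δ_comp_σ_self_assoc, SimplexCategory.δ_comp_σ_of_le_assoc] at h2
        · exact h2
        · exact hij')
      refine ⟨σ i ≫ g', .comp _ _ hg', ?_⟩
      rw [σ_comp_σ_assoc hij']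
    · exact ⟨g, hg, rfl⟩
    · obtain ⟨m, rfl⟩ : ∃ l, m = l + 1 := ⟨m - 1, by have := i.2; have := hij; omega⟩
      obtain ⟨i, rfl⟩ := Fin.exists_succ_eq.2 (Fin.ne_zero_of_lt hij)
      obtain ⟨j, rfl⟩ := Fin.exists_castSucc_eq.2 (Fin.ne_last_of_lt hij)
      have hij' : j ≤ i := Fin.castSucc_lt_succ_iff.1 hij
      obtain ⟨g', hg', rfl⟩ := ih g rfl HEq.rfl j (SimplexCategory.δ i.succ ≫ h) (by
        have h2 := SimplexCategory.δ i.succ.succ ≫= hj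
        rw [SimplexCategory.δ_comp_σ_succ_assoc, SimplexCategory.δ_comp_σ_of_gt_assoc] at h2
        · exact h2
        · exact hij)
      refine ⟨σ i ≫ g', .comp _ _ hg', ?_⟩
      rw [← σ_comp_σ_assoc hij']

theorem IsDeg.ext {m n : ℕ} {f : mk m ⟶ mk n} (hf : IsDeg f) {g : mk m ⟶ mk n} (hg : IsDeg g)
    (h : toS f = toS g) : f = g := by
  induction hf with
  | id n =>
    generalize hm : n = m at g
    cases hg with
    | id => rfl
    | comp i g hg => have := hg.le; omega
  | comp i f hf ih =>
    rw [toS_comp, toS_σ] at h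
    obtain ⟨g', hg', rfl⟩ := hg.factor g rfl HEq.rfl i _ h.symm
    rw [toS_comp, toS_σ, cancel_epi] at h
    rw [ih hg' h]

/-- Dual to `IsDeg.factor`: a composite of faces that misses the vertex `j` can be rewritten to end
with `δ j`. If the last face is `δ i` with `i ≠ j`, the preceding word misses the preimage `p` of
`j` under `δ i`. -/
theorem IsFace.factor {m n : ℕ} {f : mk m ⟶ mk n} (hf : IsFace f) :
    ∀ {n' : ℕ} (f' : mk m ⟶ mk (n' + 1)), n = n' + 1 → HEq f f' → ∀ (j : Fin (n' + 2)),
      (∀ x, (toS f').toOrderHom x ≠ j) → ∃ g, IsFace g ∧ f' = g ≫ δ j := by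
  induction hf with
  | id =>
    rintro n' f' rfl hf' j hj
    obtain rfl := eq_of_heq hf'
    exact absurd rfl (hj j)
  | @comp n g i hg ih =>
    rintro n' f' hm hf' j hj
    obtain rfl : n = n' := by omega
    obtain rfl := eq_of_heq hf'
    by_cases hij : j = i
    · subst hij; exact ⟨g, hg, rfl⟩
    obtain ⟨p, rfl⟩ := Fin.exists_succAbove_eq hij
    have hp : ∀ x, (toS g).toOrderHom x ≠ p := by
      rintro x rfl
      exact hj x (by rw [toS_comp]; rfl)
    obtain ⟨n, rfl⟩ : ∃ l, n = l + 1 := by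
      rcases n with _ | n
      · exact absurd (Subsingleton.elim (α := Fin 1) _ _) (hp 0)
      · exact ⟨n, rfl⟩
    obtain ⟨g', hg', rfl⟩ := ih g rfl HEq.rfl p hp
    rcases le_or_gt i p.castSucc with hle | hlt
    · obtain ⟨i, rfl⟩ := Fin.exists_castSucc_eq.2 (Fin.ne_last_of_lt
        (lt_of_le_of_lt hle (Fin.castSucc_lt_last p)))
      refine ⟨g' ≫ δ i, .comp _ _ hg', ?_⟩
      rw [Fin.succAbove_of_le_castSucc _ _ hle, Category.assoc, Category.assoc,
        δ_comp_δ (Fin.castSucc_le_castSucc_iff.1 hle)]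
    · obtain ⟨i, rfl⟩ := Fin.exists_succ_eq.2 (Fin.ne_zero_of_lt hlt)
      refine ⟨g' ≫ δ i, .comp _ _ hg', ?_⟩
      rw [Fin.succAbove_of_castSucc_lt _ _ hlt, Category.assoc, Category.assoc,
        δ_comp_δ (Fin.castSucc_lt_succ_iff.1 hlt)]

theorem IsFace.ext {m n : ℕ} {f : mk m ⟶ mk n} (hf : IsFace f) {g : mk m ⟶ mk n} (hg : IsFace g)
    (h : toS f = toS g) : f = g := by
  induction hf with
  | id =>
    generalize hm : n = m at g
    cases hg with
    | id => rfl
    | comp g i hg => have := hg.le; omega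
  | comp f i hf ih =>
    rw [toS_comp, toS_δ] at h
    obtain ⟨g', hg', rfl⟩ := hg.factor g rfl HEq.rfl i (fun x hx => by
      rw [← h] at hx
      exact Fin.succAbove_ne i _ hx)
    rw [toS_comp, toS_δ, cancel_mono] at h
    rw [ih hg' h]

/-- Every word is a composite of degeneracies followed by faces. Their images form an epi-mono
factorization in the simplex category, where such factorizations are unique, and words of one kind
are determined by their images (`IsDeg.ext`, `IsFace.ext`). -/
theorem toS_injective {m n : ℕ} {f g : mk m ⟶ mk n}
    (h : toS f = toS g) : f = g := by
  obtain ⟨l, e, i, he, hi, rfl⟩ := exists_isDeg_isFace f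
  obtain ⟨l', e', i', he', hi', rfl⟩ := exists_isDeg_isFace g
  rw [toS_comp, toS_comp] at h
  have := he.epi
  have := he'.epi
  have := hi.mono
  have := hi'.mono
  have : StrongEpi (toS e) := strongEpi_of_epi _
  -- The diagonal of this square is mono and epi, so the intermediate objects agree and the diagonal
  -- is the identity.
  have sq : CommSq (toS e') (toS e)
    (toS i') (toS i) := ⟨h.symm⟩
  have hm : Mono sq.lift := by
    have : Mono (sq.lift ≫ toS i') := by rw [sq.fac_right]; infer_instance
    exact mono_of_mono _ (toS i')
  have hp : Epi sq.lift := by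
    have : Epi (toS e ≫ sq.lift) := by rw [sq.fac_left]; infer_instance
    exact epi_of_epi (toS e) _
  have h1 : l ≤ l' := SimplexCategory.len_le_of_mono sq.lift
  have h2 : l' ≤ l := SimplexCategory.len_le_of_epi sq.lift
  obtain rfl : l = l' := le_antisymm h1 h2
  have h3 := SimplexCategory.eq_id_of_mono sq.lift
  have h4 := sq.fac_left
  have h5 := sq.fac_right
  rw [h3] at h4 h5
  rw [he.ext he' ((Category.comp_id _).symm.trans h4),
    hi.ext hi' ((Category.id_comp _).symm.trans h5).symm]

theorem exists_toS {x y : SimplexCategory} (f : x ⟶ y) :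
    ∃ g : mk x.len ⟶ mk y.len, toS g = f := by
  let W : MorphismProperty SimplexCategory := fun x y f =>
    ∃ g : mk x.len ⟶ mk y.len, toS g = f
  have : W.IsMultiplicative :=
    { id_mem := fun x => ⟨𝟙 _, toS_id _⟩
      comp_mem := by
        rintro x y z _ _ ⟨f, rfl⟩ ⟨g, rfl⟩
        exact ⟨f ≫ g, toS_comp f g⟩ }
  have h := SimplexCategory.morphismProperty_eq_top W (fun i => ⟨δ i, rfl⟩) (fun i => ⟨σ i, rfl⟩)
  have : W f := by rw [h]; trivial
  exact this

end GenRel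

/-! ### Cosimplicial objects as functors on the simplex category -/

namespace Cosimplicial

variable {D : Type u} [Category.{v} D] (F : Cosimplicial D)

/-- The functor on the simplex category given by generators and relations which is defined by
a cosimplicial object. -/
def genFunctor : SimplexCategoryGenRel ⥤ D :=
  CategoryTheory.Quotient.lift _
    (Paths.lift
      { obj := F.obj
        map := fun f => match f with
          | FreeSimplexQuiver.Hom.δ (n := n) i => F.d n i
          | FreeSimplexQuiver.Hom.σ (n := n) i => F.s n i })
    (by
      rintro _ _ _ _ h
      rcases h with H | H | _ | _ | H | H
      · exact ((congrArg (· ≫ _) (Category.id_comp _)).trans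
          (F.d_comp_d _ _ _ H)).trans
          (congrArg (· ≫ _) (Category.id_comp _)).symm
      · exact ((congrArg (· ≫ _) (Category.id_comp _)).trans
          (F.d_comp_s_of_le _ _ _ H)).trans
          (congrArg (· ≫ _) (Category.id_comp _)).symm
      · exact (congrArg (· ≫ _) (Category.id_comp _)).trans
          (F.d_comp_s_self _ _)
      · exact (congrArg (· ≫ _) (Category.id_comp _)).trans
          (F.d_comp_s_succ _ _)
      · exact ((congrArg (· ≫ _) (Category.id_comp _)).trans
          (F.d_comp_s_of_gt _ _ _ H)).trans
          (congrArg (· ≫ _) (Category.id_comp _)).symm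
      · exact ((congrArg (· ≫ _) (Category.id_comp _)).trans
          (F.s_comp_s _ _ _ H)).trans
          (congrArg (· ≫ _) (Category.id_comp _)).symm)

theorem genFunctor_map_δ (n : ℕ) (i : Fin (n + 2)) :
    F.genFunctor.map (SimplexCategoryGenRel.δ i) = F.d n i := Category.id_comp _

theorem genFunctor_map_σ (n : ℕ) (i : Fin (n + 1)) :
    F.genFunctor.map (SimplexCategoryGenRel.σ i) = F.s n i := Category.id_comp _

/-- The functor on the simplex category which is defined by a cosimplicial object. -/
def toFunctor : SimplexCategory ⥤ D where
  obj x := F.obj x.len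
  map f := F.genFunctor.map (exists_toS f).choose
  map_id x := by
    have : (exists_toS (𝟙 x)).choose = 𝟙 _ := by
      apply toS_injective
      rw [(exists_toS (𝟙 x)).choose_spec, toS_id]
    rw [this]
    exact F.genFunctor.map_id _
  map_comp f g := by
    -- The chosen words compose only up to the relations; faithfulness of `toS` makes the choice
    -- irrelevant.
    have : (exists_toS (f ≫ g)).choose =
        (exists_toS f).choose ≫ (exists_toS g).choose := by
      apply toS_injective
      rw [(exists_toS (f ≫ g)).choose_spec, toS_comp]
      exact (congrArg₂ (· ≫ ·) (exists_toS f).choose_spec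
        (exists_toS g).choose_spec).symm
    rw [this]
    exact F.genFunctor.map_comp _ _

theorem toFunctor_map_δ (n : ℕ) (i : Fin (n + 2)) :
    F.toFunctor.map (SimplexCategory.δ i) = F.d n i := by
  have : (exists_toS (SimplexCategory.δ i)).choose = SimplexCategoryGenRel.δ i := by
    apply toS_injective
    rw [(exists_toS (SimplexCategory.δ i)).choose_spec]
    rfl
  exact (congrArg F.genFunctor.map this).trans (F.genFunctor_map_δ n i)

theorem toFunctor_map_σ (n : ℕ) (i : Fin (n + 1)) :
    F.toFunctor.map (SimplexCategory.σ i) = F.s n i := by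
  have : (exists_toS (SimplexCategory.σ i)).choose = SimplexCategoryGenRel.σ i := by
    apply toS_injective
    rw [(exists_toS (SimplexCategory.σ i)).choose_spec]
    rfl
  exact (congrArg F.genFunctor.map this).trans (F.genFunctor_map_σ n i)

end Cosimplicial

end
end DGComod

namespace DGComod
noncomputable section

/-! ### Simplicial chains of the standard simplices acting on cosimplicial complexes -/

section SimplexChains

variable (k : Type u) [CommRing k]

variable {k} in
theorem alternating_sum_hom_apply {M N : ModuleCat.{u} k} {n : ℕ} (f : Fin n → (M ⟶ N)) (x : M) :
    (∑ i : Fin n, (-1 : ℤ) ^ (i : ℕ) • f i).hom x =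
      ∑ i : Fin n, (-1 : k) ^ (i : ℕ) • (f i).hom x := by
  rw [ModuleCat.hom_sum, LinearMap.sum_apply]
  refine Finset.sum_congr rfl fun i _ => ?_
  rcases Nat.even_or_odd (i : ℕ) with hi | hi
  · rw [hi.neg_one_pow, hi.neg_one_pow, one_smul, one_smul]
  · rw [hi.neg_one_pow, hi.neg_one_pow, neg_one_smul, neg_one_smul]; rfl

-- In the Dold–Kan decomposition the identity is `PInfty + QInfty`, and `QInfty` is a sum of maps
-- that factor through degeneracies.
variable {k} in
theorem exists_eq_PInfty_add_degenerate (S : SimplicialObject (ModuleCat.{u} k)) (m : ℕ)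
    (x : S.obj (Opposite.op (SimplexCategory.mk (m + 1)))) :
    ∃ u : Fin (m + 1) → S.obj (Opposite.op (SimplexCategory.mk m)),
      x = ModuleCat.Hom.hom (A := S.obj (Opposite.op (SimplexCategory.mk (m + 1))))
          (B := S.obj (Opposite.op (SimplexCategory.mk (m + 1))))
          ((AlgebraicTopology.DoldKan.PInfty (X := S)).f (m + 1)) x +
        ∑ j, (S.σ j).hom (u j) := by
  have h := AlgebraicTopology.DoldKan.PInfty_f_add_QInfty_f (X := S) (m + 1)
  rw [AlgebraicTopology.DoldKan.QInfty_f, AlgebraicTopology.DoldKan.decomposition_Q,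
    Finset.filter_true_of_mem (fun i _ => i.2)] at h
  refine ⟨fun j => (S.δ j.succ).hom
    (((AlgebraicTopology.DoldKan.P (X := S) (j.rev : ℕ)).f (m + 1)).hom x), ?_⟩
  have h' := congrArg (fun f => f.hom x) h
  refine h'.symm.trans ?_
  rw [ModuleCat.hom_add, LinearMap.add_apply]
  refine congrArg₂ (· + ·) rfl ?_
  rw [ModuleCat.hom_sum, LinearMap.sum_apply, ← Equiv.sum_comp Fin.revPerm]
  refine Finset.sum_congr rfl fun i _ => ?_
  rw [Fin.revPerm_apply, Fin.rev_rev]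
  rfl

/-- The unnormalized chains of the standard simplices. -/
def simplexChains : SimplexCategory ⥤ Ch k :=
  SSet.stdSimplex.{0} ⋙ freeSimplicial k ⋙
    AlgebraicTopology.alternatingFaceMapComplex (ModuleCat.{u} k)

variable {k}

/-- The simplex of `Δ[n]` given by a morphism `[m] ⟶ [n]`. -/
def simplexElt {m : ℕ} {n : SimplexCategory} (a : SimplexCategory.mk m ⟶ n) :
    ((simplexChains k).obj n).X m :=
  (ModuleCat.freeMk (R := k) (ULift.up.{u} (SSet.stdSimplex.objEquiv.{0}.symm a)) : _)

theorem simplexChains_ext {m : ℕ} {n : SimplexCategory} {M : Type*} [AddCommGroup M] [Module k M]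
    {f g : ((simplexChains k).obj n).X m →ₗ[k] M}
    (h : ∀ a : SimplexCategory.mk m ⟶ n, f (simplexElt a) = g (simplexElt a)) : f = g :=
  Finsupp.lhom_ext' fun x => LinearMap.ext_ring (h (SSet.stdSimplex.objEquiv.{0} x.down))

theorem simplexChains_map_elt {m : ℕ} {n n' : SimplexCategory} (a : SimplexCategory.mk m ⟶ n)
    (b : n ⟶ n') :
    (((simplexChains k).map b).f m).hom (simplexElt a) = simplexElt (a ≫ b) :=
  ModuleCat.free_map_apply _ _

/-- The action of `[m'] ⟶ [m]` on simplicial chains. -/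
def simplexPull {m m' : ℕ} (c : SimplexCategory.mk m' ⟶ SimplexCategory.mk m)
    (n : SimplexCategory) : ((simplexChains k).obj n).X m →ₗ[k] ((simplexChains k).obj n).X m' :=
  (((freeSimplicial k).obj (SSet.stdSimplex.{0}.obj n)).map c.op).hom

theorem simplexPull_elt {m m' : ℕ} (c : SimplexCategory.mk m' ⟶ SimplexCategory.mk m)
    {n : SimplexCategory} (a : SimplexCategory.mk m ⟶ n) :
    simplexPull (k := k) c n (simplexElt a) = simplexElt (c ≫ a) :=
  ModuleCat.free_map_apply _ _

theorem simplexChains_d (m : ℕ) (n : SimplexCategory) (w : ((simplexChains k).obj n).X (m + 1)) :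
    (((simplexChains k).obj n).d (m + 1) m).hom w =
      ∑ i : Fin (m + 2), (-1 : k) ^ (i : ℕ) • simplexPull (SimplexCategory.δ i) n w := by
  have h : ((simplexChains k).obj n).d (m + 1) m = ∑ i : Fin (m + 2), (-1 : ℤ) ^ (i : ℕ) •
      ((freeSimplicial k).obj (SSet.stdSimplex.{0}.obj n)).δ i :=
    AlgebraicTopology.AlternatingFaceMapComplex.obj_d_eq _ _
  exact (congrArg (fun f => f.hom w) h).trans (alternating_sum_hom_apply _ w)

variable (k) in
/-- The projection onto the normalized chains. -/
def simplexProj (n : SimplexCategory) : (simplexChains k).obj n ⟶ (simplexChains k).obj n :=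
  AlgebraicTopology.DoldKan.PInfty (X := (freeSimplicial k).obj (SSet.stdSimplex.{0}.obj n))

theorem simplexProj_naturality {n n' : SimplexCategory} (b : n ⟶ n') :
    (simplexChains k).map b ≫ simplexProj k n' = simplexProj k n ≫ (simplexChains k).map b :=
  (AlgebraicTopology.DoldKan.natTransPInfty (ModuleCat.{u} k)).naturality
    ((freeSimplicial k).map (SSet.stdSimplex.{0}.map b))

theorem simplexProj_pull_σ {m : ℕ} (j : Fin (m + 1)) (n : SimplexCategory)
    (w : ((simplexChains k).obj n).X m) :
    ((simplexProj k n).f (m + 1)).hom (simplexPull (SimplexCategory.σ j) n w) = 0 := by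
  have := AlgebraicTopology.DoldKan.σ_comp_PInfty
    ((freeSimplicial k).obj (SSet.stdSimplex.{0}.obj n)) j
  exact congrArg (fun f => f.hom w) this

theorem simplexProj_sub_mem (m : ℕ) (n : SimplexCategory)
    (w : ((simplexChains k).obj n).X (m + 1)) :
    ∃ u : Fin (m + 1) → ((simplexChains k).obj n).X m,
      w = ((simplexProj k n).f (m + 1)).hom w +
        ∑ j, simplexPull (SimplexCategory.σ j) n (u j) :=
  exists_eq_PInfty_add_degenerate ((freeSimplicial k).obj (SSet.stdSimplex.{0}.obj n)) m w

/-- The image of the identity in the normalized chains of the standard simplex. -/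
def fundChain (m : ℕ) : ((simplexChains k).obj (SimplexCategory.mk m)).X m :=
  ((simplexProj k (SimplexCategory.mk m)).f m).hom (simplexElt (𝟙 _))

/-- By naturality of the projector, `fundChain m` is the universal normalized `m`-chain: all others
are combinations of its images. -/
theorem map_fundChain {m : ℕ} {n : SimplexCategory} (a : SimplexCategory.mk m ⟶ n) :
    (((simplexChains k).map a).f m).hom (fundChain m) =
      ((simplexProj k n).f m).hom (simplexElt a) := by
  have h := congrArg (fun f => (f.f m).hom (simplexElt (𝟙 (SimplexCategory.mk m))))
    (simplexProj_naturality (k := k) a)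
  refine Eq.trans h.symm ?_
  change ((simplexProj k n).f m).hom ((((simplexChains k).map a).f m).hom _) = _
  rw [simplexChains_map_elt, Category.id_comp]

theorem map_σ_fundChain {m : ℕ} (j : Fin (m + 1)) :
    (((simplexChains k).map (SimplexCategory.σ j)).f (m + 1)).hom (fundChain (m + 1)) = 0 := by
  rw [map_fundChain, ← Category.comp_id (SimplexCategory.σ j), ← simplexPull_elt,
    simplexProj_pull_σ]

/-- The projector is a chain map, so the boundary formula for the identity simplex descends to the
fundamental chain. This identity turns the boundary of simplices into the coboundary of a
cosimplicial complex. -/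
theorem d_fundChain (m : ℕ) :
    (((simplexChains k).obj (SimplexCategory.mk (m + 1))).d (m + 1) m).hom (fundChain (m + 1)) =
      ∑ i : Fin (m + 2), (-1 : k) ^ (i : ℕ) •
        (((simplexChains k).map (SimplexCategory.δ i)).f m).hom (fundChain m) := by
  rw [fundChain, ← hom_d, simplexChains_d, map_sum]
  refine Finset.sum_congr rfl fun i _ => ?_
  rw [map_smul, simplexPull_elt, Category.comp_id, map_fundChain]

variable (Φ : SimplexCategory ⥤ Ch k)

/-- The action of the simplicial chains of the standard simplices on a cosimplicial complex:
`w ⊗ y` is mapped to the sum of the `w_a • Φ(a) y`. -/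
def act (m p : ℕ) (n : SimplexCategory) :
    ((simplexChains k).obj n).X m →ₗ[k] (Φ.obj (SimplexCategory.mk m)).X p →ₗ[k]
      (Φ.obj n).X p :=
  Finsupp.linearCombination k fun x : ULift.{u} _ =>
    ((Φ.map (SSet.stdSimplex.objEquiv.{0} x.down)).f p).hom

theorem act_elt (m p : ℕ) {n : SimplexCategory} (a : SimplexCategory.mk m ⟶ n) :
    act Φ m p n (simplexElt a) = ((Φ.map a).f p).hom :=
  (Finsupp.linearCombination_single ..).trans (one_smul k _)

theorem act_map (m p : ℕ) {n n' : SimplexCategory} (b : n ⟶ n')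
    (w : ((simplexChains k).obj n).X m) (y : (Φ.obj (SimplexCategory.mk m)).X p) :
    act Φ m p n' ((((simplexChains k).map b).f m).hom w) y =
      ((Φ.map b).f p).hom (act Φ m p n w y) := by
  have : (act Φ m p n').comp (((simplexChains k).map b).f m).hom =
      (LinearMap.llcomp k _ _ _ ((Φ.map b).f p).hom).comp (act Φ m p n) := by
    apply simplexChains_ext
    intro a
    change act Φ m p n' _ = _
    rw [simplexChains_map_elt, act_elt, Φ.map_comp]
    change _ = ((Φ.map b).f p).hom.comp (act Φ m p n (simplexElt a))
    rw [act_elt]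
    rfl
  exact LinearMap.congr_fun (LinearMap.congr_fun this w) y

theorem act_pull {m m' : ℕ} (p : ℕ) (c : SimplexCategory.mk m' ⟶ SimplexCategory.mk m)
    (n : SimplexCategory) (w : ((simplexChains k).obj n).X m)
    (y : (Φ.obj (SimplexCategory.mk m')).X p) :
    act Φ m' p n (simplexPull c n w) y = act Φ m p n w (((Φ.map c).f p).hom y) := by
  have : (act Φ m' p n).comp (simplexPull c n) =
      (LinearMap.lcomp k _ ((Φ.map c).f p).hom).comp (act Φ m p n) := by
    apply simplexChains_ext
    intro a
    change act Φ m' p n _ = (act Φ m p n (simplexElt a)).comp ((Φ.map c).f p).hom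
    rw [simplexPull_elt, act_elt, act_elt, Φ.map_comp]
    rfl
  exact LinearMap.congr_fun (LinearMap.congr_fun this w) y

theorem act_hom_d (m p q : ℕ) (n : SimplexCategory) (w : ((simplexChains k).obj n).X m)
    (y : (Φ.obj (SimplexCategory.mk m)).X p) :
    ((Φ.obj n).d p q).hom (act Φ m p n w y) =
      act Φ m q n w (((Φ.obj (SimplexCategory.mk m)).d p q).hom y) := by
  have : (LinearMap.llcomp k _ _ _ ((Φ.obj n).d p q).hom).comp (act Φ m p n) =
      (LinearMap.lcomp k _ ((Φ.obj (SimplexCategory.mk m)).d p q).hom).comp (act Φ m q n) := by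
    apply simplexChains_ext
    intro a
    change ((Φ.obj n).d p q).hom.comp (act Φ m p n (simplexElt a)) =
      (act Φ m q n (simplexElt a)).comp ((Φ.obj (SimplexCategory.mk m)).d p q).hom
    rw [act_elt, act_elt]
    ext y
    exact (hom_d (Φ.map a) p q y).symm
  exact LinearMap.congr_fun (LinearMap.congr_fun this w) y

/-- The alternating sum of the cofaces. -/
def coboundary (m p : ℕ) :
    (Φ.obj (SimplexCategory.mk m)).X p →ₗ[k] (Φ.obj (SimplexCategory.mk (m + 1))).X p :=
  ∑ i : Fin (m + 2), (-1 : k) ^ (i : ℕ) • ((Φ.map (SimplexCategory.δ i)).f p).hom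

theorem coboundary_apply (m p : ℕ) (y : (Φ.obj (SimplexCategory.mk m)).X p) :
    coboundary Φ m p y =
      ∑ i : Fin (m + 2), (-1 : k) ^ (i : ℕ) • ((Φ.map (SimplexCategory.δ i)).f p).hom y := by
  simp [coboundary, LinearMap.sum_apply]

theorem act_d (m p : ℕ) (n : SimplexCategory) (w : ((simplexChains k).obj n).X (m + 1))
    (y : (Φ.obj (SimplexCategory.mk m)).X p) :
    act Φ m p n ((((simplexChains k).obj n).d (m + 1) m).hom w) y =
      act Φ (m + 1) p n w (coboundary Φ m p y) := by
  rw [simplexChains_d, coboundary_apply, map_sum, map_sum, LinearMap.sum_apply]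
  refine Finset.sum_congr rfl fun i _ => ?_
  rw [map_smul, map_smul, LinearMap.smul_apply, act_pull]

theorem coboundary_hom_d (m p q : ℕ) (y : (Φ.obj (SimplexCategory.mk m)).X p) :
    ((Φ.obj _).d p q).hom (coboundary Φ m p y) =
      coboundary Φ m q (((Φ.obj _).d p q).hom y) := by
  rw [coboundary_apply, coboundary_apply, map_sum]
  refine Finset.sum_congr rfl fun i _ => ?_
  rw [map_smul, hom_d]

theorem act_id (m p : ℕ) (y : (Φ.obj (SimplexCategory.mk m)).X p) :
    act Φ m p _ (simplexElt (𝟙 _)) y = y := by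
  rw [act_elt, Φ.map_id]; rfl

/-- Acting by the identity simplex does nothing, and by `act_d` both coboundaries can be moved onto
it as boundaries, whose square is zero. -/
theorem coboundary_coboundary (m p : ℕ) (y : (Φ.obj (SimplexCategory.mk m)).X p) :
    coboundary Φ (m + 1) p (coboundary Φ m p y) = 0 := by
  rw [← act_id Φ (m + 2) p (coboundary Φ (m + 1) p (coboundary Φ m p y)), ← act_d, ← act_d, d_d,
    map_zero, LinearMap.zero_apply]

/-- The elements of a cosimplicial complex on which all codegeneracies vanish. -/
def normalized (m p : ℕ) : Submodule k ((Φ.obj (SimplexCategory.mk m)).X p) :=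
  match m with
  | 0 => ⊤
  | m + 1 => ⨅ j : Fin (m + 1), LinearMap.ker ((Φ.map (SimplexCategory.σ j)).f p).hom

theorem mem_normalized_succ {m p : ℕ} {y : (Φ.obj (SimplexCategory.mk (m + 1))).X p} :
    y ∈ normalized Φ (m + 1) p ↔
      ∀ j : Fin (m + 1), ((Φ.map (SimplexCategory.σ j)).f p).hom y = 0 := by
  simp [normalized]

/-- Codegeneracies send the fundamental chain to a degenerate simplex, which the projector kills.
With `act_fundChain`, the action of `fundChain m` is thus a projector onto the normalized elements.
-/
theorem act_fundChain_mem (m p : ℕ) (y : (Φ.obj (SimplexCategory.mk m)).X p) :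
    act Φ m p _ (fundChain m) y ∈ normalized Φ m p := by
  cases m with
  | zero => exact Submodule.mem_top
  | succ m =>
    rw [mem_normalized_succ]
    intro j
    rw [← act_map, map_σ_fundChain, map_zero, LinearMap.zero_apply]

/-- A chain and its projection differ by degenerate chains; these act through codegeneracies, which
vanish on normalized elements. -/
theorem act_proj (m p : ℕ) {y : (Φ.obj (SimplexCategory.mk m)).X p} (hy : y ∈ normalized Φ m p)
    (n : SimplexCategory) (w : ((simplexChains k).obj n).X m) :
    act Φ m p n (((simplexProj k n).f m).hom w) y = act Φ m p n w y := by
  cases m with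
  | zero => rfl
  | succ m =>
    rw [mem_normalized_succ] at hy
    obtain ⟨u, hu⟩ := simplexProj_sub_mem m n w
    conv_rhs => rw [hu]
    rw [map_add, map_sum, LinearMap.add_apply, LinearMap.sum_apply, left_eq_add]
    refine Finset.sum_eq_zero fun j _ => ?_
    rw [act_pull, hy, map_zero]

theorem act_fundChain (m p : ℕ) {y : (Φ.obj (SimplexCategory.mk m)).X p}
    (hy : y ∈ normalized Φ m p) : act Φ m p _ (fundChain m) y = y := by
  rw [fundChain, act_proj Φ m p hy, act_id]

theorem coboundary_act_fundChain (m p : ℕ) (y : (Φ.obj (SimplexCategory.mk m)).X p) :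
    coboundary Φ m p (act Φ m p _ (fundChain m) y) =
      act Φ (m + 1) p _ (fundChain (m + 1)) (coboundary Φ m p y) := by
  rw [← act_d, d_fundChain, map_sum, LinearMap.sum_apply, coboundary_apply]
  refine Finset.sum_congr rfl fun i _ => ?_
  rw [map_smul, LinearMap.smul_apply, act_map]

/-- The projectors given by the fundamental chains commute with the coboundary, by the two ways of
acting with the boundary of `fundChain (m + 1)`. -/
theorem coboundary_mem (m p : ℕ) {y : (Φ.obj (SimplexCategory.mk m)).X p}
    (hy : y ∈ normalized Φ m p) : coboundary Φ m p y ∈ normalized Φ (m + 1) p := by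
  rw [← act_fundChain Φ m p hy, coboundary_act_fundChain]
  exact act_fundChain_mem _ _ _ _

theorem d_mem_normalized (m p q : ℕ) {y : (Φ.obj (SimplexCategory.mk m)).X p}
    (hy : y ∈ normalized Φ m p) : ((Φ.obj _).d p q).hom y ∈ normalized Φ m q := by
  rw [← act_fundChain Φ m p hy, act_hom_d]
  exact act_fundChain_mem _ _ _ _

end SimplexChains

end
end DGComod

namespace DGComod
noncomputable section

/-! ### The conormalized total complex of a cosimplicial complex -/

section Tot

variable {k : Type u} [CommRing k] (Φ : SimplexCategory ⥤ Ch k)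

/-- The ambient module of the total complex. -/
abbrev TotFun : Type u := ∀ m p : ℕ, (Φ.obj (SimplexCategory.mk m)).X p

/-- The component in cosimplicial degree `m` of the coboundary. -/
def coboundaryInto (m p : ℕ) : TotFun Φ →ₗ[k] (Φ.obj (SimplexCategory.mk m)).X p :=
  match m with
  | 0 => 0
  | m + 1 => coboundary Φ m p ∘ₗ LinearMap.proj p ∘ₗ
      (LinearMap.proj m : TotFun Φ →ₗ[k] ∀ p, (Φ.obj (SimplexCategory.mk m)).X p)

theorem coboundaryInto_zero (p : ℕ) (y : TotFun Φ) : coboundaryInto Φ 0 p y = 0 := rfl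

theorem coboundaryInto_succ (m p : ℕ) (y : TotFun Φ) :
    coboundaryInto Φ (m + 1) p y = coboundary Φ m p (y m p) := rfl

/-- The differential of the total complex. -/
def totD : TotFun Φ →ₗ[k] TotFun Φ :=
  LinearMap.pi fun m => LinearMap.pi fun p => (-1 : k) ^ m •
    (((Φ.obj (SimplexCategory.mk m)).d (p + 1) p).hom ∘ₗ LinearMap.proj (p + 1) ∘ₗ
      (LinearMap.proj m : TotFun Φ →ₗ[k] ∀ p, (Φ.obj (SimplexCategory.mk m)).X p) -
      coboundaryInto Φ m p)

theorem totD_apply (y : TotFun Φ) (m p : ℕ) :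
    totD Φ y m p = (-1 : k) ^ m •
      (((Φ.obj (SimplexCategory.mk m)).d (p + 1) p).hom (y m (p + 1)) -
        coboundaryInto Φ m p y) := rfl

theorem totD_totD (y : TotFun Φ) : totD Φ (totD Φ y) = 0 := by
  funext m p
  rw [totD_apply, totD_apply, map_smul, map_sub, d_d, zero_sub]
  rcases m with _ | m
  · rw [coboundaryInto_zero, coboundaryInto_zero, map_zero, neg_zero, smul_zero, sub_zero,
      smul_zero]; rfl
  · rw [coboundaryInto_succ, coboundaryInto_succ, totD_apply, map_smul, map_sub,
      coboundary_hom_d]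
    have : coboundary Φ m p (coboundaryInto Φ m p y) = 0 := by
      rcases m with _ | m
      · rw [coboundaryInto_zero, map_zero]
      · rw [coboundaryInto_succ, coboundary_coboundary]
    rw [this, sub_zero, pow_succ]
    change _ = (0 : (Φ.obj (SimplexCategory.mk (m + 1))).X p)
    generalize coboundary Φ m p _ = c
    simp

/-- The elements of total degree `q` which are normalized. -/
def totSub (q : ℕ) : Submodule k (TotFun Φ) where
  carrier := {y | (∀ m p, m + q ≠ p → y m p = 0) ∧ ∀ m p, y m p ∈ normalized Φ m p}
  add_mem' := fun {x y} hx hy => ⟨fun m p h => by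
    rw [Pi.add_apply, Pi.add_apply, hx.1 m p h, hy.1 m p h, add_zero],
    fun m p => Submodule.add_mem _ (hx.2 m p) (hy.2 m p)⟩
  zero_mem' := ⟨fun _ _ _ => rfl, fun _ _ => Submodule.zero_mem _⟩
  smul_mem' := fun c {x} hx => ⟨fun m p h => by
    rw [Pi.smul_apply, Pi.smul_apply, hx.1 m p h, smul_zero],
    fun m p => Submodule.smul_mem _ _ (hx.2 m p)⟩

theorem totD_normalized {y : TotFun Φ} (hy : ∀ m p, y m p ∈ normalized Φ m p) (m p : ℕ) :
    totD Φ y m p ∈ normalized Φ m p := by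
  rw [totD_apply]
  refine Submodule.smul_mem _ _ (Submodule.sub_mem _ (d_mem_normalized Φ m _ _ (hy _ _)) ?_)
  rcases m with _ | m
  · exact Submodule.mem_top
  · exact coboundary_mem Φ m p (hy _ _)

theorem totD_of_ne {y : TotFun Φ} {q : ℕ} (hy : ∀ m p, m + q ≠ p → y m p = 0) (m p : ℕ)
    (h : m + q ≠ p + 1) : totD Φ y m p = 0 := by
  rw [totD_apply, hy m (p + 1) h, map_zero, zero_sub, smul_eq_zero_of_right]
  rcases m with _ | m
  · rw [coboundaryInto_zero, neg_zero]
  · rw [coboundaryInto_succ, hy m p (by omega), map_zero, neg_zero]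

theorem totD_mem (q : ℕ) : ∀ y ∈ totSub Φ (q + 1), totD Φ y ∈ totSub Φ q := fun _ hy =>
  ⟨fun m p h => totD_of_ne Φ hy.1 m p (by omega), totD_normalized Φ hy.2⟩

/-- The conormalized total complex of a cosimplicial complex, truncated to non-negative
degrees. -/
def tot : Ch k := truncComplex (totD Φ) (totSub Φ) (totD_totD Φ) (totD_mem Φ)

/-- The components of an element of the total complex. -/
def totVal (q : ℕ) : (tot Φ).X q →ₗ[k] TotFun Φ := truncVal _ _ _ _ q

variable {Φ} in
theorem totVal_injective {q : ℕ} {x y : (tot Φ).X q} (h : totVal Φ q x = totVal Φ q y) : x = y :=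
  truncVal_injective h

theorem totVal_of_ne {q : ℕ} (y : (tot Φ).X q) {m p : ℕ} (h : m + q ≠ p) :
    totVal Φ q y m p = 0 :=
  (truncVal_mem (totD Φ) (totSub Φ) (totD_totD Φ) (totD_mem Φ) q y).1 m p h

theorem totVal_mem {q : ℕ} (y : (tot Φ).X q) (m p : ℕ) : totVal Φ q y m p ∈ normalized Φ m p :=
  (truncVal_mem (totD Φ) (totSub Φ) (totD_totD Φ) (totD_mem Φ) q y).2 m p

theorem totVal_d (q : ℕ) (y : (tot Φ).X q) :
    totVal Φ (q - 1) (((tot Φ).d q (q - 1)).hom y) = totD Φ (totVal Φ q y) :=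
  truncVal_d _ _ _ _ q y

/-- Constructor for elements of the total complex. -/
def totMk (q : ℕ) (y : TotFun Φ) (hy : y ∈ totSub Φ q) (h0 : q = 0 → totD Φ y = 0) :
    (tot Φ).X q := truncMk _ _ _ _ q y hy h0

/-- The bilinear maps `w ⊗ y ↦ w • y`. -/
def totAct (n : SimplexCategory) (m q p : ℕ) :
    ((simplexChains k).obj n).X m →ₗ[k] (tot Φ).X q →ₗ[k] (Φ.obj n).X p :=
  (act Φ m p n).compl₂ ((LinearMap.proj p ∘ₗ
    (LinearMap.proj m : TotFun Φ →ₗ[k] ∀ p, (Φ.obj (SimplexCategory.mk m)).X p)) ∘ₗ totVal Φ q)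

theorem totAct_apply (n : SimplexCategory) (m q p : ℕ) (w : ((simplexChains k).obj n).X m)
    (y : (tot Φ).X q) : totAct Φ n m q p w y = act Φ m p n w (totVal Φ q y m p) := rfl

/-- The evaluation maps of the total complex. -/
def totEval (n : SimplexCategory) : (simplexChains k).obj n ⊗ tot Φ ⟶ Φ.obj n :=
  tensorDesc (fun m q p => totAct Φ n m q p) (by
    intro m q p _ w y
    simp only [totAct_apply]
    rw [totVal_d, totD_apply, act_hom_d, map_smul, map_sub, smul_smul, ← pow_add,
      Even.neg_one_pow ⟨m, rfl⟩, one_smul]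
    rcases m with _ | m
    · rw [d_zero_zero, map_zero, LinearMap.zero_apply, coboundaryInto_zero, map_zero, sub_zero,
        zero_add]
    · rw [coboundaryInto_succ, ← act_d]
      exact (add_sub_cancel _ _).symm)

theorem totEval_tm (n : SimplexCategory) {m q p : ℕ} (h : m + q = p)
    (w : ((simplexChains k).obj n).X m) (y : (tot Φ).X q) :
    ((totEval Φ n).f p).hom (tm _ (tot Φ) m q p w y) = act Φ m p n w (totVal Φ q y m p) :=
  tensorDesc_tm _ _ h w y

theorem totEval_naturality {n n' : SimplexCategory} (b : n ⟶ n') :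
    (simplexChains k).map b ▷ tot Φ ≫ totEval Φ n' = totEval Φ n ≫ Φ.map b := by
  apply ch_tensor_ext
  intro p m q h w y
  rw [comp_hom_apply, comp_hom_apply, whiskerRight_tm, totEval_tm Φ n' h, totEval_tm Φ n h,
    act_map]

variable {Φ} {B : Ch k} (σ : ∀ n, (simplexChains k).obj n ⊗ B ⟶ Φ.obj n)
  (hσ : ∀ {n n'} (b : n ⟶ n'), (simplexChains k).map b ▷ B ≫ σ n' = σ n ≫ Φ.map b)

include hσ in
theorem cone_map {n n' : SimplexCategory} (b : n ⟶ n') (m q p : ℕ)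
    (w : ((simplexChains k).obj n).X m) (x : B.X q) :
    ((Φ.map b).f p).hom (((σ n).f p).hom (tm _ B m q p w x)) =
      ((σ n').f p).hom (tm _ B m q p ((((simplexChains k).map b).f m).hom w) x) := by
  rw [← whiskerRight_tm, ← comp_hom_apply, ← comp_hom_apply, hσ]

/-- The family of components of the morphism into the total complex defined by a cone. -/
def totLiftFun (q : ℕ) : B.X q →ₗ[k] TotFun Φ :=
  LinearMap.pi fun m => LinearMap.pi fun p =>
    ((σ (SimplexCategory.mk m)).f p).hom ∘ₗ tm _ B m q p (fundChain m)

theorem totLiftFun_apply (q m p : ℕ) (b : B.X q) :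
    totLiftFun σ q b m p =
      ((σ (SimplexCategory.mk m)).f p).hom (tm _ B m q p (fundChain m) b) := rfl

include hσ in
theorem totLiftFun_mem (q : ℕ) (b : B.X q) : totLiftFun σ q b ∈ totSub Φ q := by
  refine ⟨fun m p h => ?_, fun m p => ?_⟩
  · rw [totLiftFun_apply, tm_of_ne h, LinearMap.zero_apply, LinearMap.zero_apply, map_zero]
  · rcases m with _ | m
    · exact Submodule.mem_top
    · rw [mem_normalized_succ]
      intro j
      rw [totLiftFun_apply, cone_map σ hσ, map_σ_fundChain, map_zero, LinearMap.zero_apply,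
        map_zero]

include hσ in
-- The Leibniz rule for `fundChain m ⊗ b`: by `d_fundChain` the boundary of the fundamental chain
-- produces exactly the coboundary term of the total differential.
theorem totD_totLiftFun (q : ℕ) (b : B.X q) :
    totD Φ (totLiftFun σ q b) = totLiftFun σ (q - 1) ((B.d q (q - 1)).hom b) := by
  funext m p
  rw [totD_apply, totLiftFun_apply, totLiftFun_apply, ← hom_d, d_tm_all, map_add, map_smul]
  suffices h : ((σ (SimplexCategory.mk m)).f p).hom (tm _ B (m - 1) q p
      ((((simplexChains k).obj (SimplexCategory.mk m)).d m (m - 1)).hom (fundChain m)) b) =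
        coboundaryInto Φ m p (totLiftFun σ q b) by
    rw [h, add_sub_cancel_left, smul_smul, ← pow_add, Even.neg_one_pow ⟨m, rfl⟩, one_smul]
  rcases m with _ | m
  · rw [d_zero_zero, map_zero, LinearMap.zero_apply, map_zero, coboundaryInto_zero]
  · rw [coboundaryInto_succ, coboundary_apply]
    change ((σ (SimplexCategory.mk (m + 1))).f p).hom (tm _ B m q p
      ((((simplexChains k).obj (SimplexCategory.mk (m + 1))).d (m + 1) m).hom _) b) = _
    rw [d_fundChain, map_sum, LinearMap.sum_apply, map_sum]
    refine Finset.sum_congr rfl fun i _ => ?_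
    rw [map_smul, LinearMap.smul_apply, map_smul, totLiftFun_apply, cone_map σ hσ]

/-- The morphism into the total complex which is defined by a cone. -/
def totLift : B ⟶ tot Φ :=
  truncLift _ _ _ _ (totLiftFun σ) (totLiftFun_mem σ hσ) (totD_totLiftFun σ hσ)

theorem totVal_totLift (q m p : ℕ) (b : B.X q) :
    totVal Φ q (((totLift σ hσ).f q).hom b) m p =
      ((σ (SimplexCategory.mk m)).f p).hom (tm _ B m q p (fundChain m) b) := rfl

/-- The lift records only the values of a cone on fundamental chains, which determine it on
normalized chains. The cone is therefore recovered up to the projector `simplexProj`, and this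
projector stays present in every later comparison. -/
theorem totLift_totEval (n : SimplexCategory) :
    (simplexChains k).obj n ◁ totLift σ hσ ≫ totEval Φ n = simplexProj k n ▷ B ≫ σ n := by
  apply ch_tensor_ext
  intro p m q h w b
  rw [comp_hom_apply, comp_hom_apply, whiskerRight_tm, whiskerLeft_tm, totEval_tm Φ n h,
    totVal_totLift]
  have : (act Φ m p n).flip (((σ (SimplexCategory.mk m)).f p).hom
      (tm _ B m q p (fundChain m) b)) =
      ((σ n).f p).hom ∘ₗ (tm _ B m q p).flip b ∘ₗ ((simplexProj k n).f m).hom := by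
    apply simplexChains_ext
    intro a
    rw [LinearMap.flip_apply, act_elt, cone_map σ hσ, map_fundChain]
    rfl
  exact LinearMap.congr_fun this w

/-- Evaluation at the fundamental chain returns the component of a total element, since components
are normalized. -/
theorem tot_hom_ext {D : Ch k} {f g : D ⟶ tot Φ}
    (h : ∀ n, (simplexChains k).obj n ◁ f ≫ totEval Φ n =
      (simplexChains k).obj n ◁ g ≫ totEval Φ n) : f = g := by
  apply ch_ext
  intro q x
  apply totVal_injective
  funext m p
  by_cases hp : m + q = p
  · have := congrArg (fun t => (t.f p).hom (tm _ _ m q p (fundChain m) x))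
      (h (SimplexCategory.mk m))
    simp only [comp_hom_apply] at this
    rw [whiskerLeft_tm, whiskerLeft_tm, totEval_tm Φ _ hp, totEval_tm Φ _ hp,
      act_fundChain Φ m p (totVal_mem Φ _ _ _), act_fundChain Φ m p (totVal_mem Φ _ _ _)] at this
    exact this
  · rw [totVal_of_ne Φ _ hp, totVal_of_ne Φ _ hp]

end Tot

end
end DGComod

namespace DGComod
noncomputable section

/-! ### Total complexes and tensor products -/

section TotTensor

variable {k : Type u} [CommRing k] (Φ : SimplexCategory ⥤ Ch k)

theorem simplexProj_totEval (n : SimplexCategory) :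
    simplexProj k n ▷ tot Φ ≫ totEval Φ n = totEval Φ n := by
  apply ch_tensor_ext
  intro p m q h w y
  rw [comp_hom_apply, whiskerRight_tm, totEval_tm Φ n h, totEval_tm Φ n h,
    act_proj Φ m p (totVal_mem Φ y m p)]

theorem totEval_whiskerRight_naturality (B : Ch k) {n n' : SimplexCategory} (b : n ⟶ n') :
    (simplexChains k).map b ▷ (tot Φ ⊗ B) ≫ (α_ _ _ _).inv ≫ totEval Φ n' ▷ B =
      ((α_ _ _ _).inv ≫ totEval Φ n ▷ B) ≫ (Φ ⋙ tensorRight B).map b := by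
  rw [associator_inv_naturality_left_assoc, ← comp_whiskerRight, totEval_naturality,
    comp_whiskerRight, Category.assoc]
  rfl

/-- The comparison map of the total complex of `Φ` tensored with `B` and of the total complex
of `Φ ⊗ B`. -/
def totTensor (B : Ch k) : tot Φ ⊗ B ⟶ tot (Φ ⋙ tensorRight B) :=
  totLift (Φ := Φ ⋙ tensorRight B) (fun n => (α_ _ _ _).inv ≫ totEval Φ n ▷ B)
    (totEval_whiskerRight_naturality Φ B)

theorem whiskerLeft_totTensor (B : Ch k) (n : SimplexCategory) :
    (simplexChains k).obj n ◁ totTensor Φ B ≫ totEval (Φ ⋙ tensorRight B) n =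
      (α_ _ _ _).inv ≫ totEval Φ n ▷ B := by
  rw [totTensor, totLift_totEval _ (totEval_whiskerRight_naturality Φ B),
    associator_inv_naturality_left_assoc, ← comp_whiskerRight,
    simplexProj_totEval]

theorem totVal_totTensor (B : Ch k) {i j q : ℕ} (h : i + j = q) (m : ℕ) (y : (tot Φ).X i)
    (b : B.X j) :
    totVal (Φ ⋙ tensorRight B) q (((totTensor Φ B).f q).hom (tm (tot Φ) B i j q y b)) m (m + q) =
      tm (Φ.obj (SimplexCategory.mk m)) B (m + i) j (m + q) (totVal Φ i y m (m + i)) b := by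
  refine (totVal_totLift _ (totEval_whiskerRight_naturality Φ B) q m (m + q) _).trans ?_
  rw [comp_hom_apply, associator_inv_tm rfl h, whiskerRight_tm, totEval_tm Φ _ rfl,
    act_fundChain Φ m _ (totVal_mem Φ y m _)]

/-- The action is by linear combinations of the maps `Φ(a)`, and these act on the first tensor
factor only. -/
theorem act_tensorRight (B : Ch k) (m i j p : ℕ) (n : SimplexCategory)
    (w : ((simplexChains k).obj n).X m) (a : (Φ.obj (SimplexCategory.mk m)).X i) (b : B.X j) :
    act (Φ ⋙ tensorRight B) m p n w (tm (Φ.obj (SimplexCategory.mk m)) B i j p a b) =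
      tm (Φ.obj n) B i j p (act Φ m i n w a) b := by
  have : (act (Φ ⋙ tensorRight B) m p n).flip (tm (Φ.obj (SimplexCategory.mk m)) B i j p a b) =
      (tm (Φ.obj n) B i j p).flip b ∘ₗ (act Φ m i n).flip a := by
    apply simplexChains_ext
    intro c
    rw [LinearMap.flip_apply, act_elt, LinearMap.comp_apply, LinearMap.flip_apply,
      LinearMap.flip_apply, act_elt]
    exact whiskerRight_tm (Φ.map c) B a b
  exact LinearMap.congr_fun this w

/-- A cosimplicial complex is steep if its normalization vanishes in cosimplicial degree `m` and
chain degree `p` for `p < 2 * m`. -/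
def IsSteep : Prop := ∀ m p, p < 2 * m → ∀ y ∈ normalized Φ m p, y = 0

variable {Φ}

theorem IsSteep.act_fundChain_eq_zero (hΦ : IsSteep Φ) {m p : ℕ} (h : p < 2 * m)
    (y : (Φ.obj (SimplexCategory.mk m)).X p) : act Φ m p _ (fundChain m) y = 0 :=
  hΦ m p h _ (act_fundChain_mem Φ m p y)

/-- On `a ⊗ b` the normalization projector acts on `a` alone, and the degree of `a` is at most the
total degree. -/
theorem IsSteep.tensorRight (hΦ : IsSteep Φ) (B : Ch k) : IsSteep (Φ ⋙ tensorRight B) := by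
  intro m p h y hy
  rw [← act_fundChain _ m p hy]
  have : act (Φ ⋙ MonoidalCategory.tensorRight B) m p _ (fundChain m) = 0 := by
    apply tm_ext
    intro i j hij a b
    rw [act_tensorRight, hΦ.act_fundChain_eq_zero (by omega), map_zero]
    rfl
  exact LinearMap.congr_fun this y

/-- The differential of an element of degree `0` has components in chain degree `m - 1 < 2 * m`.
Hence truncating the total complex to cycles in degree `0` loses nothing. -/
theorem IsSteep.totD_eq_zero (hΦ : IsSteep Φ) {y : TotFun Φ} (hy : y ∈ totSub Φ 0) :
    totD Φ y = 0 := by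
  funext m p
  by_cases hp : m + 0 = p + 1
  · exact hΦ m p (by omega) _ (totD_normalized Φ hy.2 m p)
  · exact totD_of_ne Φ hy.1 m p hp

theorem single_mem_totSub (m q : ℕ) {y : (Φ.obj (SimplexCategory.mk m)).X (m + q)}
    (hy : y ∈ normalized Φ m (m + q)) :
    (Pi.single m (Pi.single (m + q) y) : TotFun Φ) ∈ totSub Φ q := by
  constructor
  · intro m' p' h
    by_cases hm : m' = m
    · subst hm
      rw [Pi.single_eq_same, Pi.single_eq_of_ne (Ne.symm h)]
    · rw [Pi.single_eq_of_ne hm]; rfl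
  · intro m' p'
    by_cases hm : m' = m
    · subst hm
      rw [Pi.single_eq_same]
      by_cases hp : p' = m' + q
      · subst hp
        rwa [Pi.single_eq_same]
      · rw [Pi.single_eq_of_ne hp]; exact Submodule.zero_mem _
    · rw [Pi.single_eq_of_ne hm]; exact Submodule.zero_mem _

/-- The elements of the total complex which are concentrated in one cosimplicial degree. -/
def totSingle (hΦ : IsSteep Φ) (m q : ℕ) :
    (Φ.obj (SimplexCategory.mk m)).X (m + q) →ₗ[k] (tot Φ).X q where
  toFun y := totMk Φ q _ (single_mem_totSub m q (act_fundChain_mem Φ m (m + q) y))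
    (fun h => by subst h; exact hΦ.totD_eq_zero (single_mem_totSub m 0 (act_fundChain_mem Φ _ _ _)))
  map_add' x y := totVal_injective <| by
    change (Pi.single m (Pi.single (m + q) (act Φ m (m + q) _ (fundChain m) (x + y))) :
      TotFun Φ) = Pi.single m (Pi.single (m + q) (act Φ m (m + q) _ (fundChain m) x)) +
        Pi.single m (Pi.single (m + q) (act Φ m (m + q) _ (fundChain m) y))
    rw [map_add, Pi.single_add, Pi.single_add]
  map_smul' c x := totVal_injective <| by
    change (Pi.single m (Pi.single (m + q) (act Φ m (m + q) _ (fundChain m) (c • x))) :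
      TotFun Φ) = c • Pi.single m (Pi.single (m + q) (act Φ m (m + q) _ (fundChain m) x))
    rw [map_smul, Pi.single_smul, Pi.single_smul]

theorem totVal_totSingle (hΦ : IsSteep Φ) (m q : ℕ)
    (y : (Φ.obj (SimplexCategory.mk m)).X (m + q)) :
    totVal Φ q (totSingle hΦ m q y) =
      Pi.single m (Pi.single (m + q) (act Φ m (m + q) _ (fundChain m) y)) := rfl

theorem totVal_totSingle_same (hΦ : IsSteep Φ) (m q : ℕ)
    (y : (Φ.obj (SimplexCategory.mk m)).X (m + q)) :
    totVal Φ q (totSingle hΦ m q y) m (m + q) = act Φ m (m + q) _ (fundChain m) y := by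
  rw [totVal_totSingle, Pi.single_eq_same, Pi.single_eq_same]

theorem totVal_totSingle_of_ne (hΦ : IsSteep Φ) (m q : ℕ)
    (y : (Φ.obj (SimplexCategory.mk m)).X (m + q)) {m' : ℕ} (h : m' ≠ m) :
    totVal Φ q (totSingle hΦ m q y) m' = 0 := by
  rw [totVal_totSingle, Pi.single_eq_of_ne h]

/-- Components in cosimplicial degree `m` and chain degree `m + i` vanish by steepness once `m > i`.
The bound `q` may exceed `i`, so that one range serves all summands of a tensor product in degree
`q`. -/
theorem sum_totSingle (hΦ : IsSteep Φ) {i q : ℕ} (h : i ≤ q) (y : (tot Φ).X i) :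
    ∑ m ∈ Finset.range (q + 1), totSingle hΦ m i (totVal Φ i y m (m + i)) = y := by
  apply totVal_injective
  funext m p
  by_cases hp : m + i = p
  · subst hp
    rw [map_sum, Finset.sum_apply, Finset.sum_apply]
    by_cases hm : m ≤ q
    · rw [Finset.sum_eq_single m, totVal_totSingle_same, act_fundChain Φ _ _ (totVal_mem Φ y _ _)]
      · intro m' _ h'
        rw [totVal_totSingle_of_ne hΦ _ _ _ (Ne.symm h')]; rfl
      · intro h'; exact absurd (Finset.mem_range.2 (by omega)) h'
    · rw [hΦ m (m + i) (by omega) _ (totVal_mem Φ y m (m + i))]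
      refine Finset.sum_eq_zero fun m' h' => ?_
      rw [Finset.mem_range] at h'
      rw [totVal_totSingle_of_ne hΦ _ _ _ (by omega)]; rfl
  · rw [totVal_of_ne Φ _ hp, totVal_of_ne Φ _ hp]

/-- The maps `totSingle`, extended by zero to all degrees. -/
def totSingleX (hΦ : IsSteep Φ) (m p q : ℕ) :
    (Φ.obj (SimplexCategory.mk m)).X p →ₗ[k] (tot Φ).X q :=
  if h : m + q = p then h ▸ totSingle hΦ m q else 0

theorem totSingleX_self (hΦ : IsSteep Φ) (m q : ℕ) :
    totSingleX hΦ m (m + q) q = totSingle hΦ m q := dif_pos rfl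

/-- The map `totSingle` tensored with `B`. -/
def totSingleTensor (hΦ : IsSteep Φ) (B : Ch k) (m q : ℕ) :
    (Φ.obj (SimplexCategory.mk m) ⊗ B : Ch k).X (m + q) →ₗ[k] (tot Φ ⊗ B : Ch k).X q :=
  -- For `i < m` the truncated difference is `0`, and `totSingleX hΦ m i 0` is zero because `m + 0 ≠
  -- i`.
  tdesc fun i j => (tm (tot Φ) B (i - m) j q).comp (totSingleX hΦ m i (i - m))

theorem totSingleTensor_tm (hΦ : IsSteep Φ) (B : Ch k) {m i j q : ℕ} (h : i + j = q)
    (a : (Φ.obj (SimplexCategory.mk m)).X (m + i)) (b : B.X j) :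
    totSingleTensor hΦ B m q (tm (Φ.obj (SimplexCategory.mk m)) B (m + i) j (m + q) a b) =
      tm (tot Φ) B i j q (totSingle hΦ m i a) b := by
  rw [totSingleTensor, tdesc_tm _ (by omega), LinearMap.comp_apply, ← totSingleX_self,
    Nat.add_sub_cancel_left]

theorem totSingleTensor_tm_of_lt (hΦ : IsSteep Φ) (B : Ch k) {m i j q : ℕ} (h : i + j = m + q)
    (hi : i < m) (a : (Φ.obj (SimplexCategory.mk m)).X i) (b : B.X j) :
    totSingleTensor hΦ B m q (tm (Φ.obj (SimplexCategory.mk m)) B i j (m + q) a b) = 0 := by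
  rw [totSingleTensor, tdesc_tm _ h, LinearMap.comp_apply, totSingleX, dif_neg (by omega),
    LinearMap.zero_apply, map_zero, LinearMap.zero_apply]

/-- An element of `tot Φ ⊗ B` is rebuilt from the components of its image. This finite sum is the
inverse of the comparison map; an infinite product would not commute with the tensor product. -/
theorem sum_totSingleTensor (hΦ : IsSteep Φ) (B : Ch k) (q : ℕ) (x : (tot Φ ⊗ B : Ch k).X q) :
    ∑ m ∈ Finset.range (q + 1), totSingleTensor hΦ B m q
      (totVal (Φ ⋙ tensorRight B) q (((totTensor Φ B).f q).hom x) m (m + q)) = x := by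
  have : ∑ m ∈ Finset.range (q + 1), totSingleTensor hΦ B m q ∘ₗ LinearMap.proj (m + q) ∘ₗ
      (LinearMap.proj m : TotFun (Φ ⋙ tensorRight B) →ₗ[k] _) ∘ₗ
        totVal (Φ ⋙ tensorRight B) q ∘ₗ ((totTensor Φ B).f q).hom = LinearMap.id := by
    apply tm_ext
    intro i j h y b
    rw [LinearMap.sum_apply, LinearMap.id_apply]
    conv_rhs => rw [← sum_totSingle hΦ (show i ≤ q by omega) y]
    rw [map_sum, LinearMap.sum_apply]
    refine Finset.sum_congr rfl fun m _ => ?_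
    refine Eq.trans ?_ (totSingleTensor_tm hΦ B h _ b)
    exact congrArg (totSingleTensor hΦ B m q) (totVal_totTensor Φ B h m y b)
  have := LinearMap.congr_fun this x
  rwa [LinearMap.sum_apply] at this

theorem totVal_totTensor_totSingleTensor (hΦ : IsSteep Φ) (B : Ch k) (m q : ℕ)
    (v : (Φ.obj (SimplexCategory.mk m) ⊗ B : Ch k).X (m + q)) (m' : ℕ) :
    totVal (Φ ⋙ tensorRight B) q (((totTensor Φ B).f q).hom (totSingleTensor hΦ B m q v)) m'
        (m' + q) =
      (Pi.single m (Pi.single (m + q)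
        (act (Φ ⋙ tensorRight B) m (m + q) _ (fundChain m) v)) :
          TotFun (Φ ⋙ tensorRight B)) m' (m' + q) := by
  have : (LinearMap.proj (m' + q) ∘ₗ
      (LinearMap.proj m' : TotFun (Φ ⋙ tensorRight B) →ₗ[k] _)) ∘ₗ
        totVal (Φ ⋙ tensorRight B) q ∘ₗ ((totTensor Φ B).f q).hom ∘ₗ totSingleTensor hΦ B m q =
      (LinearMap.proj (m' + q) ∘ₗ (LinearMap.proj m' : TotFun (Φ ⋙ tensorRight B) →ₗ[k] _)) ∘ₗ
        LinearMap.single k _ m ∘ₗ LinearMap.single k _ (m + q) ∘ₗ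
          act (Φ ⋙ tensorRight B) m (m + q) _ (fundChain m) := by
    apply tm_ext
    intro i j h a b
    change totVal (Φ ⋙ tensorRight B) q (((totTensor Φ B).f q).hom (totSingleTensor hΦ B m q
      (tm _ B i j (m + q) a b))) m' (m' + q) = (Pi.single m (Pi.single (m + q)
        (act (Φ ⋙ tensorRight B) m (m + q) _ (fundChain m) (tm _ B i j (m + q) a b))) :
          TotFun (Φ ⋙ tensorRight B)) m' (m' + q)
    rw [act_tensorRight]
    rcases lt_or_ge i m with hi | hi
    · rw [totSingleTensor_tm_of_lt hΦ B h hi, hΦ.act_fundChain_eq_zero (by omega), map_zero,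
        map_zero, map_zero, LinearMap.zero_apply, Pi.single_zero, Pi.single_zero]
    · obtain ⟨i, rfl⟩ := Nat.exists_eq_add_of_le hi
      rw [totSingleTensor_tm hΦ B (by omega : i + j = q), totVal_totTensor Φ B (by omega)]
      by_cases hm : m' = m
      · subst hm
        rw [totVal_totSingle_same, Pi.single_eq_same, Pi.single_eq_same]
      · rw [totVal_totSingle_of_ne hΦ _ _ _ hm, Pi.single_eq_of_ne hm, Pi.zero_apply, map_zero]
        rfl
  exact LinearMap.congr_fun this v

/-- Steepness passes to `Φ ⊗ B`, so both sides are finite sums over `m ≤ q` in degree `q`, and the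
maps `totSingleTensor` assemble to an inverse. -/
theorem IsSteep.totTensor_bijective (hΦ : IsSteep Φ) (B : Ch k) (q : ℕ) :
    Function.Bijective ((totTensor Φ B).f q).hom := by
  constructor
  · intro x y h
    rw [← sum_totSingleTensor hΦ B q x, ← sum_totSingleTensor hΦ B q y, h]
  · intro z
    refine ⟨∑ m ∈ Finset.range (q + 1), totSingleTensor hΦ B m q (totVal _ q z m (m + q)), ?_⟩
    apply totVal_injective
    funext m p
    by_cases hp : m + q = p
    · subst hp
      rw [map_sum, map_sum, Finset.sum_apply, Finset.sum_apply]
      simp only [totVal_totTensor_totSingleTensor]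
      by_cases hm : m ≤ q
      · rw [Finset.sum_eq_single m, Pi.single_eq_same, Pi.single_eq_same,
          act_fundChain _ _ _ (totVal_mem _ z _ _)]
        · intro m' _ h'
          rw [Pi.single_eq_of_ne (Ne.symm h')]; rfl
        · intro h'; exact absurd (Finset.mem_range.2 (by omega)) h'
      · rw [hΦ.tensorRight B m (m + q) (by omega) _ (totVal_mem _ z m (m + q))]
        refine Finset.sum_eq_zero fun m' h' => ?_
        rw [Finset.mem_range] at h'
        rw [Pi.single_eq_of_ne (by omega)]; rfl
    · rw [totVal_of_ne _ _ hp, totVal_of_ne _ _ hp]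

theorem IsSteep.isIso_totTensor (hΦ : IsSteep Φ) (B : Ch k) : IsIso (totTensor Φ B) := by
  have : ∀ q, IsIso ((totTensor Φ B).f q) := fun q =>
    (ConcreteCategory.isIso_iff_bijective _).2 (hΦ.totTensor_bijective B q)
  exact HomologicalComplex.Hom.isIso_of_components _

/-- The evaluations tensored with `B` are jointly monic because `tot Φ ⊗ B` is itself a total
complex. This allows the comodule axioms for `tot` to be checked on the cosimplicial comodule. -/
theorem IsSteep.hom_ext (hΦ : IsSteep Φ) {B D : Ch k} {f g : D ⟶ tot Φ ⊗ B}
    (h : ∀ n, (simplexChains k).obj n ◁ f ≫ (α_ _ _ _).inv ≫ totEval Φ n ▷ B =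
      (simplexChains k).obj n ◁ g ≫ (α_ _ _ _).inv ≫ totEval Φ n ▷ B) : f = g := by
  have := hΦ.isIso_totTensor B
  rw [← cancel_mono (totTensor Φ B)]
  apply tot_hom_ext
  intro n
  rw [whiskerLeft_comp, whiskerLeft_comp, Category.assoc, Category.assoc, whiskerLeft_totTensor, h]

end TotTensor

/-! ### The total complex of a cosimplicial comodule -/

section TotComodule

variable {V : Type u} [Category.{v} V] [MonoidalCategory V] {C : V} [ComonObj C]

namespace RightComodule

variable (C) in
/-- The forgetful functor from comodules. -/
@[reducible]
def forget : RightComodule C ⥤ V where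
  obj A := A.X
  map f := f.hom

/-- A comodule structure from a jointly monic family of maps to comodules. -/
@[simps, reducible]
def ofJointlyMonic {ι : Type*} {A : ι → V} {Y : V} (F : ι → RightComodule C)
    (e : ∀ i, A i ⊗ Y ⟶ (F i).X)
    (he : ∀ (B : V) {D : V} {f g : D ⟶ Y ⊗ B}, (∀ i, A i ◁ f ≫ (α_ _ _ _).inv ≫ e i ▷ B =
      A i ◁ g ≫ (α_ _ _ _).inv ≫ e i ▷ B) → f = g)
    (ρ : Y ⟶ Y ⊗ C) (hρ : ∀ i, A i ◁ ρ ≫ (α_ _ _ _).inv ≫ e i ▷ C = e i ≫ (F i).ρ) :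
    RightComodule C where
  X := Y
  ρ := ρ
  coassoc := by
    apply he
    intro i
    have h1 := hρ i =≫ (F i).X ◁ ComonObj.comul
    have h2 := congrArg (fun t => A i ◁ ρ ≫ (α_ _ _ _).inv ≫ t ▷ C ≫ (α_ _ _ _).hom) (hρ i)
    simp only [comp_whiskerRight, Category.assoc] at h1 h2
    rw [← whisker_exchange] at h1
    rw [reassoc_of% (hρ i), ← (F i).coassoc] at h2
    simp only [whiskerLeft_comp, Category.assoc]
    rw [associator_inv_naturality_right_assoc, h1, ← h2]
    simp
  counit := by
    apply he
    intro i
    have h1 := hρ i =≫ (F i).X ◁ ComonObj.counit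
    simp only [Category.assoc] at h1
    rw [← whisker_exchange, (F i).counit] at h1
    simp only [whiskerLeft_comp, Category.assoc]
    rw [associator_inv_naturality_right_assoc, h1]
    simp

end RightComodule

end TotComodule

end
end DGComod

namespace DGComod
noncomputable section

section TotComodule

open RightComodule

variable {k : Type u} [CommRing k] {C : Ch k} [ComonObj C]
  (F : SimplexCategory ⥤ RightComodule C)

theorem totEval_coaction_naturality {n n' : SimplexCategory} (b : n ⟶ n') :
    (simplexChains k).map b ▷ tot (F ⋙ forget C) ≫ totEval (F ⋙ forget C) n' ≫ (F.obj n').ρ =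
      (totEval (F ⋙ forget C) n ≫ (F.obj n).ρ) ≫
        ((F ⋙ forget C) ⋙ tensorRight C).map b := by
  rw [← Category.assoc, totEval_naturality, Category.assoc, Category.assoc]
  exact congrArg (fun t => totEval (F ⋙ forget C) n ≫ t) (F.map b).comm.symm

variable {F} (hF : IsSteep (F ⋙ forget C))

/-- The coaction on the total complex of a cosimplicial comodule. -/
def totCoaction : tot (F ⋙ forget C) ⟶ tot (F ⋙ forget C) ⊗ C :=
  letI := hF.isIso_totTensor C
  totLift (Φ := (F ⋙ forget C) ⋙ tensorRight C)
    (fun n => totEval (F ⋙ forget C) n ≫ (F.obj n).ρ) (totEval_coaction_naturality F) ≫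
    inv (totTensor (F ⋙ forget C) C)

/-- No projector is left over here: evaluations out of `tot` already absorb it
(`simplexProj_totEval`). -/
theorem whiskerLeft_totCoaction (n : SimplexCategory) :
    (simplexChains k).obj n ◁ totCoaction hF ≫ (α_ _ _ _).inv ≫
        totEval (F ⋙ forget C) n ▷ C = totEval (F ⋙ forget C) n ≫ (F.obj n).ρ := by
  have := hF.isIso_totTensor C
  rw [← whiskerLeft_totTensor, ← Category.assoc, ← whiskerLeft_comp, totCoaction, Category.assoc,
    IsIso.inv_hom_id, Category.comp_id,
    totLift_totEval _ (totEval_coaction_naturality F), ← Category.assoc, simplexProj_totEval]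

/-- The total complex of a cosimplicial comodule, as a comodule. -/
@[reducible]
def totComodule : RightComodule C :=
  ofJointlyMonic F.obj (totEval (F ⋙ forget C)) (fun _ _ _ _ => hF.hom_ext) (totCoaction hF)
    (whiskerLeft_totCoaction hF)

/-- The evaluation maps of the total complex of a cosimplicial comodule. -/
def totComoduleEval (n : SimplexCategory) :
    tensorLeft ((simplexChains k).obj n) (totComodule hF) ⟶ F.obj n where
  hom := totEval (F ⋙ forget C) n
  comm := (Category.assoc _ _ _).trans (whiskerLeft_totCoaction hF n)

/-- A morphism of complexes into the total complex is a morphism of comodules if its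
composites with the evaluation maps are. -/
def totComoduleHom {S : RightComodule C} (f : S.X ⟶ tot (F ⋙ forget C))
    (g : ∀ n, tensorLeft ((simplexChains k).obj n) S ⟶ F.obj n)
    (hg : ∀ n, (simplexChains k).obj n ◁ f ≫ totEval (F ⋙ forget C) n = (g n).hom) :
    S ⟶ totComodule hF where
  hom := f
  comm := by
    apply hF.hom_ext
    intro n
    change _ = _ ◁ (f ≫ totCoaction hF) ≫ _
    rw [whiskerLeft_comp, whiskerLeft_comp, Category.assoc, Category.assoc,
      whiskerLeft_totCoaction, ← Category.assoc (_ ◁ f), hg, ← (g n).comm, ← hg, comp_whiskerRight]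
    simp

end TotComodule

/-! ### The normalization of the cobar construction of a simply connected coalgebra -/

section Steep

open RightComodule

variable {k : Type u} [CommRing k] {C : Ch k} [ComonObj C]

theorem counitMap_tm_zero {M : Ch k} {n : ℕ} (a : M.X n) (b : C.X 0) (c : k)
    (hc : ((ComonObj.counit (X := C)).f 0).hom b = c • unitElt k) :
    ((counitMap C M).f n).hom (tm M C n 0 n a b) = c • a := by
  rw [counitMap, comp_hom_apply, whiskerLeft_tm, hc, map_smul, map_smul, rightUnitor_hom_tm]

theorem counitMap_tm_of_ne {M : Ch k} {i j n : ℕ} (hj : j ≠ 0) (a : M.X i)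
    (b : C.X j) : ((counitMap C M).f n).hom (tm M C i j n a b) = 0 := by
  rw [counitMap, comp_hom_apply, whiskerLeft_tm, unit_X_eq_zero hj (((ComonObj.counit (X := C)).f j).hom b),
    map_zero, map_zero]

/-- Let `g` generate `C_0` with `ε g = c` and `Δ g = d (g ⊗ g)`. The counit law gives `d c g = g`,
so `d g` generates `C_0` with coordinate the counit. Hence the counit is injective in degree `0`,
although the given isomorphism `C_0 ≅ k` need not be the counit. -/
theorem IsSimplyConnected.exists_unit (hC : IsSimplyConnected C) :
    ∃ e : C.X 0, ∀ b : C.X 0, ∃ c : k,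
      ((ComonObj.counit (X := C)).f 0).hom b = c • unitElt k ∧ b = c • e := by
  obtain ⟨f⟩ := hC.degree_zero
  let g : C.X 0 := f.inv.hom 1
  have hg : ∀ b : C.X 0, b = (f.hom.hom b : k) • g := fun b => by
    have h1 : f.inv.hom (f.hom.hom b) = b := congrArg (fun t => t.hom b) f.hom_inv_id
    have h2 : f.inv.hom ((f.hom.hom b : k) • (1 : k)) = (f.hom.hom b : k) • g := map_smul _ _ _
    rw [smul_eq_mul, mul_one, h1] at h2
    exact h2
  have hu : ∀ z : (𝟙_ (Ch k)).X 0, ∃ c : k, z = c • unitElt k := fun z => by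
    let e := HomologicalComplex.singleObjXSelf (ComplexShape.down ℕ) 0 (𝟙_ (ModuleCat.{u} k))
    refine ⟨e.hom.hom z, ?_⟩
    have h1 : e.inv.hom (e.hom.hom z) = z := congrArg (fun t => t.hom z) e.hom_inv_id
    have h2 : e.inv.hom ((e.hom.hom z : k) • (1 : k)) = (e.hom.hom z : k) • unitElt k :=
      map_smul _ _ _
    rw [smul_eq_mul, mul_one, h1] at h2
    exact h2
  obtain ⟨c, hc⟩ := hu (((ComonObj.counit (X := C)).f 0).hom g)
  -- The degree `0` part of `C ⊗ C` is `C_0 ⊗ C_0`, spanned by `g ⊗ g`; the product of the two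
  -- coordinates gives the coefficient.
  have hΔ : ∀ z : (C ⊗ C : Ch k).X 0, ∃ d : k, z = d • tm C C 0 0 0 g g := by
    have h1 : (LinearMap.toSpanSingleton k _ (tm C C 0 0 0 g g)) ∘ₗ
        tdesc (fun i j => match i, j with
          | 0, 0 => (LinearMap.mul k k).compl₁₂ f.hom.hom f.hom.hom
          | _, _ => 0) = LinearMap.id := by
      apply tm_ext
      intro i j hij a b
      obtain rfl : i = 0 := by omega
      obtain rfl : j = 0 := by omega
      rw [LinearMap.comp_apply, tdesc_tm _ hij, LinearMap.id_apply,
        LinearMap.toSpanSingleton_apply]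
      conv_rhs => rw [hg a, hg b, map_smul, map_smul, LinearMap.smul_apply, smul_smul, mul_comm]
      rfl
    intro z
    exact ⟨_, (LinearMap.congr_fun h1 z).symm⟩
  obtain ⟨d, hd⟩ := hΔ (((ComonObj.comul (X := C)).f 0).hom g)
  have h1 : d • c • g = g := by
    have h2 : ComonObj.comul (X := C) ≫ counitMap C C = 𝟙 C := by
      rw [counitMap, ← Category.assoc, ComonObj.comul_counit]
      simp
    have h3 := congrArg (fun t => (t.f 0).hom g) h2
    rw [← counitMap_tm_zero g g c hc, ← map_smul, ← hd]
    exact h3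
  refine ⟨d • g, fun b => ⟨f.hom.hom b * c, ?_, ?_⟩⟩
  · conv_lhs => rw [hg b]
    rw [map_smul, hc, smul_smul]
  · conv_lhs => rw [hg b, ← h1]
    rw [smul_smul, smul_smul, smul_smul]
    congr 1
    ring

/-- If the maps `s j` jointly detect elements of `M` below degree `2 * m`, then `s j ⊗ C` and the
new counit detect `M ⊗ C` below `2 * (m + 1)`. The counit recovers the part `M ⊗ C_0`, the part `M ⊗
C_1` is zero, and in `M ⊗ C_l` with `l ≥ 2` the first factor has degree less than `2 * m`. An
explicit linear left inverse is kept, rather than joint injectivity, because it survives tensoring.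
-/
theorem IsSimplyConnected.exists_section_step (hC : IsSimplyConnected C) {M N : Ch k} {m : ℕ}
    (s : Fin m → (M ⟶ N)) (r : ∀ a, Fin m → (N.X a →ₗ[k] M.X a))
    (h : ∀ a, a < 2 * m → ∀ x : M.X a, ∑ j, r a j (((s j).f a).hom x) = x) (a : ℕ)
    (ha : a < 2 * (m + 1)) :
    ∃ (r' : Fin m → ((N ⊗ C : Ch k).X a →ₗ[k] (M ⊗ C : Ch k).X a))
      (r'' : M.X a →ₗ[k] (M ⊗ C : Ch k).X a), ∀ x : (M ⊗ C : Ch k).X a,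
        ∑ j, r' j (((s j ▷ C).f a).hom x) + r'' (((counitMap C M).f a).hom x) = x := by
  obtain ⟨e, he⟩ := hC.exists_unit
  have h1 : ∀ c : C.X 1, c = 0 := fun c => by
    have := hC.degree_one.eq_of_src (𝟙 (C.X 1)) 0
    exact congrArg (fun f => f.hom c) this
  refine ⟨fun j => tdesc fun i l => if 2 ≤ l then (tm M C i l a).comp (r i j) else 0,
    (tm M C a 0 a).flip e, fun x => ?_⟩
  have : ∑ j, (tdesc fun i l => if 2 ≤ l then (tm M C i l a).comp (r i j) else 0) ∘ₗ
      ((s j ▷ C).f a).hom + (tm M C a 0 a).flip e ∘ₗ ((counitMap C M).f a).hom =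
      LinearMap.id := by
    apply tm_ext
    intro i l hil y c
    rw [LinearMap.add_apply, LinearMap.sum_apply, LinearMap.comp_apply, LinearMap.id_apply]
    have h2 : ∀ j, ((tdesc fun i l => if 2 ≤ l then (tm M C i l a).comp (r i j) else 0) ∘ₗ
        ((s j ▷ C).f a).hom) (tm M C i l a y c) =
        if 2 ≤ l then tm M C i l a (r i j (((s j).f i).hom y)) c else 0 := by
      intro j
      rw [LinearMap.comp_apply, whiskerRight_tm, tdesc_tm _ hil]
      split_ifs <;> rfl
    simp only [h2]
    -- The three cases are the degrees `0`, `1` and at least `2` of the last factor.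
    rcases l with _ | _ | l
    · obtain rfl : i = a := hil
      obtain ⟨d, hd, rfl⟩ := he c
      rw [counitMap_tm_zero y _ d hd]
      simp
    · rw [h1 c]; simp
    · rw [counitMap_tm_of_ne (by omega), map_zero, add_zero]
      simp only [le_add_iff_nonneg_left, zero_le, if_true]
      rw [← LinearMap.sum_apply, ← map_sum, h i (by omega)]
  have := LinearMap.congr_fun this x
  rwa [LinearMap.add_apply, LinearMap.sum_apply] at this

/-- The morphism `X ⊗ C ^ (m + 1) ⟶ X ⊗ C ^ m` which applies the counit to the factor `C`
number `j + 1`. -/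
def cobarCounit (X : RightComodule C) (m : ℕ) :
    Fin (m + 1) → ((cobarObj X (m + 1)).X ⟶ (cobarObj X m).X) :=
  Fin.lastCases (counitMap C (cobarObj X m).X)
    (match m with
    | 0 => fun j => j.elim0
    | m + 1 => fun j => (cobarCodegeneracy X m j).hom)

theorem cobarCounit_last (X : RightComodule C) (m : ℕ) :
    cobarCounit X m (Fin.last m) = counitMap C (cobarObj X m).X := by
  simp [cobarCounit]

theorem cobarCounit_castSucc (X : RightComodule C) (m : ℕ) (j : Fin (m + 1)) :
    cobarCounit X (m + 1) j.castSucc = (cobarCodegeneracy X m j).hom := by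
  simp [cobarCounit]

theorem cobarCodegeneracy_eq (X : RightComodule C) (m : ℕ) (j : Fin (m + 1)) :
    cobarCodegeneracy X m j = cofreeMap C (cobarCounit X m j) := by
  induction j using Fin.lastCases with
  | last => rw [cobarCodegeneracy_last, cobarCounit_last]
  | cast j =>
    cases m with
    | zero => exact j.elim0
    | succ m => rw [cobarCodegeneracy_castSucc, cobarCounit_castSucc]

theorem IsSimplyConnected.exists_section (hC : IsSimplyConnected C) (X : RightComodule C)
    (m : ℕ) : ∃ r : ∀ a, Fin (m + 1) →
      ((cobarObj X m).X.X a →ₗ[k] (cobarObj X (m + 1)).X.X a),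
      ∀ a, a < 2 * (m + 1) → ∀ x, ∑ j, r a j (((cobarCounit X m j).f a).hom x) = x := by
  induction m with
  | zero =>
    -- With no maps and the bound `0` the hypothesis is empty, so the step itself supplies the base
    -- case.
    have := hC.exists_section_step (M := X.X) (N := X.X) (m := 0) (fun j => j.elim0)
      (fun _ j => j.elim0) (fun a ha => absurd ha (by omega))
    choose! r' r h using this
    refine ⟨fun a _ => r a, fun a ha x => ?_⟩
    rw [Fin.sum_univ_one]
    have := h a ha x
    rwa [Fin.sum_univ_zero, zero_add] at this
  | succ m ih =>
    obtain ⟨r, hr⟩ := ih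
    have := hC.exists_section_step (cobarCounit X m) r hr
    choose! r' r'' h using this
    refine ⟨fun a => Fin.lastCases (r'' a) (r' a), fun a ha x => ?_⟩
    rw [Fin.sum_univ_castSucc]
    refine Eq.trans ?_ (h a ha x)
    rw [cobarCounit_last]
    beta_reduce
    rw [Fin.lastCases_last]
    refine congrArg (· + _) (Finset.sum_congr rfl fun j _ => ?_)
    rw [Fin.lastCases_castSucc, cobarCounit_castSucc, cobarCodegeneracy_eq]
    rfl

/-- The codegeneracies are `cobarCounit ⊗ C`, with the last factor `C` untouched. The left inverse
from `exists_section`, tensored with `C`, expresses `y` through its images under them, which are all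
zero. -/
theorem IsSimplyConnected.isSteep_cobar (hC : IsSimplyConnected C) (X : RightComodule C) :
    IsSteep ((cobar X).toFunctor ⋙ forget C) := by
  intro m p h y hy
  rcases m with _ | m
  · omega
  rw [mem_normalized_succ] at hy
  obtain ⟨r, hr⟩ := hC.exists_section X m
  have hy' : ∀ j : Fin (m + 1), ((cobarCounit X m j ▷ C).f p).hom y = 0 := by
    intro j
    have h1 : ((cobar X).toFunctor.map (SimplexCategory.σ j)).hom = cobarCounit X m j ▷ C := by
      rw [(cobar X).toFunctor_map_σ m j]
      exact congrArg Hom.hom (cobarCodegeneracy_eq X m j)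
    rw [← h1]
    exact hy j
  have h2 : ∑ j, gradedWhisker C (fun i => r i j) p ∘ₗ ((cobarCounit X m j ▷ C).f p).hom =
      LinearMap.id := by
    apply tm_ext
    intro i j hij a b
    rw [LinearMap.sum_apply]
    conv_rhs => rw [LinearMap.id_apply, ← hr i (by omega) a, map_sum, LinearMap.sum_apply]
    refine Finset.sum_congr rfl fun l _ => ?_
    rw [LinearMap.comp_apply, whiskerRight_tm, gradedWhisker_tm _ _ hij]
  have h3 : ∑ j, gradedWhisker C (fun i => r i j) p (((cobarCounit X m j ▷ C).f p).hom y) = y :=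
    (LinearMap.sum_apply ..).symm.trans (LinearMap.congr_fun h2 y)
  refine h3.symm.trans (Finset.sum_eq_zero fun j _ => ?_)
  exact (congrArg _ (hy' j)).trans (map_zero _)

end Steep

end
end DGComod

namespace DGComod
noncomputable section

/-! ### Chain homotopies by components, and natural cones -/

section Homotopy

variable {k : Type u} [CommRing k]

/-- A chain homotopy from its components in consecutive degrees. -/
def homotopyOfComponents {A B : Ch k} {f g : A ⟶ B} (s : ∀ q, A.X q →ₗ[k] B.X (q + 1))
    (h0 : ∀ a : A.X 0, (f.f 0).hom a = (B.d 1 0).hom (s 0 a) + (g.f 0).hom a)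
    (hs : ∀ q (a : A.X (q + 1)), (f.f (q + 1)).hom a = s q ((A.d (q + 1) q).hom a) +
      (B.d (q + 2) (q + 1)).hom (s (q + 1) a) + (g.f (q + 1)).hom a) : Homotopy f g where
  hom i j := if h : i + 1 = j then ModuleCat.ofHom (s i) ≫ eqToHom (by rw [h]) else 0
  zero i j h := dif_neg h
  comm := by
    intro i
    rw [Homotopy.prevD_chainComplex, dif_pos rfl, eqToHom_refl, Category.comp_id]
    apply ModuleCat.hom_ext
    ext a
    rcases i with _ | i
    · rw [Homotopy.dNext_zero_chainComplex, zero_add]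
      exact h0 a
    · rw [Homotopy.dNext_succ_chainComplex, dif_pos rfl, eqToHom_refl, Category.comp_id]
      exact hs i a

end Homotopy

section Cones

open RightComodule

variable {V : Type u} [Category.{v} V] [MonoidalCategory V] {C : V} [ComonObj C]
  {W : SimplexCategory ⥤ V} {F : Cosimplicial (RightComodule C)}

/-- The legs of a cone, as morphisms to the values of the functor on the simplex category. -/
def WeightedCone.leg (T : WeightedCone W F) (n : SimplexCategory) :
    tensorLeft (W.obj n) T.pt ⟶ F.toFunctor.obj n := T.π n.len

/-- The morphisms satisfying naturality are closed under composition and contain all cofaces and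
codegeneracies, which generate the simplex category. -/
theorem WeightedCone.leg_naturality (T : WeightedCone W F) {n n' : SimplexCategory}
    (b : n ⟶ n') :
    T.leg n ≫ F.toFunctor.map b = tensorMap (W.map b) (𝟙 T.pt) ≫ T.leg n' := by
  let P : MorphismProperty SimplexCategory := fun x y b =>
    T.leg x ≫ F.toFunctor.map b = tensorMap (W.map b) (𝟙 T.pt) ≫ T.leg y
  have : P.IsMultiplicative :=
    { id_mem := fun x => by
        change T.leg x ≫ F.toFunctor.map (𝟙 x) = tensorMap (W.map (𝟙 x)) (𝟙 T.pt) ≫ T.leg x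
        rw [F.toFunctor.map_id, W.map_id, Category.comp_id]
        ext
        simp
      comp_mem := by
        intro x y z b c hb hc
        change T.leg x ≫ F.toFunctor.map (b ≫ c) =
          tensorMap (W.map (b ≫ c)) (𝟙 T.pt) ≫ T.leg z
        rw [F.toFunctor.map_comp, W.map_comp, ← tensorMap_comp_tensorMap, Category.assoc]
        have hb' : T.leg x ≫ F.toFunctor.map b = tensorMap (W.map b) (𝟙 T.pt) ≫ T.leg y := hb
        have hc' : T.leg y ≫ F.toFunctor.map c = tensorMap (W.map c) (𝟙 T.pt) ≫ T.leg z := hc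
        rw [← Category.assoc, hb', Category.assoc, hc'] }
  have h := SimplexCategory.morphismProperty_eq_top P
    (fun {n} i => by
      change T.leg _ ≫ F.toFunctor.map _ = _ ≫ T.leg _
      rw [F.toFunctor_map_δ]; exact T.π_d n i)
    (fun {n} j => by
      change T.leg _ ≫ F.toFunctor.map _ = _ ≫ T.leg _
      rw [F.toFunctor_map_σ]; exact T.π_s n j)
  have : P b := by rw [h]; trivial
  exact this

/-- A cone from a family of morphisms which is natural on the simplex category. -/
def WeightedCone.ofNatural (A : RightComodule C)
    (π : ∀ n : SimplexCategory, tensorLeft (W.obj n) A ⟶ F.toFunctor.obj n)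
    (h : ∀ {n n'} (b : n ⟶ n'), π n ≫ F.toFunctor.map b = tensorMap (W.map b) (𝟙 A) ≫ π n') :
    WeightedCone W F where
  pt := A
  π n := π (SimplexCategory.mk n)
  π_d n i := (congrArg (fun t => π (SimplexCategory.mk n) ≫ t) (F.toFunctor_map_δ n i)).symm.trans
    (h _)
  π_s n j := (congrArg (fun t => π (SimplexCategory.mk (n + 1)) ≫ t)
    (F.toFunctor_map_σ n j)).symm.trans (h _)

/-- The cone with weight `W'` which is defined by a cone with weight `W` and a natural
transformation `W' ⟶ W`. -/
def WeightedCone.precomp {W' : SimplexCategory ⥤ V} (T : WeightedCone W F) (a : W' ⟶ W) :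
    WeightedCone W' F where
  pt := T.pt
  π n := tensorMap (a.app _) (𝟙 T.pt) ≫ T.π n
  π_d n i := by
    rw [Category.assoc, T.π_d, ← Category.assoc, ← Category.assoc, tensorMap_comp_tensorMap,
      tensorMap_comp_tensorMap, a.naturality]
  π_s n i := by
    rw [Category.assoc, T.π_s, ← Category.assoc, ← Category.assoc, tensorMap_comp_tensorMap,
      tensorMap_comp_tensorMap, a.naturality]

end Cones

/-! ### The coaugmentation of the total complex of the cobar construction -/

section Cobar

open RightComodule

variable {k : Type u} [CommRing k] {C : Ch k} [ComonObj C]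

variable (k) in
/-- The augmentation of the chains of the standard simplices. -/
def simplexAug (n : SimplexCategory) : (simplexChains k).obj n ⟶ 𝟙_ (Ch k) :=
  AlgebraicTopology.AlternatingFaceMapComplex.ε.app
    { left := (freeSimplicial k).obj (SSet.stdSimplex.{0}.obj n)
      right := 𝟙_ (ModuleCat.{u} k)
      hom := freeSimplicialAug k _ }

theorem simplexAug_elt {n : SimplexCategory} (a : SimplexCategory.mk 0 ⟶ n) :
    ((simplexAug k n).f 0).hom (simplexElt a) = unitElt k := by
  have h := AlgebraicTopology.AlternatingFaceMapComplex.ε_app_f_zero (C := ModuleCat.{u} k)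
    { left := (freeSimplicial k).obj (SSet.stdSimplex.{0}.obj n)
      right := 𝟙_ (ModuleCat.{u} k)
      hom := freeSimplicialAug k _ }
  refine (congrArg (fun f => ModuleCat.Hom.hom f (simplexElt a)) h).trans ?_
  exact ModuleCat.freeDesc_apply _ _

theorem simplexAug_naturality {n n' : SimplexCategory} (b : n ⟶ n') :
    (simplexChains k).map b ≫ simplexAug k n' = simplexAug k n := by
  apply ch_ext
  intro q x
  rcases q with _ | q
  · have : ((simplexAug k n').f 0).hom ∘ₗ (((simplexChains k).map b).f 0).hom =
        ((simplexAug k n).f 0).hom := by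
      apply simplexChains_ext
      intro a
      rw [LinearMap.comp_apply, simplexChains_map_elt, simplexAug_elt, simplexAug_elt]
    exact LinearMap.congr_fun this x
  · rw [unit_X_eq_zero (by omega) ((((simplexChains k).map b ≫ simplexAug k n').f _).hom x),
      unit_X_eq_zero (by omega) (((simplexAug k n).f _).hom x)]

variable (X : RightComodule C)

/-- The cone over the cobar construction with weight the chains of the standard simplices which
is given by the coaugmentation. -/
def simplexCone : WeightedCone (simplexChains k) (cobar X) :=
  coaugCone (simplexChains k) (simplexAug k) (fun f => simplexAug_naturality f) X

theorem WeightedCone.leg_hom_naturality {W : SimplexCategory ⥤ Ch k}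
    {F : Cosimplicial (RightComodule C)} (T : WeightedCone W F) {n n' : SimplexCategory}
    (b : n ⟶ n') : W.map b ▷ T.pt.X ≫ (T.leg n').hom =
      (T.leg n).hom ≫ (F.toFunctor ⋙ forget C).map b := by
  refine Eq.trans ?_ (congrArg Hom.hom (T.leg_naturality b)).symm
  rw [comp_hom, tensorMap_hom, id_hom, tensorHom_id]

/-- The morphism to the total complex which is defined by a cone with weight the chains of
the standard simplices. -/
def WeightedCone.toTot {F : Cosimplicial (RightComodule C)}
    (T : WeightedCone (simplexChains k) F) : T.pt.X ⟶ tot (F.toFunctor ⋙ forget C) :=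
  totLift (fun n => (T.leg n).hom) (T.leg_hom_naturality)

theorem WeightedCone.totVal_toTot {F : Cosimplicial (RightComodule C)}
    (T : WeightedCone (simplexChains k) F) (q m p : ℕ) (x : T.pt.X.X q) :
    totVal (F.toFunctor ⋙ forget C) q ((T.toTot.f q).hom x) m p =
      ((T.leg (SimplexCategory.mk m)).hom.f p).hom (tm _ T.pt.X m q p (fundChain m) x) :=
  rfl

theorem totVal_toTot_simplexCone_zero (q : ℕ) (x : X.X.X q) :
    totVal ((cobar X).toFunctor ⋙ forget C) q (((simplexCone X).toTot.f q).hom x) 0 q =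
      (X.ρ.f q).hom x := by
  refine ((simplexCone X).totVal_toTot q 0 q x).trans ?_
  have : (fundChain 0 : ((simplexChains k).obj _).X 0) = simplexElt (𝟙 _) := rfl
  rw [this]
  have h2 : ((simplexCone X).leg (SimplexCategory.mk 0)).hom =
    (simplexAug k (SimplexCategory.mk 0) ⊗ₘ 𝟙 X.X) ≫ (λ_ X.X).hom ≫ 𝟙 X.X ≫ X.ρ := rfl
  rw [h2]
  erw [comp_hom_apply, tensorHom_tm, simplexAug_elt]
  rw [Category.id_comp]
  erw [comp_hom_apply, leftUnitor_hom_tm]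
  rfl

/-- The augmentation kills chains of positive degree, so the image of `X` in the total complex is
concentrated in cosimplicial degree `0`, where it is the coaction. -/
theorem totVal_toTot_simplexCone_succ (q m p : ℕ) (x : X.X.X q) :
    totVal ((cobar X).toFunctor ⋙ forget C) q (((simplexCone X).toTot.f q).hom x) (m + 1) p =
      0 := by
  refine ((simplexCone X).totVal_toTot q (m + 1) p x).trans ?_
  have h2 : ((simplexCone X).leg (SimplexCategory.mk (m + 1))).hom =
    (simplexAug k (SimplexCategory.mk (m + 1)) ⊗ₘ 𝟙 X.X) ≫ (λ_ X.X).hom ≫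
      (coaug X (m + 2)).hom := rfl
  rw [h2]
  erw [comp_hom_apply, tensorHom_tm, unit_X_eq_zero (Nat.succ_ne_zero m)
    (((simplexAug k _).f (m + 1)).hom (fundChain (m + 1))), map_zero, LinearMap.zero_apply,
    map_zero]

end Cobar

end
end DGComod

namespace DGComod
noncomputable section

/-! ### The extra codegeneracy and the contraction of the total complex -/

section Contraction

open RightComodule

section Abstract

variable {V : Type u} [Category.{v} V] [MonoidalCategory V] {C : V} [ComonObj C]
  (X : RightComodule C)

/-- The objects underlying the cobar construction. -/
abbrev cobarFunctor : SimplexCategory ⥤ V := (cobar X).toFunctor ⋙ forget C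

/-- The counit applied to the last factor `C` of the cobar construction. -/
def extraCounit (m : ℕ) : (cobarFunctor X).obj (SimplexCategory.mk (m + 1)) ⟶
    (cobarFunctor X).obj (SimplexCategory.mk m) :=
  counitMap C (cobarObj X (m + 1)).X

/-- The cofaces of the cobar construction. -/
def cobarδ (m : ℕ) (i : Fin (m + 2)) : (cobarFunctor X).obj (SimplexCategory.mk m) ⟶
    (cobarFunctor X).obj (SimplexCategory.mk (m + 1)) := (cobarCoface X (m + 1) i).hom

/-- The codegeneracies of the cobar construction. -/
def cobarσ (m : ℕ) (i : Fin (m + 1)) : (cobarFunctor X).obj (SimplexCategory.mk (m + 1)) ⟶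
    (cobarFunctor X).obj (SimplexCategory.mk m) := (cobarCodegeneracy X m i).hom

theorem cobarFunctor_map_δ (m : ℕ) (i : Fin (m + 2)) :
    (cobarFunctor X).map (SimplexCategory.δ i) = cobarδ X m i :=
  congrArg Hom.hom ((cobar X).toFunctor_map_δ m i)

theorem cobarFunctor_map_σ (m : ℕ) (i : Fin (m + 1)) :
    (cobarFunctor X).map (SimplexCategory.σ i) = cobarσ X m i :=
  congrArg Hom.hom ((cobar X).toFunctor_map_σ m i)

theorem cobarCoface_castSucc_counitMap (m : ℕ) (i : Fin (m + 1)) :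
    (cobarCoface X (m + 1) i.castSucc).hom ≫ counitMap C (cobarObj X (m + 1)).X =
      counitMap C (cobarObj X m).X ≫ (cobarCoface X m i).hom := by
  rw [cobarCoface_castSucc, cofreeMap_hom, counitMap_naturality]

theorem cobarCoface_last_counitMap (m : ℕ) :
    (cobarCoface X m (Fin.last m)).hom ≫ counitMap C (cobarObj X m).X = 𝟙 _ := by
  rw [cobarCoface_last, coaction_hom, coaction_counitMap]

theorem cobarCodegeneracy_castSucc_counitMap (m : ℕ) (j : Fin (m + 1)) :
    (cobarCodegeneracy X (m + 1) j.castSucc).hom ≫ counitMap C (cobarObj X (m + 1)).X =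
      counitMap C (cobarObj X (m + 2)).X ≫ (cobarCodegeneracy X m j).hom := by
  rw [cobarCodegeneracy_castSucc, cofreeMap_hom, counitMap_naturality]

theorem cobarδ_castSucc_extraCounit (m : ℕ) (i : Fin (m + 2)) :
    cobarδ X (m + 1) i.castSucc ≫ extraCounit X (m + 1) = extraCounit X m ≫ cobarδ X m i :=
  cobarCoface_castSucc_counitMap X (m + 1) i

theorem cobarσ_castSucc_extraCounit (m : ℕ) (j : Fin (m + 1)) :
    cobarσ X (m + 1) j.castSucc ≫ extraCounit X m = extraCounit X (m + 1) ≫ cobarσ X m j :=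
  cobarCodegeneracy_castSucc_counitMap X m j

/-- The counit `X ⊗ C ⟶ X` on the cobar construction in degree zero. -/
def zeroCounit : (cobarFunctor X).obj (SimplexCategory.mk 0) ⟶ X.X := counitMap C X.X

/-- The coaction of `X` as a morphism to the cobar construction in degree zero. -/
def zeroCoaction : X.X ⟶ (cobarFunctor X).obj (SimplexCategory.mk 0) := X.ρ

theorem zeroCoaction_zeroCounit : zeroCoaction X ≫ zeroCounit X = 𝟙 X.X := coaction_counitMap X

theorem δ_castSucc_extraCounit (m : ℕ) (i : Fin (m + 2)) :
    (cobarFunctor X).map (SimplexCategory.δ i.castSucc) ≫ extraCounit X (m + 1) =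
      extraCounit X m ≫ (cobarFunctor X).map (SimplexCategory.δ i) := by
  rw [cobarFunctor_map_δ X m, cobarFunctor_map_δ X (m + 1), cobarδ_castSucc_extraCounit]

/-- At the bottom the extra codegeneracy passes the coface and leaves the idempotent `X ⊗ C ⟶ X ⟶ X
⊗ C`, the projection onto the copy of `X`. -/
theorem δ_zero_extraCounit :
    (cobarFunctor X).map (SimplexCategory.δ (0 : Fin 2)) ≫ extraCounit X 0 =
      zeroCounit X ≫ zeroCoaction X := by
  rw [cobarFunctor_map_δ X 0]
  exact cobarCoface_castSucc_counitMap X 0 0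

theorem δ_last_extraCounit (m : ℕ) :
    (cobarFunctor X).map (SimplexCategory.δ (Fin.last (m + 1))) ≫ extraCounit X m = 𝟙 _ := by
  rw [cobarFunctor_map_δ]
  exact cobarCoface_last_counitMap X (m + 1)

theorem σ_extraCounit (m : ℕ) (j : Fin (m + 1)) :
    (cobarFunctor X).map (SimplexCategory.σ j.castSucc) ≫ extraCounit X m =
      extraCounit X (m + 1) ≫ (cobarFunctor X).map (SimplexCategory.σ j) := by
  rw [cobarFunctor_map_σ X m, cobarFunctor_map_σ X (m + 1), cobarσ_castSucc_extraCounit]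

end Abstract

variable {k : Type u} [CommRing k] {C : Ch k} [ComonObj C] (X : RightComodule C)

/-- The extra counit commutes with every coface but the last, which it inverts; that coface has sign
`(-1) ^ (m + 2) = (-1) ^ m`. -/
theorem extraCounit_coboundary_succ (m p : ℕ)
    (y : ((cobarFunctor X).obj (SimplexCategory.mk (m + 1))).X p) :
    ((extraCounit X (m + 1)).f p).hom (coboundary (cobarFunctor X) (m + 1) p y) =
      coboundary (cobarFunctor X) m p (((extraCounit X m).f p).hom y) + (-1 : k) ^ m • y := by
  rw [coboundary_apply, coboundary_apply, Fin.sum_univ_castSucc, map_add, map_sum]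
  refine congrArg₂ (· + ·) (Finset.sum_congr rfl fun i _ => ?_) ?_
  · rw [map_smul]
    exact congrArg (fun t => (-1 : k) ^ (i : ℕ) • (t.f p).hom y) (δ_castSucc_extraCounit X m i)
  · rw [map_smul, Fin.val_last, pow_add, neg_one_sq, mul_one]
    exact congrArg (fun t => (-1 : k) ^ m • (t.f p).hom y) (δ_last_extraCounit X (m + 1))

theorem extraCounit_coboundary_zero (p : ℕ)
    (y : ((cobarFunctor X).obj (SimplexCategory.mk 0)).X p) :
    ((extraCounit X 0).f p).hom (coboundary (cobarFunctor X) 0 p y) =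
      ((zeroCoaction X).f p).hom (((zeroCounit X).f p).hom y) - y := by
  rw [coboundary_apply, Fin.sum_univ_two, map_add, map_smul, map_smul, Fin.val_zero, pow_zero,
    one_smul, Fin.val_one, pow_one, neg_one_smul, sub_eq_add_neg]
  refine congrArg₂ (· + ·) ?_ (congrArg Neg.neg ?_)
  · exact congrArg (fun t => (t.f p).hom y) (δ_zero_extraCounit X)
  · exact congrArg (fun t => (t.f p).hom y) (δ_last_extraCounit X 0)

/-- The extra counit commutes with all codegeneracies except the last one of its source, so it
preserves their common kernel. -/
theorem extraCounit_mem_normalized (m p : ℕ)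
    {y : ((cobarFunctor X).obj (SimplexCategory.mk (m + 1))).X p}
    (hy : y ∈ normalized (cobarFunctor X) (m + 1) p) :
    ((extraCounit X m).f p).hom y ∈ normalized (cobarFunctor X) m p := by
  rcases m with _ | m
  · exact Submodule.mem_top
  · rw [mem_normalized_succ] at hy ⊢
    intro j
    have := congrArg (fun t => (t.f p).hom y) (σ_extraCounit X m j)
    refine Eq.trans this.symm ?_
    exact (congrArg ((extraCounit X m).f p).hom (hy j.castSucc)).trans (map_zero _)

/-- The contracting homotopy of the total complex of the cobar construction. -/
def totContractFun : TotFun (cobarFunctor X) →ₗ[k] TotFun (cobarFunctor X) :=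
  LinearMap.pi fun m => LinearMap.pi fun p =>
    -- With this sign, and the factor `(-1) ^ m` in `totD`, the homotopy equation holds with the
    -- identity rather than its negative.
    -(((extraCounit X m).f p).hom ∘ₗ LinearMap.proj p ∘ₗ LinearMap.proj (m + 1))

theorem totContractFun_apply (y : TotFun (cobarFunctor X)) (m p : ℕ) :
    totContractFun X y m p = -((extraCounit X m).f p).hom (y (m + 1) p) := rfl

theorem totContractFun_mem (q : ℕ) (y : (tot (cobarFunctor X)).X q) :
    totContractFun X (totVal _ q y) ∈ totSub (cobarFunctor X) (q + 1) := by
  refine ⟨fun m p h => ?_, fun m p => ?_⟩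
  · rw [totContractFun_apply, totVal_of_ne _ y (by omega), map_zero, neg_zero]
  · rw [totContractFun_apply]
    exact Submodule.neg_mem _ (extraCounit_mem_normalized X m p (totVal_mem _ y _ _))

/-- The internal differentials cancel because the extra counit is a chain map; what remains is its
commutator with the coboundary, which is the identity up to sign. -/
theorem totContractFun_homotopy_succ (y : TotFun (cobarFunctor X)) (m p : ℕ) :
    totContractFun X (totD _ y) (m + 1) p + totD _ (totContractFun X y) (m + 1) p =
      y (m + 1) p := by
  rw [totContractFun_apply, totD_apply, totD_apply, totContractFun_apply, coboundaryInto_succ,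
    coboundaryInto_succ, totContractFun_apply, map_smul, map_sub, extraCounit_coboundary_succ,
    hom_d, map_neg, map_neg]
  generalize coboundary (cobarFunctor X) m p _ = a
  generalize (((cobarFunctor X).obj _).d (p + 1) p).hom _ = b
  have h : (-1 : k) ^ (m + 1) • (-1 : k) ^ m • y (m + 1) p = -y (m + 1) p := by
    rw [smul_smul, ← pow_add, Odd.neg_one_pow ⟨m, by ring⟩, neg_one_smul]
  rw [pow_succ (-1 : k) (m + 1), mul_neg_one, neg_smul, smul_sub, smul_add, h, smul_sub, smul_neg,
    smul_neg]
  abel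

theorem totContractFun_homotopy_zero (y : TotFun (cobarFunctor X)) (p : ℕ) :
    totContractFun X (totD _ y) 0 p + totD _ (totContractFun X y) 0 p =
      y 0 p - ((zeroCoaction X).f p).hom (((zeroCounit X).f p).hom (y 0 p)) := by
  rw [totContractFun_apply, totD_apply, totD_apply, totContractFun_apply, coboundaryInto_succ,
    coboundaryInto_zero, map_smul, map_sub, extraCounit_coboundary_zero, hom_d, map_neg]
  simp only [zero_add, pow_one, pow_zero, one_smul, sub_zero, neg_smul, neg_neg]
  abel

/-- The retraction of the total complex of the cobar construction. -/
def totRetraction : tot (cobarFunctor X) ⟶ X.X where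
  f q := ModuleCat.ofHom (((zeroCounit X).f q).hom ∘ₗ LinearMap.proj q ∘ₗ
    (LinearMap.proj 0 : TotFun (cobarFunctor X) →ₗ[k] _) ∘ₗ totVal _ q)
  comm' := by
    rintro _ q rfl
    apply ModuleCat.hom_ext
    ext y
    change (X.X.d (q + 1) q).hom (((zeroCounit X).f (q + 1)).hom (totVal _ (q + 1) y 0 (q + 1))) =
      ((zeroCounit X).f q).hom (totVal _ q (((tot (cobarFunctor X)).d (q + 1) q).hom y) 0 q)
    have := totVal_d (cobarFunctor X) (q + 1) y
    rw [Nat.add_sub_cancel] at this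
    rw [this, totD_apply, coboundaryInto_zero, sub_zero, pow_zero, one_smul]
    exact (hom_d (zeroCounit X) (q + 1) q _).symm

theorem totRetraction_apply (q : ℕ) (y : (tot (cobarFunctor X)).X q) :
    ((totRetraction X).f q).hom y = ((zeroCounit X).f q).hom (totVal _ q y 0 q) := rfl

theorem toTot_totRetraction : (simplexCone X).toTot ≫ totRetraction X = 𝟙 X.X := by
  apply ch_ext
  intro q x
  refine (totRetraction_apply X q _).trans ?_
  refine (congrArg ((zeroCounit X).f q).hom (totVal_toTot_simplexCone_zero X q x)).trans ?_
  exact congrArg (fun t => (t.f q).hom x) (zeroCoaction_zeroCounit X)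

/-- The components of the contracting homotopy. -/
def totContract (q : ℕ) : (tot (cobarFunctor X)).X q →ₗ[k] (tot (cobarFunctor X)).X (q + 1) where
  toFun y := totMk _ (q + 1) _ (totContractFun_mem X q y) (fun h => by omega)
  map_add' x y := totVal_injective (by
    change totContractFun X (totVal _ q (x + y)) =
      totContractFun X (totVal _ q x) + totContractFun X (totVal _ q y)
    rw [map_add, map_add])
  map_smul' c x := totVal_injective (by
    change totContractFun X (totVal _ q (c • x)) = c • totContractFun X (totVal _ q x)
    rw [map_smul, map_smul])

theorem totVal_totContract (q : ℕ) (y : (tot (cobarFunctor X)).X q) :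
    totVal _ (q + 1) (totContract X q y) = totContractFun X (totVal _ q y) := rfl

theorem totVal_d_totContract (q : ℕ) (y : (tot (cobarFunctor X)).X q) :
    totVal _ q (((tot (cobarFunctor X)).d (q + 1) q).hom (totContract X q y)) =
      totD _ (totContractFun X (totVal _ q y)) :=
  totVal_d (cobarFunctor X) (q + 1) (totContract X q y)

theorem totContractFun_homotopy (q : ℕ) (y : (tot (cobarFunctor X)).X q) :
    totVal _ q y = totContractFun X (totD _ (totVal _ q y)) +
      totD _ (totContractFun X (totVal _ q y)) +
        totVal _ q (((totRetraction X ≫ (simplexCone X).toTot).f q).hom y) := by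
  funext m p
  rw [Pi.add_apply, Pi.add_apply, Pi.add_apply, Pi.add_apply]
  rcases m with _ | m
  · rw [totContractFun_homotopy_zero]
    by_cases hp : q = p
    · subst hp
      have : totVal _ q (((totRetraction X ≫ (simplexCone X).toTot).f q).hom y) 0 q =
          ((zeroCoaction X).f q).hom (((zeroCounit X).f q).hom (totVal _ q y 0 q)) :=
        totVal_toTot_simplexCone_zero X q (((totRetraction X).f q).hom y)
      rw [this, sub_add_cancel]
    · rw [totVal_of_ne _ y (by omega), totVal_of_ne _ _ (by omega), map_zero, map_zero, sub_zero,
        add_zero]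
  · rw [totContractFun_homotopy_succ]
    have : totVal _ q (((totRetraction X ≫ (simplexCone X).toTot).f q).hom y) (m + 1) p = 0 :=
      totVal_toTot_simplexCone_succ X q m p (((totRetraction X).f q).hom y)
    rw [this, add_zero]

/-- The homotopy which exhibits `X` as a deformation retract of the total complex of its cobar
construction. -/
def totHomotopy : Homotopy (𝟙 (tot (cobarFunctor X))) (totRetraction X ≫ (simplexCone X).toTot) :=
  homotopyOfComponents (totContract X)
    (fun y => totVal_injective (by
      have h : totD _ (totVal _ 0 y) = 0 := truncVal_cycle _ _ _ _ y
      have h2 := totContractFun_homotopy X 0 y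
      rw [h, map_zero, zero_add] at h2
      rw [map_add, totVal_d_totContract]
      exact h2))
    (fun q y => totVal_injective (by
      rw [map_add, map_add, totVal_d_totContract, totVal_totContract]
      have h : totVal _ q (((tot (cobarFunctor X)).d (q + 1) q).hom y) = totD _ (totVal _ _ y) :=
        totVal_d (cobarFunctor X) (q + 1) y
      rw [h]
      exact totContractFun_homotopy X (q + 1) y))

/-- The retraction and the homotopy live only in chain complexes, since the counit on the last
factor is not a comodule map. A quasi-isomorphism requires no more. -/
theorem quasiIso_toTot : QuasiIso (simplexCone X).toTot := by
  let e : HomotopyEquiv X.X (tot (cobarFunctor X)) :=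
    { hom := (simplexCone X).toTot
      inv := totRetraction X
      homotopyHomInvId := Homotopy.ofEq (toTot_totRetraction X)
      homotopyInvHomId := (totHomotopy X).symm }
  exact e.quasiIso_hom

end Contraction

end
end DGComod

namespace DGComod
noncomputable section

/-! ### Extending simplices of a nerve by a terminal object -/

section Nerve

theorem functor_eq_of_subsingleton {J D : Type*} [Category J] [Category D]
    [∀ a b : D, Subsingleton (a ⟶ b)] {F G : J ⥤ D} (h : ∀ j, F.obj j = G.obj j) : F = G :=
  CategoryTheory.Functor.ext h (fun _ _ _ => Subsingleton.elim _ _)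

instance {α : Type*} [Preorder α] (a b : WithTerminal α) : Subsingleton (a ⟶ b) := by
  rcases a with a | _ <;> rcases b with b | _
  · exact inferInstanceAs (Subsingleton (a ⟶ b))
  · exact inferInstanceAs (Subsingleton PUnit)
  · exact inferInstanceAs (Subsingleton PEmpty)
  · exact inferInstanceAs (Subsingleton PUnit)

/-- The map which sends the last element to the adjoined terminal object. -/
def snocObj (m : ℕ) (j : Fin (m + 2)) : WithTerminal (Fin (m + 1)) :=
  if h : j.val < m + 1 then .of ⟨j.val, h⟩ else .star

theorem snocObj_castSucc {m : ℕ} (j : Fin (m + 1)) : snocObj m j.castSucc = .of j :=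
  dif_pos j.2

theorem snocObj_last (m : ℕ) : snocObj m (Fin.last (m + 1)) = .star :=
  dif_neg (lt_irrefl _)

/-- The functor which sends the last object to the adjoined terminal object. -/
def snocShape (m : ℕ) : Fin (m + 2) ⥤ WithTerminal (Fin (m + 1)) where
  obj := snocObj m
  map {i j} f := by
    by_cases hj : j.val < m + 1
    · have hi : i.val < m + 1 := lt_of_le_of_lt (leOfHom f) hj
      rw [snocObj, snocObj, dif_pos hi, dif_pos hj]
      exact WithTerminal.incl.map (homOfLE (leOfHom f))
    · rw [show snocObj m j = .star from dif_neg hj]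
      exact default
  map_id _ := Subsingleton.elim _ _
  map_comp _ _ := Subsingleton.elim _ _

variable {D : Type*} [Category D] {t : D}

/-- The extension of a sequence of composable arrows by a terminal object. -/
def snocTerminal (ht : Limits.IsTerminal t) {m : ℕ} (x : ComposableArrows D m) :
    ComposableArrows D (m + 1) :=
  snocShape m ⋙ WithTerminal.lift x (fun _ => ht.from _) (fun _ _ _ => ht.hom_ext _ _)

theorem withTerminal_map_lift (ht : Limits.IsTerminal t) {J J' : Type*} [Category J] [Category J']
   (F : J ⥤ J') (x : J' ⥤ D) :
   WithTerminal.map F ⋙ WithTerminal.lift x (fun _ => ht.from _) (fun _ _ _ => ht.hom_ext _ _) =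
   WithTerminal.lift (F ⋙ x) (fun _ => ht.from _) (fun _ _ _ => ht.hom_ext _ _) := by
  refine CategoryTheory.Functor.ext ?_ ?_
  · rintro (a | _) <;> rfl
  · rintro (a | _) (b | _) f
    · exact ((Category.id_comp _).trans (Category.comp_id _)).symm
    · exact ht.hom_ext _ _
    · exact f.elim
    · exact ht.hom_ext _ _

theorem snocTerminal_last (ht : Limits.IsTerminal t) {m : ℕ} (x : ComposableArrows D m) :
    (nerve D).δ (Fin.last (m + 1)) (snocTerminal ht x) = x := by
  have : (SimplexCategory.toCat.map (SimplexCategory.δ (Fin.last (m+1)))).toFunctor ⋙ snocShape m =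
     WithTerminal.incl := by
    apply functor_eq_of_subsingleton
    intro j
    exact (congrArg (snocObj m) (Fin.succAbove_last_apply j)).trans (snocObj_castSucc j)
  exact congrArg (· ⋙ WithTerminal.lift x (fun _ => ht.from _) (fun _ _ _ => ht.hom_ext _ _)) this

/-- Both sides factor through `Fin (m + 2)` with a terminal object adjoined. Hom sets there have at
most one element, so the shape functors only need to agree on objects. -/
theorem snocTerminal_castSucc (ht : Limits.IsTerminal t) {m : ℕ} (x : ComposableArrows D (m + 1))
    (i : Fin (m + 2)) :
    (nerve D).δ i.castSucc (snocTerminal ht x) = snocTerminal ht ((nerve D).δ i x) := by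
  have : (SimplexCategory.toCat.map (SimplexCategory.δ i.castSucc)).toFunctor ⋙ snocShape (m + 1) =
     snocShape m ⋙ WithTerminal.map (SimplexCategory.toCat.map (SimplexCategory.δ i)).toFunctor := by
    apply functor_eq_of_subsingleton
    intro j
    rcases Fin.eq_castSucc_or_eq_last j with ⟨j, rfl⟩ | rfl
    · refine ((congrArg (snocObj (m + 1)) (Fin.castSucc_succAbove_castSucc (i := i) (j := j))).trans
        (snocObj_castSucc _)).trans ?_
      exact congrArg
        (WithTerminal.map (SimplexCategory.toCat.map (SimplexCategory.δ i)).toFunctor).obj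
        (snocObj_castSucc j).symm
    · refine ((congrArg (snocObj (m + 1)) (Fin.succAbove_castSucc_of_le _ _ (Fin.le_last i))).trans
        (snocObj_last _)).trans ?_
      exact congrArg
        (WithTerminal.map (SimplexCategory.toCat.map (SimplexCategory.δ i)).toFunctor).obj
        (snocObj_last m).symm
  refine (congrArg
    (· ⋙ WithTerminal.lift x (fun _ => ht.from _) (fun _ _ _ => ht.hom_ext _ _)) this).trans ?_
  exact congrArg (snocShape m ⋙ ·) (withTerminal_map_lift ht _ x)

theorem snocTerminal_zero (ht : Limits.IsTerminal t) (x : ComposableArrows D 0) :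
    (nerve D).δ 0 (snocTerminal ht x) = ComposableArrows.mk₀ t :=
  ComposableArrows.ext₀ rfl

end Nerve

/-! ### Chains of contractible simplicial sets -/

section FreeChains

/-- The morphism from the unit defined by an element. -/
def unitDesc {k : Type u} [CommRing k] {M : Type*} [AddCommGroup M] [Module k M] (y : M) :
    (𝟙_ (Ch k)).X 0 →ₗ[k] M :=
  LinearMap.toSpanSingleton k M y ∘ₗ
    (HomologicalComplex.singleObjXSelf (ComplexShape.down ℕ) 0 (𝟙_ (ModuleCat.{u} k))).hom.hom

theorem unitDesc_unitElt {k : Type u} [CommRing k] {M : Type*} [AddCommGroup M] [Module k M]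
    (y : M) : unitDesc y (unitElt k) = y := by
  have h := congrArg (fun t => t.hom (1 : k)) (HomologicalComplex.singleObjXSelf
    (ComplexShape.down ℕ) 0 (𝟙_ (ModuleCat.{u} k))).inv_hom_id
  exact (congrArg (LinearMap.toSpanSingleton k M y) h).trans (one_smul k y)

variable (k : Type u) [CommRing k]

/-- The unnormalized chains of a simplicial set. -/
def freeChains : SSet.{0} ⥤ Ch k :=
  freeSimplicial k ⋙ AlgebraicTopology.alternatingFaceMapComplex (ModuleCat.{u} k)

/-- The augmentation of the unnormalized chains of a simplicial set. -/
def freeChainsAug (K : SSet.{0}) : (freeChains k).obj K ⟶ 𝟙_ (Ch k) :=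
  AlgebraicTopology.AlternatingFaceMapComplex.ε.app
    { left := (freeSimplicial k).obj K
      right := 𝟙_ (ModuleCat.{u} k)
      hom := freeSimplicialAug k _ }

variable {k}

/-- A simplex as a chain. -/
def chainElt {K : SSet.{0}} {m : ℕ} (x : K.obj (Opposite.op (SimplexCategory.mk m))) :
    ((freeChains k).obj K).X m :=
  (ModuleCat.freeMk (R := k) (ULift.up.{u} x) : _)

theorem freeChains_ext {K : SSet.{0}} {m : ℕ} {M : Type*} [AddCommGroup M] [Module k M]
    {f g : ((freeChains k).obj K).X m →ₗ[k] M}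
    (h : ∀ x, f (chainElt x) = g (chainElt x)) : f = g :=
  Finsupp.lhom_ext' fun x => LinearMap.ext_ring (h x.down)

theorem freeChainsAug_elt {K : SSet.{0}} (x : K.obj (Opposite.op (SimplexCategory.mk 0))) :
    ((freeChainsAug k K).f 0).hom (chainElt x) = unitElt k := by
  have h := AlgebraicTopology.AlternatingFaceMapComplex.ε_app_f_zero (C := ModuleCat.{u} k)
    { left := (freeSimplicial k).obj K
      right := 𝟙_ (ModuleCat.{u} k)
      hom := freeSimplicialAug k _ }
  refine (congrArg (fun f => ModuleCat.Hom.hom f (chainElt x)) h).trans ?_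
  exact ModuleCat.freeDesc_apply _ _

theorem freeChains_d_elt {K : SSet.{0}} {m : ℕ}
    (x : K.obj (Opposite.op (SimplexCategory.mk (m + 1)))) :
    (((freeChains k).obj K).d (m + 1) m).hom (chainElt x) =
      ∑ i : Fin (m + 2), (-1 : k) ^ (i : ℕ) • chainElt (K.δ i x) := by
  have h : ((freeChains k).obj K).d (m + 1) m = ∑ i : Fin (m + 2), (-1 : ℤ) ^ (i : ℕ) •
      ((freeSimplicial k).obj K).δ i :=
    AlgebraicTopology.AlternatingFaceMapComplex.obj_d_eq _ _
  refine (congrArg (fun f => f.hom (chainElt x)) h).trans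
    ((alternating_sum_hom_apply _ (chainElt x)).trans ?_)
  exact Finset.sum_congr rfl fun i _ => congrArg _ (ModuleCat.free_map_apply _ _)

/-- A contraction of a simplicial set, in terms of extra degeneracies at the end. -/
structure EndContraction (K : SSet.{0}) where
  /-- the extra degeneracies -/
  s (m : ℕ) : K.obj (Opposite.op (SimplexCategory.mk m)) →
    K.obj (Opposite.op (SimplexCategory.mk (m + 1)))
  /-- the base point -/
  pt : K.obj (Opposite.op (SimplexCategory.mk 0))
  δ_last (m : ℕ) (x) : K.δ (Fin.last (m + 1)) (s m x) = x
  δ_castSucc (m : ℕ) (i : Fin (m + 2)) (x) : K.δ i.castSucc (s (m + 1) x) = s m (K.δ i x)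
  δ_zero (x) : K.δ 0 (s 0 x) = pt

namespace EndContraction

variable {K : SSet.{0}} (c : EndContraction K)

/-- The extra degeneracies on chains. -/
def op (m : ℕ) : ((freeChains k).obj K).X m →ₗ[k] ((freeChains k).obj K).X (m + 1) :=
  ((ModuleCat.free k).map (TypeCat.ofHom fun x : ULift.{u} _ => ULift.up (c.s m x.down))).hom

theorem op_elt {m : ℕ} (x : K.obj (Opposite.op (SimplexCategory.mk m))) :
    c.op (k := k) m (chainElt x) = chainElt (c.s m x) :=
  ModuleCat.free_map_apply _ _

/-- The two faces of the extra degeneracy of a vertex are the base point and the vertex, so the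
boundary is the augmentation times the base point minus the chain. -/
theorem d_op_zero (z : ((freeChains k).obj K).X 0) (hz : ((freeChainsAug k K).f 0).hom z = 0) :
    (((freeChains k).obj K).d 1 0).hom (c.op 0 z) = - z := by
  have h : (((freeChains k).obj K).d 1 0).hom ∘ₗ c.op 0 =
      unitDesc (chainElt c.pt) ∘ₗ ((freeChainsAug k K).f 0).hom - LinearMap.id := by
    apply freeChains_ext
    intro x
    rw [LinearMap.comp_apply, op_elt, freeChains_d_elt, Fin.sum_univ_two, LinearMap.sub_apply,
      LinearMap.comp_apply, freeChainsAug_elt, unitDesc_unitElt, c.δ_zero,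
      show K.δ 1 (c.s 0 x) = x from c.δ_last 0 x]
    simp [sub_eq_add_neg]
  refine (LinearMap.congr_fun h z).trans ?_
  rw [LinearMap.sub_apply, LinearMap.comp_apply, hz, map_zero, zero_sub, LinearMap.id_apply]

/-- All faces but the last commute with the extra degeneracy; the last, with sign `(-1) ^ (m + 2)`,
undoes it. -/
theorem d_op_succ (m : ℕ) (z : ((freeChains k).obj K).X (m + 1)) :
    (((freeChains k).obj K).d (m + 2) (m + 1)).hom (c.op (m + 1) z) =
      c.op m ((((freeChains k).obj K).d (m + 1) m).hom z) + (-1 : k) ^ (m + 2) • z := by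
  have h : (((freeChains k).obj K).d (m + 2) (m + 1)).hom ∘ₗ c.op (m + 1) =
      c.op m ∘ₗ (((freeChains k).obj K).d (m + 1) m).hom + (-1 : k) ^ (m + 2) • LinearMap.id := by
    apply freeChains_ext
    intro x
    rw [LinearMap.comp_apply, op_elt, freeChains_d_elt, Fin.sum_univ_castSucc, c.δ_last,
      LinearMap.add_apply, LinearMap.comp_apply, freeChains_d_elt, map_sum]
    refine congrArg₂ (· + ·) (Finset.sum_congr rfl fun i _ => ?_) rfl
    rw [c.δ_castSucc, map_smul, op_elt]; rfl
  exact LinearMap.congr_fun h z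

theorem acyclic_zero (c : EndContraction K) (z : ((freeChains k).obj K).X 0)
    (hz : ((freeChainsAug k K).f 0).hom z = 0) :
    ∃ y, (((freeChains k).obj K).d 1 0).hom y = z :=
  ⟨-c.op 0 z, by rw [map_neg, c.d_op_zero z hz, neg_neg]⟩

theorem acyclic_succ (c : EndContraction K) (m : ℕ) (z : ((freeChains k).obj K).X (m + 1))
    (hz : (((freeChains k).obj K).d (m + 1) m).hom z = 0) :
    ∃ y, (((freeChains k).obj K).d (m + 2) (m + 1)).hom y = z := by
  refine ⟨(-1 : k) ^ (m + 2) • c.op (m + 1) z, ?_⟩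
  rw [map_smul, d_op_succ, hz, map_zero, zero_add, smul_smul, ← mul_pow, neg_one_mul, neg_neg, one_pow,
    one_smul]

end EndContraction

/-- The nerve of a category with a terminal object is contractible. -/
def nerveContraction {D : Type} [Category.{0} D] {t : D} (ht : Limits.IsTerminal t) :
    EndContraction (nerve D) where
  s _ x := snocTerminal ht x
  pt := ComposableArrows.mk₀ t
  δ_last _ x := snocTerminal_last ht x
  δ_castSucc _ i x := snocTerminal_castSucc ht x i
  δ_zero x := snocTerminal_zero ht x

/-- The extension of a monotone map by the last element. -/
def snocLast {m : ℕ} {n : SimplexCategory} (a : SimplexCategory.mk m ⟶ n) :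
    SimplexCategory.mk (m + 1) ⟶ n :=
  SimplexCategory.mkHom
    { toFun := Fin.lastCases (Fin.last _) a.toOrderHom
      monotone' := by
        intro i j h
        induction j using Fin.lastCases with
        | last => dsimp only; rw [Fin.lastCases_last]; exact Fin.le_last _
        | cast j =>
          induction i using Fin.lastCases with
          | last => exact absurd h (not_le.2 (Fin.castSucc_lt_last j))
          | cast i =>
            dsimp only
            rw [Fin.lastCases_castSucc, Fin.lastCases_castSucc]
            exact a.toOrderHom.monotone (Fin.castSucc_le_castSucc_iff.1 h) }

/-- The standard simplices are contractible. -/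
def stdSimplexContraction (n : SimplexCategory) : EndContraction (SSet.stdSimplex.{0}.obj n) where
  s _ x := SSet.stdSimplex.objEquiv.symm (snocLast (SSet.stdSimplex.objEquiv x))
  pt := SSet.stdSimplex.objEquiv.symm (SimplexCategory.const _ _ (Fin.last _))
  δ_last m x := by
    apply SSet.stdSimplex.objEquiv.injective
    refine SimplexCategory.Hom.ext _ _ (OrderHom.ext _ _ (funext fun j => ?_))
    exact (congrArg (Fin.lastCases (motive := fun _ => Fin (n.len + 1)) _ _)
      (Fin.succAbove_last_apply j)).trans (Fin.lastCases_castSucc _)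
  δ_castSucc m i x := by
    apply SSet.stdSimplex.objEquiv.injective
    refine SimplexCategory.Hom.ext _ _ (OrderHom.ext _ _ (funext fun j => ?_))
    induction j using Fin.lastCases with
    | last =>
      refine Eq.trans ?_ (Fin.lastCases_last (motive := fun _ => Fin (n.len + 1))).symm
      exact (congrArg (Fin.lastCases (motive := fun _ => Fin (n.len + 1)) _ _)
        (Fin.succAbove_castSucc_of_le _ _ (Fin.le_last i))).trans Fin.lastCases_last
    | cast j =>
      refine Eq.trans ?_ (Fin.lastCases_castSucc (motive := fun _ => Fin (n.len + 1)) _).symm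
      exact (congrArg (Fin.lastCases (motive := fun _ => Fin (n.len + 1)) _ _)
        (Fin.castSucc_succAbove_castSucc)).trans (Fin.lastCases_castSucc _)
  δ_zero x := by
    apply SSet.stdSimplex.objEquiv.injective
    refine SimplexCategory.Hom.ext _ _ (OrderHom.ext _ _ (funext fun j => ?_))
    obtain rfl : j = (0 : Fin 1) := Subsingleton.elim (α := Fin 1) _ _
    exact Fin.lastCases_last (motive := fun _ => Fin (n.len + 1))

end FreeChains

/-! ### Projective models: simplices and nerves of slices -/

section AcyclicModels

variable {k : Type u} [CommRing k] {J : Type} [Category.{0} J]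

/-- A functor to modules with the lifting property against pointwise surjections. -/
def PointwiseProjective (G : J ⥤ ModuleCat.{u} k) : Prop :=
  ∀ ⦃E H : J ⥤ ModuleCat.{u} k⦄ (q : E ⟶ H) (h : G ⟶ H),
    (∀ n (x : G.obj n), ∃ y, (q.app n).hom y = (h.app n).hom x) → ∃ l : G ⟶ E, l ≫ q = h

/-- The data `c`, `s`, `r`, `a` exhibit `S` as a coproduct of corepresentable functors with
universal elements `s i`. By Yoneda a lift is fixed by choosing a preimage of the value of `h` at
each universal element. -/
theorem pointwiseProjective_free (S : J ⥤ Type) {ι : Type} (c : ι → J) (s : ∀ i, S.obj (c i))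
    (r : ∀ n, S.obj n → ι) (a : ∀ n (x : S.obj n), c (r n x) ⟶ n)
    (hs : ∀ n x, S.map (a n x) (s (r n x)) = x)
    (hr : ∀ {n n'} (b : n ⟶ n') (x : S.obj n),
      (⟨r n' (S.map b x), a n' (S.map b x)⟩ : Σ i, c i ⟶ n') = ⟨r n x, a n x ≫ b⟩) :
    PointwiseProjective (S ⋙ uliftFunctor.{u, 0} ⋙ ModuleCat.free k) := by
  intro E H q h hq
  choose y hy using fun i => hq (c i) (ModuleCat.freeMk (ULift.up (s i)))
  let t (n : J) (p : Σ i, c i ⟶ n) : E.obj n := (E.map p.2).hom (y p.1)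
  have ht {n n' : J} (b : n ⟶ n') (p : Σ i, c i ⟶ n) :
      t n' ⟨p.1, p.2 ≫ b⟩ = (E.map b).hom (t n p) := by
    change (E.map (p.2 ≫ b)).hom _ = _
    rw [E.map_comp]; rfl
  refine ⟨{ app := fun n => ModuleCat.freeDesc (TypeCat.ofHom fun x : ULift.{u} (S.obj n) =>
              t n ⟨r n x.down, a n x.down⟩)
            naturality := ?_ }, ?_⟩
  · intro n n' b
    apply ModuleCat.free_hom_ext
    intro x
    rw [ModuleCat.comp_apply, ModuleCat.comp_apply]
    refine (congrArg _ (ModuleCat.free_map_apply _ _)).trans ((ModuleCat.freeDesc_apply _ _).trans ?_)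
    refine ((congrArg (t n') (hr b x.down)).trans (ht b ⟨r n x.down, a n x.down⟩)).trans ?_
    refine congrArg (E.map b).hom (Eq.symm ?_)
    exact ModuleCat.freeDesc_apply (TypeCat.ofHom fun x : ULift.{u} (S.obj n) =>
      t n ⟨r n x.down, a n x.down⟩) x
  · ext n : 2
    apply ModuleCat.free_hom_ext
    intro x
    change (q.app n).hom (ModuleCat.Hom.hom (ModuleCat.freeDesc _) _) = _
    refine (congrArg (q.app n).hom (ModuleCat.freeDesc_apply _ _)).trans ?_
    have h1 : (q.app n).hom (t n ⟨r n x.down, a n x.down⟩) =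
        (H.map (a n x.down)).hom ((q.app _).hom (y (r n x.down))) :=
      congrArg (fun f => f.hom (y (r n x.down))) (q.naturality (a n x.down))
    refine (h1.trans (congrArg _ (hy _))).trans ?_
    have h2 := congrArg (fun f => f.hom (ModuleCat.freeMk (ULift.up (s (r n x.down)))))
      (h.naturality (a n x.down))
    refine h2.symm.trans (congrArg (h.app n).hom ?_)
    refine (ModuleCat.free_map_apply _ _).trans (congrArg ModuleCat.freeMk ?_)
    exact congrArg ULift.up (hs n x.down)

/-- The evaluation of a cosimplicial simplicial set in a simplicial degree. -/
def degreeFunctor (S : J ⥤ SSet.{0}) (m : ℕ) : J ⥤ Type :=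
  S ⋙ (evaluation _ _).obj (Opposite.op (SimplexCategory.mk m))

/-- The functor of `m`-simplices of `Δ[n]` is corepresented by `[m]`, with the identity as its
universal element. -/
theorem pointwiseProjective_stdSimplex (m : ℕ) :
    PointwiseProjective (degreeFunctor SSet.stdSimplex.{0} m ⋙ uliftFunctor.{u, 0} ⋙
      ModuleCat.free k) :=
  pointwiseProjective_free (degreeFunctor SSet.stdSimplex.{0} m)
    (ι := Unit) (fun _ => SimplexCategory.mk m) (fun _ => SSet.stdSimplex.objEquiv.symm (𝟙 _))
    (fun _ _ => ⟨⟩) (fun _ x => SSet.stdSimplex.objEquiv x)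
    (fun _ x => SSet.stdSimplex.objEquiv.injective (Category.id_comp (SSet.stdSimplex.objEquiv x)))
    (fun _ _ => rfl)

/-- The universal lift of a sequence of composable arrows to the category over its target. -/
def overLast {D : Type*} [Category D] {m : ℕ} (x : ComposableArrows D m) :
    ComposableArrows (Over (x.obj (Fin.last m))) m where
  obj j := Over.mk (x.map (homOfLE (Fin.le_last j)))
  map f := Over.homMk (x.map f) (by
    dsimp; rw [← x.map_comp]; rfl)

theorem overLast_map {D : Type*} [Category D] {m : ℕ} {d : D} (x : ComposableArrows (Over d) m) :
    overLast (x ⋙ Over.forget d) ⋙ Over.map (x.obj (Fin.last m)).hom = x := by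
  have hobj (j) : (overLast (x ⋙ Over.forget d) ⋙ Over.map (x.obj (Fin.last m)).hom).obj j =
      x.obj j := congrArg Over.mk (Over.w (x.map (homOfLE (Fin.le_last j))))
  refine CategoryTheory.Functor.ext hobj fun i j f => ?_
  ext
  rw [Over.comp_left, Over.comp_left, Over.eqToHom_left, Over.eqToHom_left]
  exact ((Category.id_comp _).trans (Category.comp_id _)).symm

/-- An `m`-simplex of `N(Δ ↓ [n])` is a chain of `m` arrows in `Δ` together with a map from its last
object to `[n]`. So the functor is a coproduct, over such chains, of the functors corepresented by
the last objects. -/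
theorem pointwiseProjective_overNerve (m : ℕ) :
    PointwiseProjective (degreeFunctor overNerve m ⋙ uliftFunctor.{u, 0} ⋙ ModuleCat.free k) :=
  pointwiseProjective_free (degreeFunctor overNerve m)
    (ι := ComposableArrows SimplexCategory m) (fun i => i.obj (Fin.last m)) (fun i => overLast i)
    (fun n x => (x : ComposableArrows (Over n) m) ⋙ Over.forget n)
    (fun n x => ((x : ComposableArrows (Over n) m).obj (Fin.last m)).hom)
    (fun _ x => overLast_map x)
    (fun _ _ => rfl)

end AcyclicModels

end
end DGComod

namespace DGComod
noncomputable section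

/-! ### Acyclic models -/

section AcyclicModels

variable {k : Type u} [CommRing k] {J : Type} [Category.{0} J]

/-- The complex of functors defined by a functor to complexes. -/
def flip (Φ : J ⥤ Ch k) : ChainComplex (J ⥤ ModuleCat.{u} k) ℕ where
  X m := Φ ⋙ HomologicalComplex.eval _ _ m
  d i j :=
    { app := fun n => (Φ.obj n).d i j
      naturality := fun _ _ b => (Φ.map b).comm i j }
  shape i j h := by
    ext n : 2
    exact (Φ.obj n).shape i j h
  d_comp_d' i j l _ _ := by
    ext n : 2
    exact (Φ.obj n).d_comp_d i j l

/-- The morphism of complexes of functors defined by a natural transformation. -/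
def flipMap {Φ Ψ : J ⥤ Ch k} (f : Φ ⟶ Ψ) : flip Φ ⟶ flip Ψ where
  f m := Functor.whiskerRight f (HomologicalComplex.eval _ _ m)
  comm' i j _ := by
    ext n : 2
    exact (f.app n).comm i j

/-- The natural transformation defined by a morphism of complexes of functors. -/
def unflipMap {Φ Ψ : J ⥤ Ch k} (g : flip Φ ⟶ flip Ψ) : Φ ⟶ Ψ where
  app n :=
    { f := fun m => (g.f m).app n
      comm' := fun i j _ => NatTrans.congr_app (g.comm i j) n }
  naturality _ _ b := by
    ext m : 1
    exact (g.f m).naturality b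

/-- A functor to complexes with an augmentation to the unit which is a pointwise resolution. -/
structure IsResolution {Φ : J ⥤ Ch k} (ε : Φ ⟶ (Functor.const J).obj (𝟙_ (Ch k))) : Prop where
  surjective (n : J) (z : (𝟙_ (Ch k)).X 0) : ∃ y, ((ε.app n).f 0).hom y = z
  exact_zero (n : J) (z : (Φ.obj n).X 0) (hz : ((ε.app n).f 0).hom z = 0) :
    ∃ y, ((Φ.obj n).d 1 0).hom y = z
  exact_succ (n : J) (m : ℕ) (z : (Φ.obj n).X (m + 1)) (hz : ((Φ.obj n).d (m + 1) m).hom z = 0) :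
    ∃ y, ((Φ.obj n).d (m + 2) (m + 1)).hom y = z

/-- The usual construction degree by degree: projectivity supplies a natural lift wherever exactness
of the target supplies lifts pointwise. Nothing natural is required of the exactness. -/
theorem exists_lift_of_isResolution {Φ Ψ : J ⥤ Ch k}
    (hΦ : ∀ m, PointwiseProjective ((flip Φ).X m))
    (ε : Φ ⟶ (Functor.const J).obj (𝟙_ (Ch k))) {ε' : Ψ ⟶ (Functor.const J).obj (𝟙_ (Ch k))}
    (hΨ : IsResolution ε') : ∃ f : Φ ⟶ Ψ, f ≫ ε' = ε := by
  obtain ⟨zero, h0⟩ := hΦ 0 (Functor.whiskerRight ε' (HomologicalComplex.eval _ _ 0))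
    (Functor.whiskerRight ε (HomologicalComplex.eval _ _ 0)) (fun n x => hΨ.surjective n _)
  have h0' (n : J) (x : (Φ.obj n).X 0) :
      ((ε'.app n).f 0).hom ((zero.app n).hom x) = ((ε.app n).f 0).hom x :=
    congrArg (fun t => (t.app n).hom x) h0
  obtain ⟨one, h1⟩ := hΦ 1 ((flip Ψ).d 1 0) ((flip Φ).d 1 0 ≫ zero) (fun n x => by
    apply hΨ.exact_zero
    refine (h0' n _).trans ((hom_d (ε.app n) 1 0 x).trans ?_)
    rw [unit_X_eq_zero one_ne_zero (((ε.app n).f 1).hom x), map_zero])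
  let g : flip Φ ⟶ flip Ψ := ChainComplex.mkHom _ _ zero one h1 (fun m p => by
    have h := hΦ (m + 2) ((flip Ψ).d (m + 2) (m + 1)) ((flip Φ).d (m + 2) (m + 1) ≫ p.2.1)
      (fun n x => by
        apply hΨ.exact_succ
        have h1 : (flip Φ).d (m + 2) (m + 1) ≫ p.2.1 ≫ (flip Ψ).d (m + 1) m = 0 := by
          rw [p.2.2, ← Category.assoc, (flip Φ).d_comp_d, Limits.zero_comp]
        exact congrArg (fun t => (t.app n).hom x) h1)
    exact ⟨h.choose, h.choose_spec⟩)
  refine ⟨unflipMap g, ?_⟩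
  ext n : 2
  apply ch_ext
  intro q x
  rcases q with _ | q
  · exact h0' n x
  · exact (unit_X_eq_zero (Nat.succ_ne_zero q) _).trans
      (unit_X_eq_zero (Nat.succ_ne_zero q) _).symm

/-- The difference of two lifts dies in the augmentation, hence is a boundary in degree `0`; in each
higher degree the error left by the previous stage is a cycle and can be lifted naturally. -/
theorem nonempty_homotopy_of_isResolution {Φ Ψ : J ⥤ Ch k}
    (hΦ : ∀ m, PointwiseProjective ((flip Φ).X m))
    {ε' : Ψ ⟶ (Functor.const J).obj (𝟙_ (Ch k))} (hΨ : IsResolution ε') (f g : Φ ⟶ Ψ)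
    (hfg : f ≫ ε' = g ≫ ε') : Nonempty (Homotopy (flipMap f) (flipMap g)) := by
  let e : flip Φ ⟶ flip Ψ := flipMap f - flipMap g
  obtain ⟨zero, h0⟩ : ∃ l : (flip Φ).X 0 ⟶ (flip Ψ).X 1, l ≫ (flip Ψ).d 1 0 = e.f 0 :=
    hΦ 0 ((flip Ψ).d 1 0) (e.f 0) (fun n x => by
    apply hΨ.exact_zero
    have h := congrArg (fun t => ((t.app n).f 0).hom x) hfg
    change ((ε'.app n).f 0).hom (((f.app n).f 0).hom x - ((g.app n).f 0).hom x) = 0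
    rw [map_sub, sub_eq_zero]
    exact h)
  obtain ⟨one, h1⟩ : ∃ l : (flip Φ).X 1 ⟶ (flip Ψ).X 2,
      l ≫ (flip Ψ).d 2 1 = e.f 1 - (flip Φ).d 1 0 ≫ zero :=
    hΦ 1 ((flip Ψ).d 2 1) (e.f 1 - (flip Φ).d 1 0 ≫ zero) (fun n x => by
    apply hΨ.exact_succ
    have h : (e.f 1 - (flip Φ).d 1 0 ≫ zero) ≫ (flip Ψ).d 1 0 = 0 := by
      rw [Preadditive.sub_comp, Category.assoc, h0, e.comm, sub_self]
    exact congrArg (fun t => (t.app n).hom x) h)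
  have ho : Homotopy e 0 := Homotopy.mkInductive e zero h0.symm one (by rw [h1]; abel)
    (fun m p => by
      have h := hΦ (m + 2) ((flip Ψ).d (m + 3) (m + 2))
        (e.f (m + 2) - (flip Φ).d (m + 2) (m + 1) ≫ p.2.1) (fun n x => by
          apply hΨ.exact_succ
          have h : (e.f (m + 2) - (flip Φ).d (m + 2) (m + 1) ≫ p.2.1) ≫
              (flip Ψ).d (m + 2) (m + 1) = 0 := by
            obtain ⟨a, b, hab⟩ := p
            dsimp only
            rw [Preadditive.sub_comp, e.comm, hab, Preadditive.comp_add, ← Category.assoc,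
              (flip Φ).d_comp_d, Limits.zero_comp, zero_add, Category.assoc, sub_self]
          exact congrArg (fun t => (t.app n).hom x) h)
      exact ⟨h.choose, by rw [h.choose_spec]; abel⟩)
  exact ⟨Homotopy.equivSubZero.symm ho⟩

/-- The augmentation of the chains of a diagram of simplicial sets. -/
def diagramAug (S : J ⥤ SSet.{0}) :
    S ⋙ freeChains k ⟶ (Functor.const J).obj (𝟙_ (Ch k)) where
  app n := freeChainsAug k (S.obj n)
  naturality n n' b := by
    apply ch_ext
    intro q x
    rcases q with _ | q
    · have : ((freeChainsAug k (S.obj n')).f 0).hom ∘ₗ (((freeChains k).map (S.map b)).f 0).hom =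
          ((freeChainsAug k (S.obj n)).f 0).hom := by
        apply freeChains_ext
        intro x
        rw [LinearMap.comp_apply, freeChainsAug_elt]
        exact (congrArg _ (ModuleCat.free_map_apply _ _)).trans (freeChainsAug_elt _)
      exact LinearMap.congr_fun this x
    · exact (unit_X_eq_zero (Nat.succ_ne_zero q) _).trans
        (unit_X_eq_zero (Nat.succ_ne_zero q) _).symm

theorem isResolution_diagramAug (S : J ⥤ SSet.{0}) (c : ∀ n, EndContraction (S.obj n)) :
    IsResolution (diagramAug (k := k) S) where
  surjective n z := by
    refine ⟨unitDesc (chainElt (c n).pt) z, ?_⟩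
    have : ((freeChainsAug k (S.obj n)).f 0).hom ∘ₗ unitDesc (chainElt (c n).pt) =
        LinearMap.id := by
      apply unit_ext
      rw [LinearMap.comp_apply, unitDesc_unitElt, freeChainsAug_elt, LinearMap.id_apply]
    exact LinearMap.congr_fun this z
  exact_zero n z hz := (c n).acyclic_zero z hz
  exact_succ n m z hz := (c n).acyclic_succ m z hz

end AcyclicModels

/-! ### Comparison of the two weights -/

section Weights

variable (k : Type u) [CommRing k]

/-- The inclusion of the normalized chains of the nerves of the categories over a simplex. -/
def weightInclusion : holimWeight k ⟶ overNerve ⋙ freeChains k :=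
  Functor.whiskerLeft (overNerve ⋙ freeSimplicial k)
    (AlgebraicTopology.inclusionOfMooreComplex (ModuleCat.{u} k))

/-- The projection to the normalized chains of the nerves of the categories over a simplex. -/
def weightProjection : overNerve ⋙ freeChains k ⟶ holimWeight k where
  app n := AlgebraicTopology.DoldKan.PInftyToNormalizedMooreComplex
    ((freeSimplicial k).obj (overNerve.obj n))
  naturality _ _ b := AlgebraicTopology.DoldKan.PInftyToNormalizedMooreComplex_naturality
    ((freeSimplicial k).map (overNerve.map b))

theorem weightInclusion_projection : weightInclusion k ≫ weightProjection k = 𝟙 _ := by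
  ext n : 2
  exact (AlgebraicTopology.DoldKan.splitMonoInclusionOfMooreComplexMap
    ((freeSimplicial k).obj (overNerve.obj n))).id

/-- The projection of the chains of the standard simplices to the normalized chains. -/
def simplexProjTrans : simplexChains k ⟶ simplexChains k where
  app n := simplexProj k n
  naturality _ _ b := simplexProj_naturality b

/-- The augmentation of the weight for homotopy limits. -/
def holimAug : holimWeight k ⟶ (Functor.const SimplexCategory).obj (𝟙_ (Ch k)) where
  app n := normalizedChainsAug k (overNerve.obj n)
  naturality _ _ b := (normalizedChainsAug_naturality k (overNerve.map b)).trans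
    (Category.comp_id _).symm

/-- The augmentation sees only degree `0`, where the Dold–Kan projector is the identity. -/
theorem weightProjection_aug : weightProjection k ≫ holimAug k = diagramAug overNerve := by
  ext n : 2
  let S := (freeSimplicial k).obj (overNerve.obj n)
  have h := AlgebraicTopology.DoldKan.PInftyToNormalizedMooreComplex_comp_inclusionOfMooreComplexMap S
  apply ch_ext
  intro q x
  rcases q with _ | q
  · have h' := congrArg (fun t => (t.f 0).hom x) h
    exact congrArg ((freeChainsAug k (overNerve.obj n)).f 0).hom h'
  · exact (unit_X_eq_zero (Nat.succ_ne_zero q) _).trans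
      (unit_X_eq_zero (Nat.succ_ne_zero q) _).symm

theorem simplexProjTrans_aug :
    simplexProjTrans k ≫ diagramAug SSet.stdSimplex.{0} = diagramAug SSet.stdSimplex.{0} := by
  ext n : 2
  apply ch_ext
  intro q x
  rcases q with _ | q
  · rfl
  · exact (unit_X_eq_zero (Nat.succ_ne_zero q) _).trans
      (unit_X_eq_zero (Nat.succ_ne_zero q) _).symm

/-- The weight for homotopy limits is a homotopy retract of the normalized chains of the standard
simplices. -/
theorem exists_weight_retraction : ∃ (φ : holimWeight k ⟶ simplexChains k)
    (ψ : simplexChains k ⟶ holimWeight k),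
    (∀ n, ψ.app n ≫ normalizedChainsAug k (overNerve.obj n) = simplexAug k n) ∧
    Nonempty (Homotopy (flipMap (φ ≫ simplexProjTrans k ≫ ψ)) (𝟙 (flip (holimWeight k)))) := by
  have hA : IsResolution (diagramAug (k := k) SSet.stdSimplex.{0}) :=
    isResolution_diagramAug _ stdSimplexContraction
  have hU : IsResolution (diagramAug (k := k) overNerve) :=
    isResolution_diagramAug _ (fun n => nerveContraction (D := Over n) Over.mkIdTerminal)
  obtain ⟨a, ha⟩ := exists_lift_of_isResolution (Φ := overNerve ⋙ freeChains k)
    pointwiseProjective_overNerve (diagramAug overNerve) hA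
  obtain ⟨b, hb⟩ := exists_lift_of_isResolution (Φ := SSet.stdSimplex.{0} ⋙ freeChains k)
    pointwiseProjective_stdSimplex (diagramAug SSet.stdSimplex.{0}) hU
  -- Both the round trip through normalized chains of `Δ[n]` and the identity cover the identity of
  -- the constant functor. The projector is put in the middle because `totLift_totEval` produces it.
  obtain ⟨h⟩ := nonempty_homotopy_of_isResolution (Φ := overNerve ⋙ freeChains k)
    pointwiseProjective_overNerve hU
    (a ≫ simplexProjTrans k ≫ b) (𝟙 _)
    ((congrArg (fun t => a ≫ simplexProjTrans k ≫ t) hb).trans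
      ((congrArg (fun t => a ≫ t) (simplexProjTrans_aug k)).trans
        (ha.trans (Category.id_comp _).symm)))
  refine ⟨weightInclusion k ≫ a, b ≫ weightProjection k, fun n => ?_, ⟨?_⟩⟩
  · have : (b ≫ weightProjection k) ≫ holimAug k = diagramAug SSet.stdSimplex.{0} := by
      rw [Category.assoc, weightProjection_aug, hb]
    exact congrArg (fun t => t.app n) this
  · have h' := (h.compLeft (flipMap (weightInclusion k))).compRight (flipMap (weightProjection k))
    refine (Homotopy.ofEq ?_).trans (h'.trans (Homotopy.ofEq ?_))
    · rfl
    · exact congrArg flipMap (weightInclusion_projection k)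

end Weights

end
end DGComod

namespace DGComod
noncomputable section

namespace RightComodule

variable {V : Type u} [Category.{v} V] [MonoidalCategory V] {C : V} [ComonObj C]

/-- The associativity of the tensor product with a comodule. -/
@[simps]
def tensorAssocHom (W W' : V) (A : RightComodule C) :
    tensorLeft W (tensorLeft W' A) ⟶ tensorLeft (W ⊗ W') A where
  hom := (α_ W W' A.X).inv
  comm := by simp

/-- The morphism from a comodule to its tensor product which is defined by a morphism from the
unit. -/
@[simps]
def tensorIncl {W : V} (e : 𝟙_ V ⟶ W) (A : RightComodule C) : A ⟶ tensorLeft W A where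
  hom := (λ_ A.X).inv ≫ e ▷ A.X
  comm := by
    simp only [tensorLeft_X, Category.assoc, comp_whiskerRight]
    rw [← whisker_exchange_assoc, ← leftUnitor_inv_naturality_assoc]
    simp

end RightComodule

/-! ### The interval complex and chain homotopies -/

section Interval

variable (k : Type u) [CommRing k]

/-- The modules of the normalized chains of the interval. -/
def intervalX : ℕ → ModuleCat.{u} k
  | 0 => ModuleCat.of k (k × k)
  | 1 => ModuleCat.of k k
  | _ + 2 => ModuleCat.of k PUnit

/-- The differential of the normalized chains of the interval. -/
def intervalD : ∀ n, intervalX k (n + 1) ⟶ intervalX k n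
  | 0 => ModuleCat.ofHom (LinearMap.prod (-LinearMap.id) LinearMap.id : k →ₗ[k] k × k)
  | _ + 1 => 0

/-- The normalized chains of the interval. -/
def interval : Ch k :=
  ChainComplex.of (intervalX k) (intervalD k) (fun _ => Limits.zero_comp)

/-- The coordinate of the first vertex. -/
def intervalFst : (interval k).X 0 →ₗ[k] k := LinearMap.fst k k k

/-- The coordinate of the second vertex. -/
def intervalSnd : (interval k).X 0 →ₗ[k] k := LinearMap.snd k k k

/-- The coordinate of the edge. -/
def intervalCoord : (interval k).X 1 →ₗ[k] k := LinearMap.id (M := k)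

/-- The vertices of the interval. -/
def intervalPoint (j : Fin 2) : (interval k).X 0 :=
  if j = 0 then ((1, 0) : k × k) else ((0, 1) : k × k)

/-- The edge of the interval. -/
def intervalEdge : (interval k).X 1 := (1 : k)

theorem interval_d_one (x : (interval k).X 1) :
    ((interval k).d 1 0).hom x =
      ((-intervalCoord k x, intervalCoord k x) : k × k) := by
  have h : (interval k).d 1 0 = intervalD k 0 := ChainComplex.of_d (intervalX k) (intervalD k) 0
  exact congrArg (fun t => t.hom x) h

theorem interval_d_edge :
    ((interval k).d 1 0).hom (intervalEdge k) = intervalPoint k 1 - intervalPoint k 0 := by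
  refine (interval_d_one k _).trans ?_
  have h : ((-1, 1) : k × k) = (0, 1) - (1, 0) := by simp
  exact h

variable {k}

theorem interval_X_eq_zero (n : ℕ) (x : (interval k).X (n + 2)) : x = 0 :=
  Subsingleton.elim (α := PUnit) x 0

variable (k)

/-- The inclusions of the vertices of the interval. -/
def intervalVertex (j : Fin 2) : 𝟙_ (Ch k) ⟶ interval k :=
  HomologicalComplex.mkHomFromSingle
    (show ModuleCat.of k k ⟶ (interval k).X 0 from
      ModuleCat.ofHom (X := k) (Y := (interval k).X 0)
        (LinearMap.toSpanSingleton k ((interval k).X 0) (intervalPoint k j)))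
    (fun i hi => by simp at hi)

theorem intervalVertex_unitElt (j : Fin 2) :
    ((intervalVertex k j).f 0).hom (unitElt k) = intervalPoint k j := by
  have h : (intervalVertex k j).f 0 = _ := HomologicalComplex.mkHomFromSingle_f _ _
  exact (congrArg (fun t => t.hom (unitElt k)) h).trans (unitDesc_unitElt (intervalPoint k j))

variable {k}

/-- A morphism of complexes, as a family of maps between all degrees. -/
def gradedHom {A B : Ch k} (f : A ⟶ B) (i n : ℕ) : A.X i →ₗ[k] B.X n :=
  if h : i = n then (f.f i ≫ eqToHom (by rw [h])).hom else 0

theorem gradedHom_self {A B : Ch k} (f : A ⟶ B) (n : ℕ) : gradedHom f n n = (f.f n).hom := by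
  rw [gradedHom, dif_pos rfl, eqToHom_refl, Category.comp_id]

/-- The bilinear map defined by a linear map and a linear form. -/
def scaleBy {M N P : Type*} [AddCommGroup M] [AddCommGroup N] [AddCommGroup P] [Module k M]
    [Module k N] [Module k P] (L : M →ₗ[k] P) (c : N →ₗ[k] k) : M →ₗ[k] N →ₗ[k] P :=
  (LinearMap.lsmul k P).flip.compl₁₂ L c

theorem homotopy_apply_succ {A B : Ch k} {f g : A ⟶ B} (h : Homotopy f g) (n : ℕ)
    (a : A.X (n + 1)) : (f.f (n + 1)).hom a = (h.hom n (n + 1)).hom ((A.d (n + 1) n).hom a) +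
      (B.d (n + 2) (n + 1)).hom ((h.hom (n + 1) (n + 2)).hom a) + (g.f (n + 1)).hom a := by
  have := h.comm (n + 1)
  rw [Homotopy.dNext_succ_chainComplex, Homotopy.prevD_chainComplex] at this
  exact congrArg (fun t => t.hom a) this

theorem homotopy_apply_zero {A B : Ch k} {f g : A ⟶ B} (h : Homotopy f g) (a : A.X 0) :
    (f.f 0).hom a = (B.d 1 0).hom ((h.hom 0 1).hom a) + (g.f 0).hom a := by
  have := h.comm 0
  rw [Homotopy.dNext_zero_chainComplex, Homotopy.prevD_chainComplex, zero_add] at this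
  exact congrArg (fun t => t.hom a) this

/-- The components of `intervalDesc`. -/
def intervalBilin {A B : Ch k} {f g : A ⟶ B} (h : Homotopy f g) (i : ℕ) :
    ∀ j n, A.X i →ₗ[k] (interval k).X j →ₗ[k] B.X n
  -- The edge has boundary the second vertex minus the first, so the source `f` of the homotopy sits
  -- at the second vertex and `g` at the first.
  | 0, n => scaleBy (gradedHom g i n) (intervalFst k) + scaleBy (gradedHom f i n) (intervalSnd k)
  -- The interval stands on the right, so its differential passes an element of degree `i`; this
  -- sign turns the Leibniz rule into `f = h d + d h + g`.
  | 1, n => (-1 : k) ^ i • scaleBy (h.hom i n).hom (intervalCoord k)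
  | _ + 2, _ => 0

/-- The morphism out of the tensor product with an interval defined by a homotopy. -/
def intervalDesc {A B : Ch k} {f g : A ⟶ B} (h : Homotopy f g) : A ⊗ interval k ⟶ B :=
  tensorDesc (intervalBilin h) (by
    intro i j n hij a b
    match j, b, hij with
    | 0, b, hij =>
      obtain rfl : i = n + 1 := hij
      change (B.d (n + 1) n).hom (intervalFst k b • gradedHom g (n + 1) (n + 1) a +
          intervalSnd k b • gradedHom f (n + 1) (n + 1) a) =
        intervalFst k b • gradedHom g n n ((A.d (n + 1) n).hom a) +
          intervalSnd k b • gradedHom f n n ((A.d (n + 1) n).hom a) +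
        (-1 : k) ^ (n + 1) • intervalBilin h (n + 1) 0 n a (((interval k).d 0 0).hom b)
      rw [d_zero_zero, map_zero, smul_zero, add_zero, gradedHom_self, gradedHom_self,
        gradedHom_self, gradedHom_self, map_add, map_smul, map_smul, hom_d, hom_d]
    | 1, b, hij =>
      obtain rfl : i = n := Nat.succ.inj hij
      change (B.d (i + 1) i).hom ((-1 : k) ^ i • intervalCoord k b • (h.hom i (i + 1)).hom a) =
        (-1 : k) ^ (i - 1) • intervalCoord k b • (h.hom (i - 1) i).hom ((A.d i (i - 1)).hom a) +
        (-1 : k) ^ i • (intervalFst k (((interval k).d 1 0).hom b) • gradedHom g i i a +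
          intervalSnd k (((interval k).d 1 0).hom b) • gradedHom f i i a)
      have h1 : intervalFst k (((interval k).d 1 0).hom b) = -intervalCoord k b :=
        congrArg (LinearMap.fst k k k) (interval_d_one k b)
      have h2 : intervalSnd k (((interval k).d 1 0).hom b) = intervalCoord k b :=
        congrArg (LinearMap.snd k k k) (interval_d_one k b)
      rw [h1, h2, gradedHom_self, gradedHom_self, map_smul, map_smul]
      rcases i with _ | i
      · rw [homotopy_apply_zero h a, d_zero_zero, map_zero]
        module
      · rw [homotopy_apply_succ h i a, Nat.add_sub_cancel, pow_succ]
        module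
    | j + 2, b, hij =>
      rw [interval_X_eq_zero j b]
      simp)

theorem intervalDesc_tm {A B : Ch k} {f g : A ⟶ B} (h : Homotopy f g) {i j n : ℕ}
    (hij : i + j = n) (a : A.X i) (b : (interval k).X j) :
    ((intervalDesc h).f n).hom (tm A (interval k) i j n a b) = intervalBilin h i j n a b :=
  tensorDesc_tm _ _ hij a b

theorem intervalDesc_point_zero {A B : Ch k} {f g : A ⟶ B} (h : Homotopy f g) (n : ℕ)
    (a : A.X n) : ((intervalDesc h).f n).hom (tm A (interval k) n 0 n a (intervalPoint k 0)) =
      (g.f n).hom a := by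
  rw [intervalDesc_tm h (add_zero n)]
  change (1 : k) • gradedHom g n n a + (0 : k) • gradedHom f n n a = _
  rw [one_smul, zero_smul, add_zero, gradedHom_self]

theorem intervalDesc_point_one {A B : Ch k} {f g : A ⟶ B} (h : Homotopy f g) (n : ℕ)
    (a : A.X n) : ((intervalDesc h).f n).hom (tm A (interval k) n 0 n a (intervalPoint k 1)) =
      (f.f n).hom a := by
  rw [intervalDesc_tm h (add_zero n)]
  change (0 : k) • gradedHom g n n a + (1 : k) • gradedHom f n n a = _
  rw [one_smul, zero_smul, zero_add, gradedHom_self]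

/-- A morphism out of the tensor product with an interval defines a homotopy. -/
def homotopyOfInterval {A B : Ch k} (K : interval k ⊗ A ⟶ B) :
    Homotopy ((λ_ A).inv ≫ intervalVertex k 1 ▷ A ≫ K)
      ((λ_ A).inv ≫ intervalVertex k 0 ▷ A ≫ K) := by
  have hv (j : Fin 2) (q : ℕ) (b : A.X q) :
      (((λ_ A).inv ≫ intervalVertex k j ▷ A ≫ K).f q).hom b =
        (K.f q).hom (tm (interval k) A 0 q q (intervalPoint k j) b) := by
    rw [comp_hom_apply, comp_hom_apply, leftUnitor_inv_apply, whiskerRight_tm,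
      intervalVertex_unitElt]
  have hd (q : ℕ) (b : A.X q) :
      (B.d (q + 1) q).hom ((K.f (q + 1)).hom (tm (interval k) A 1 q (q + 1) (intervalEdge k) b)) =
      (K.f q).hom (tm (interval k) A 0 q q (intervalPoint k 1) b) -
      (K.f q).hom (tm (interval k) A 0 q q (intervalPoint k 0) b) -
      (K.f q).hom (tm (interval k) A 1 (q - 1) q (intervalEdge k) ((A.d q (q - 1)).hom b)) := by
    rw [← hom_d, d_tm_all, Nat.sub_self, interval_d_edge, map_sub, LinearMap.sub_apply, pow_one,
      map_add, map_sub, map_smul, neg_one_smul, sub_eq_add_neg _ ((K.f q).hom (tm _ _ 1 _ _ _ _))]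
  refine homotopyOfComponents
    (fun q => (K.f (q + 1)).hom ∘ₗ tm (interval k) A 1 q (q + 1) (intervalEdge k)) ?_ ?_
  · intro a
    rw [hv, hv, LinearMap.comp_apply, hd, d_zero_zero, map_zero, map_zero]
    abel
  · intro q a
    rw [hv, hv, LinearMap.comp_apply, LinearMap.comp_apply, hd, Nat.add_sub_cancel]
    abel

end Interval
end
end DGComod

namespace DGComod
noncomputable section

/-! ### Homotopic weights and homotopic maps of weighted limits -/

open RightComodule

section Cones

variable {V : Type u} [Category.{v} V] [MonoidalCategory V] {C : V} [ComonObj C]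
  {W : SimplexCategory ⥤ V} {F : Cosimplicial (RightComodule C)}

theorem WeightedCone.IsLimit.lift_eq {T S : WeightedCone W F} (hT : T.IsLimit)
    {f : S.pt ⟶ T.pt} (hf : IsFactorization S T f) : f = hT.lift S :=
  (hT S).unique hf (hT.lift_spec S)

theorem WeightedCone.IsLimit.lift_precomp_id {T : WeightedCone W F} (hT : T.IsLimit) :
    hT.lift (T.precomp (𝟙 W)) = 𝟙 T.pt := by
  refine (hT.lift_eq (S := T.precomp (𝟙 W)) (f := 𝟙 T.pt) fun n => ?_).symm
  rfl

/-- The cone whose vertex is the tensor product of the vertex of `T` with `I`, which is defined by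
natural morphisms `W ⊗ I ⟶ W`. -/
def WeightedCone.tensor (T : WeightedCone W F) {I : V}
    (a : ∀ n : SimplexCategory, W.obj n ⊗ I ⟶ W.obj n)
    (ha : ∀ {n n' : SimplexCategory} (b : n ⟶ n'), W.map b ▷ I ≫ a n' = a n ≫ W.map b) :
    WeightedCone W F where
  pt := tensorLeft I T.pt
  π n := tensorAssocHom _ _ _ ≫ tensorMap (a _) (𝟙 T.pt) ≫ T.π n
  π_d n i := by
    rw [Category.assoc, Category.assoc, T.π_d, ← Category.assoc (tensorMap _ _) (tensorMap _ _),
      tensorMap_comp_tensorMap, ← ha, ← tensorMap_comp_tensorMap]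
    have : tensorMap (W.map (SimplexCategory.δ i)) (𝟙 (tensorLeft I T.pt)) ≫
        tensorAssocHom _ _ _ = tensorAssocHom _ _ _ ≫
          tensorMap (W.map (SimplexCategory.δ i) ▷ I) (𝟙 T.pt) := by
      ext; simp
    rw [← Category.assoc (tensorMap _ (𝟙 (tensorLeft I T.pt))), this]
    simp only [Category.assoc]
  π_s n i := by
    rw [Category.assoc, Category.assoc, T.π_s, ← Category.assoc (tensorMap _ _) (tensorMap _ _),
      tensorMap_comp_tensorMap, ← ha, ← tensorMap_comp_tensorMap]
    have : tensorMap (W.map (SimplexCategory.σ i)) (𝟙 (tensorLeft I T.pt)) ≫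
        tensorAssocHom _ _ _ = tensorAssocHom _ _ _ ≫
          tensorMap (W.map (SimplexCategory.σ i) ▷ I) (𝟙 T.pt) := by
      ext; simp
    rw [← Category.assoc (tensorMap _ (𝟙 (tensorLeft I T.pt))), this]
    simp only [Category.assoc]

/-- Restricting a family of endomorphisms of the weight parametrized by `I` to a point of `I` gives
the endomorphism induced at that point. For the interval this identifies the two ends of the
homotopy. -/
theorem WeightedCone.IsLimit.tensorIncl_lift {T : WeightedCone W F} (hT : T.IsLimit) {I : V}
    (a : ∀ n : SimplexCategory, W.obj n ⊗ I ⟶ W.obj n)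
    (ha : ∀ {n n' : SimplexCategory} (b : n ⟶ n'), W.map b ▷ I ≫ a n' = a n ≫ W.map b)
    (e : 𝟙_ V ⟶ I) (f : W ⟶ W) (hf : ∀ n, (ρ_ _).inv ≫ W.obj n ◁ e ≫ a n = f.app n) :
    tensorIncl e T.pt ≫ hT.lift (T.tensor a ha) = hT.lift (T.precomp f) := by
  refine hT.lift_eq (S := T.precomp f) fun n => ?_
  have key (K : tensorLeft I T.pt ⟶ T.pt) (hK : tensorMap (𝟙 (W.obj (SimplexCategory.mk n))) K ≫
      T.π n = tensorAssocHom _ _ _ ≫ tensorMap (a _) (𝟙 T.pt) ≫ T.π n) :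
      tensorMap (𝟙 (W.obj (SimplexCategory.mk n))) (tensorIncl e T.pt ≫ K) ≫ T.π n =
        tensorMap (f.app _) (𝟙 T.pt) ≫ T.π n := by
    have h1 : tensorMap (𝟙 (W.obj (SimplexCategory.mk n))) (tensorIncl e T.pt ≫ K) =
        tensorMap (𝟙 _) (tensorIncl e T.pt) ≫ tensorMap (𝟙 _) K := by
      ext; simp
    have h2 : tensorMap (𝟙 (W.obj (SimplexCategory.mk n))) (tensorIncl e T.pt) ≫
        tensorAssocHom _ _ _ ≫ tensorMap (a _) (𝟙 T.pt) = tensorMap (f.app _) (𝟙 T.pt) := by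
      ext
      rw [← hf]
      simp
    rw [h1, Category.assoc, hK, ← h2]
    simp only [Category.assoc]
  exact key _ (hT.lift_spec (T.tensor a ha) n)

end Cones

section Homotopy

variable {k : Type u} [CommRing k] {C : Ch k} [ComonObj C] {W : SimplexCategory ⥤ Ch k}
  {F : Cosimplicial (RightComodule C)}

/-- The value of a homotopy between natural transformations at an object. -/
def homotopyApp {J : Type} [Category.{0} J] {Φ Ψ : J ⥤ Ch k} {f g : Φ ⟶ Ψ}
    (h : Homotopy (flipMap f) (flipMap g)) (n : J) : Homotopy (f.app n) (g.app n) where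
  hom i j := (h.hom i j).app n
  zero i j hij := by rw [h.zero i j hij]; rfl
  comm i := congrArg (fun t => t.app n) (h.comm i)

/-- Homotopic endomorphisms of the weight induce homotopic endomorphisms of the weighted limit. -/
def WeightedCone.IsLimit.liftHomotopy {T : WeightedCone W F} (hT : T.IsLimit) {f g : W ⟶ W}
    (h : Homotopy (flipMap f) (flipMap g)) :
    Homotopy (hT.lift (T.precomp f)).hom (hT.lift (T.precomp g)).hom := by
  have ha {n n' : SimplexCategory} (b : n ⟶ n') : W.map b ▷ interval k ≫
      intervalDesc (homotopyApp h n') = intervalDesc (homotopyApp h n) ≫ W.map b := by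
    apply ch_tensor_ext
    intro q i j hij w x
    rw [comp_hom_apply, comp_hom_apply, whiskerRight_tm, intervalDesc_tm _ hij,
      intervalDesc_tm _ hij]
    match j, x, hij with
    | 0, x, hij =>
      obtain rfl : i = q := hij
      change intervalFst k x • gradedHom (g.app n') i i _ +
          intervalSnd k x • gradedHom (f.app n') i i _ =
        ((W.map b).f i).hom (intervalFst k x • gradedHom (g.app n) i i w +
          intervalSnd k x • gradedHom (f.app n) i i w)
      rw [map_add, map_smul, map_smul, gradedHom_self, gradedHom_self, gradedHom_self,
        gradedHom_self]
      exact congrArg₂ (fun s t => intervalFst k x • s + intervalSnd k x • t)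
        (congrArg (fun t => (t.f i).hom w) (g.naturality b))
        (congrArg (fun t => (t.f i).hom w) (f.naturality b))
    | 1, x, hij =>
      change (-1 : k) ^ i • intervalCoord k x • ((h.hom i q).app n').hom _ =
        ((W.map b).f q).hom ((-1 : k) ^ i • intervalCoord k x • ((h.hom i q).app n).hom w)
      refine Eq.trans ?_ ((map_smul ((W.map b).f q).hom _ _).trans
        (congrArg _ (map_smul ((W.map b).f q).hom _ _))).symm
      exact congrArg (fun t => (-1 : k) ^ i • intervalCoord k x • t)
        (congrArg (fun t => t.hom w) ((h.hom i q).naturality b))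
    | _ + 2, x, hij => exact (map_zero ((W.map b).f q).hom).symm
  have he (j : Fin 2) (e : W ⟶ W) (h' : ∀ n m (w : (W.obj n).X m),
      ((intervalDesc (homotopyApp h n)).f m).hom (tm _ _ m 0 m w (intervalPoint k j)) =
        ((e.app n).f m).hom w) (n) : (ρ_ _).inv ≫ W.obj n ◁ intervalVertex k j ≫
        intervalDesc (homotopyApp h n) = e.app n := by
    apply ch_ext
    intro m w
    rw [comp_hom_apply, comp_hom_apply, rightUnitor_inv_apply, whiskerLeft_tm,
      intervalVertex_unitElt, h']
  -- The interval is moved from the weight to the vertex of the cone, and the universal property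
  -- then gives a map out of `interval k ⊗ T.pt`, which is a homotopy.
  let K := hT.lift (T.tensor (fun n => intervalDesc (homotopyApp h n)) ha)
  have h1 := hT.tensorIncl_lift _ ha (intervalVertex k 1) f (he 1 f fun n m w =>
    intervalDesc_point_one _ m w)
  have h0 := hT.tensorIncl_lift _ ha (intervalVertex k 0) g (he 0 g fun n m w =>
    intervalDesc_point_zero _ m w)
  refine (Homotopy.ofEq ?_).trans ((homotopyOfInterval K.hom).trans (Homotopy.ofEq ?_))
  · exact (congrArg Hom.hom h1).symm.trans (Category.assoc _ _ _)
  · exact ((Category.assoc _ _ _).symm.trans (congrArg Hom.hom h0))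

end Homotopy

end
end DGComod

namespace DGComod
noncomputable section

/-! ### Comparing the homotopy limit with the total complex -/

open RightComodule

section Cones

variable {V : Type u} [Category.{v} V] [MonoidalCategory V]

theorem whiskerLeft_comp_comp_of_eq {A B D W Y Z : V} {f : B ⟶ D} {t : D ⟶ Y} {ev : A ⊗ Y ⟶ Z}
    {P : A ⟶ A} {ψ : A ⟶ W} {l : W ⊗ D ⟶ Z} {l' : W ⊗ B ⟶ Z}
    (h : A ◁ t ≫ ev = P ▷ D ≫ ψ ▷ D ≫ l) (h' : W ◁ f ≫ l = l') :
    A ◁ (f ≫ t) ≫ ev = P ▷ B ≫ ψ ▷ B ≫ l' := by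
  rw [whiskerLeft_comp, Category.assoc, h, ← h', whisker_exchange_assoc, whisker_exchange_assoc]

theorem whiskerLeft_comp_comp_of_eq' {A D W Y Z : V} {t : D ⟶ Y} {ev : A ⊗ Y ⟶ Z}
    {P : A ⟶ A} {ψ : A ⟶ W} {φ : W ⟶ A} {l : W ⊗ D ⟶ Z} {r : Y ⟶ D}
    (h : A ◁ t ≫ ev = P ▷ D ≫ ψ ▷ D ≫ l) (h' : W ◁ r ≫ l = φ ▷ Y ≫ ev) :
    (𝟙 W ⊗ₘ t ≫ r) ≫ l = ((φ ≫ P ≫ ψ) ⊗ₘ 𝟙 D) ≫ l := by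
  rw [id_tensorHom, tensorHom_id, whiskerLeft_comp, Category.assoc, h', whisker_exchange_assoc, h]
  simp only [comp_whiskerRight, Category.assoc]

theorem whiskerRight_comp_of_eq {A W E D Z : V} {ψ : A ⟶ W} {ε : W ⟶ E} {ε' : A ⟶ E}
    (h : ψ ≫ ε = ε') (t : E ⊗ D ⟶ Z) : ψ ▷ D ≫ ε ▷ D ≫ t = ε' ▷ D ≫ t := by
  rw [← h, comp_whiskerRight, Category.assoc]

variable {C : V} [ComonObj C] {F : Cosimplicial (RightComodule C)}
  {W W' : SimplexCategory ⥤ V}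

/-- The legs of a cone, as morphisms of the underlying objects. -/
def WeightedCone.legHom (T : WeightedCone W F) (n : SimplexCategory) :
    W.obj n ⊗ T.pt.X ⟶ (F.toFunctor ⋙ forget C).obj n := (T.leg n).hom

theorem WeightedCone.precomp_legHom (T : WeightedCone W F)
    (ψ : W' ⟶ W) (n : SimplexCategory) :
    (T.precomp ψ).legHom n = ψ.app n ▷ T.pt.X ≫ T.legHom n := by
  change (ψ.app n ⊗ₘ 𝟙 T.pt.X) ≫ _ = _
  rw [tensorHom_id]
  rfl

theorem WeightedCone.IsLimit.whiskerLeft_lift {T : WeightedCone W F} (hT : T.IsLimit)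
    (S : WeightedCone W F) (n : SimplexCategory) :
    W.obj n ◁ (hT.lift S).hom ≫ T.legHom n = S.legHom n := by
  have h := congrArg Hom.hom (hT.lift_spec S n.len)
  refine Eq.trans ?_ h
  change _ = (𝟙 _ ⊗ₘ (hT.lift S).hom) ≫ _
  rw [id_tensorHom]
  rfl

theorem coaugCone_legHom (ε : ∀ n, W.obj n ⟶ 𝟙_ V)
    (hε : ∀ {m n} (f : m ⟶ n), W.map f ≫ ε n = ε m) (X : RightComodule C) (n : SimplexCategory) :
    (coaugCone W ε hε X).legHom n = ε n ▷ X.X ≫ (λ_ X.X).hom ≫ (coaug X (n.len + 1)).hom := by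
  change (ε n ⊗ₘ 𝟙 X.X) ≫ _ = _
  rw [tensorHom_id]
  rfl

end Cones

section Comparison

variable {k : Type u} [CommRing k] {C : Ch k} [ComonObj C] {F : Cosimplicial (RightComodule C)}
  {W : SimplexCategory ⥤ Ch k} {T : WeightedCone W F}

theorem WeightedCone.whiskerLeft_toTot (S : WeightedCone (simplexChains k) F)
    (n : SimplexCategory) :
    (simplexChains k).obj n ◁ S.toTot ≫ totEval (F.toFunctor ⋙ forget C) n =
      simplexProj k n ▷ S.pt.X ≫ S.legHom n :=
  totLift_totEval (Φ := F.toFunctor ⋙ forget C) S.legHom S.leg_hom_naturality n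

/-- The morphism to the total complex which is defined by a cone. -/
def WeightedCone.precompToTot (T : WeightedCone W F) (ψ : simplexChains k ⟶ W) :
    T.pt.X ⟶ tot (F.toFunctor ⋙ forget C) :=
  (T.precomp ψ).toTot

theorem WeightedCone.whiskerLeft_precompToTot (T : WeightedCone W F) (ψ : simplexChains k ⟶ W)
    (n : SimplexCategory) :
    (simplexChains k).obj n ◁ T.precompToTot ψ ≫ totEval (F.toFunctor ⋙ forget C) n =
      simplexProj k n ▷ T.pt.X ≫ ψ.app n ▷ T.pt.X ≫ T.legHom n :=
  ((T.precomp ψ).whiskerLeft_toTot n).trans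
    (congrArg (fun t => simplexProj k n ▷ T.pt.X ≫ t) (T.precomp_legHom ψ n))

/-- Maps into `tot` are determined by their evaluations, and on these the defining property of the
lift applies. -/
theorem WeightedCone.IsLimit.lift_hom_toTot (hT : T.IsLimit) (S : WeightedCone W F)
    (ψ : simplexChains k ⟶ W) :
    (hT.lift S).hom ≫ T.precompToTot ψ = S.precompToTot ψ :=
  tot_hom_ext fun n =>
    (whiskerLeft_comp_comp_of_eq (T.whiskerLeft_precompToTot ψ n) (hT.whiskerLeft_lift S n)).trans
      (S.whiskerLeft_precompToTot ψ n).symm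

variable (hF : IsSteep (F.toFunctor ⋙ forget C))

/-- The morphism of comodules to the total complex which is defined by a cone. -/
def WeightedCone.toTotComodule (T : WeightedCone W F) (ψ : simplexChains k ⟶ W) :
    T.pt ⟶ totComodule hF :=
  totComoduleHom hF (T.precompToTot ψ)
    (fun n => tensorMap (simplexProj k n ≫ ψ.app n) (𝟙 T.pt) ≫ T.leg n) (fun n => by
      refine (T.whiskerLeft_precompToTot ψ n).trans ?_
      change _ = ((simplexProj k n ≫ ψ.app n) ⊗ₘ 𝟙 T.pt.X) ≫ T.legHom n
      rw [tensorHom_id, comp_whiskerRight, Category.assoc])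

/-- The tautological cone on the total complex. -/
def totCone : WeightedCone (simplexChains k) F :=
  WeightedCone.ofNatural (totComodule hF) (totComoduleEval hF) (fun {n n'} b => by
    apply Hom.ext
    refine Eq.trans ?_ ((congrArg (fun t => t ≫ totEval (F.toFunctor ⋙ forget C) n')
      (tensorHom_id ((simplexChains k).map b) (tot (F.toFunctor ⋙ forget C)))).symm)
    exact (totEval_naturality (F.toFunctor ⋙ forget C) b).symm)

/-- The morphism from the total complex to a weighted limit. -/
def WeightedCone.IsLimit.ofTot (hT : T.IsLimit) (φ : W ⟶ simplexChains k) :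
    totComodule hF ⟶ T.pt :=
  hT.lift ((totCone hF).precomp φ)

theorem WeightedCone.IsLimit.whiskerLeft_ofTot (hT : T.IsLimit) (φ : W ⟶ simplexChains k)
    (n : SimplexCategory) :
    W.obj n ◁ (hT.ofTot hF φ).hom ≫ T.legHom n =
      φ.app n ▷ tot (F.toFunctor ⋙ forget C) ≫ totEval (F.toFunctor ⋙ forget C) n :=
  (hT.whiskerLeft_lift _ n).trans ((totCone hF).precomp_legHom φ n)

/-- On legs the round trip through `tot` is precomposition with `ψ`, the projector and `φ`, so
uniqueness of lifts identifies it with the map induced by an endomorphism of the weight. Lifting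
against `T` requires `tot` to be a comodule, which is where steepness enters. -/
theorem WeightedCone.IsLimit.toTotComodule_ofTot (hT : T.IsLimit) (φ : W ⟶ simplexChains k)
    (ψ : simplexChains k ⟶ W) :
    T.toTotComodule hF ψ ≫ hT.ofTot hF φ =
      hT.lift (T.precomp (φ ≫ simplexProjTrans k ≫ ψ)) := by
  refine hT.lift_eq (S := T.precomp (φ ≫ simplexProjTrans k ≫ ψ)) fun n => ?_
  apply Hom.ext
  exact whiskerLeft_comp_comp_of_eq' (T.whiskerLeft_precompToTot ψ (SimplexCategory.mk n))
    (hT.whiskerLeft_ofTot hF φ (SimplexCategory.mk n))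

/-- A homotopy retraction of weights induces a homotopy retraction of weighted limits. -/
def WeightedCone.IsLimit.retractionHomotopy (hT : T.IsLimit) {φ : W ⟶ simplexChains k}
    {ψ : simplexChains k ⟶ W}
    (h : Homotopy (flipMap (φ ≫ simplexProjTrans k ≫ ψ)) (𝟙 (flip W))) :
    Homotopy (T.precompToTot ψ ≫ (hT.ofTot hF φ).hom) (𝟙 T.pt.X) :=
  (Homotopy.ofEq (congrArg Hom.hom (hT.toTotComodule_ofTot hF φ ψ))).trans
    ((hT.liftHomotopy (g := 𝟙 W) h).trans (Homotopy.ofEq (congrArg Hom.hom hT.lift_precomp_id)))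

/-- On homology `g` is mono, having a left inverse, and epi, because `f ≫ g` is an isomorphism. So
`g` is a quasi-isomorphism, and two out of three gives the claim for `f`. -/
theorem quasiIso_of_comp_of_homotopy {A B D : Ch k} (f : A ⟶ B) (g : B ⟶ D) (r : D ⟶ B)
    [QuasiIso (f ≫ g)] (h : Homotopy (g ≫ r) (𝟙 B)) : QuasiIso f := by
  have : QuasiIso g := by
    rw [quasiIso_iff]
    intro i
    rw [quasiIsoAt_iff_isIso_homologyMap]
    have h1 : HomologicalComplex.homologyMap g i ≫ HomologicalComplex.homologyMap r i = 𝟙 _ := by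
      rw [← HomologicalComplex.homologyMap_comp, h.homologyMap_eq,
        HomologicalComplex.homologyMap_id]
    have : Mono (HomologicalComplex.homologyMap g i) := mono_of_mono_fac h1
    have h2 : IsIso (HomologicalComplex.homologyMap f i ≫ HomologicalComplex.homologyMap g i) := by
      rw [← HomologicalComplex.homologyMap_comp]
      infer_instance
    have : Epi (HomologicalComplex.homologyMap g i) :=
      epi_of_epi (HomologicalComplex.homologyMap f i) _
    exact isIso_of_mono_of_epi _
  exact quasiIso_of_comp_right f g

theorem quasiIso_toCobarResolution (hC : IsSimplyConnected C) (X : RightComodule C)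
    {T : WeightedCone (holimWeight k) (cobar X)} (hT : IsHomotopyLimit T) :
    QuasiIso (toCobarResolution X hT).hom := by
  obtain ⟨φ, ψ, hψ, ⟨h⟩⟩ := exists_weight_retraction k
  -- Both cones are the coaugmentation precomposed with the augmentation of the weight, and `ψ`
  -- respects the augmentations.
  have hcone : (cobarCone X).precompToTot ψ = (simplexCone X).toTot := by
    refine tot_hom_ext fun n => ((cobarCone X).whiskerLeft_precompToTot ψ n).trans
      (Eq.trans ?_ ((simplexCone X).whiskerLeft_toTot n).symm)
    refine congrArg (fun t => simplexProj k n ▷ X.X ≫ t) ?_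
    refine (congrArg (fun t => ψ.app n ▷ X.X ≫ t) (coaugCone_legHom _
        (fun f => normalizedChainsAug_naturality k (overNerve.map f)) X n)).trans
      (Eq.trans ?_ (coaugCone_legHom (simplexAug k) (fun f => simplexAug_naturality f) X n).symm)
    exact whiskerRight_comp_of_eq (hψ n) _
  have hcomp : (toCobarResolution X hT).hom ≫ T.precompToTot ψ = (simplexCone X).toTot :=
    (hT.lift_hom_toTot (cobarCone X) ψ).trans hcone
  have : QuasiIso ((toCobarResolution X hT).hom ≫ T.precompToTot ψ) := by
    rw [hcomp]
    exact quasiIso_toTot X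
  exact quasiIso_of_comp_of_homotopy _ _ _ (hT.retractionHomotopy (hC.isSteep_cobar X) h)

end Comparison

end
end DGComod

open DGComod in
theorem lemma3 {k : Type u} [CommRing k] {n : ℕ} (hn : 1 ≤ n) (K : Fin n → Type v)
    [∀ i, Field (K i)] (e : k ≃+* (∀ i, K i))
    (C : Ch k) [ComonObj C] (hC : IsSimplyConnected C) (X : RightComodule C) :
    (∃ T : WeightedCone (holimWeight k) (cobar X), IsHomotopyLimit T) ∧
    ∀ (T : WeightedCone (holimWeight k) (cobar X)) (hT : IsHomotopyLimit T),
      IsWeakEquivalence (toCobarResolution X hT) := by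
  -- A finite product of fields is semisimple; the form of `k` is used only here.
  have : IsSemisimpleRing k := e.symm.isSemisimpleRing
  exact ⟨exists_isLimit_cobar (holimWeight k) X,
    fun T hT => quasiIso_toCobarResolution hC X hT⟩
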